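/- For $r,q\ge 2$, the $(r\times q)$-grid is the graph on the pairs $(i,j)$, $1\le i\le r$, $1\le j\le q$, in which $(i_1,j_1)$ and $(i_2,j_2)$ are adjacent iff $|i_1-i_2|+|j_1-j_2|=1$. A finite simple graph $G$ is $k$-contractible to a graph $H$ if there is a surjection $\psi:V(G)\to V(H)$ such that every set $W(h)=\psi^{-1}(h)$ is connected in $G$, distinct $h,h'$ are adjacent in $H$ iff some edge of $G$ joins $W(h)$ to $W(h')$, and a union of spanning trees of all the sets $W(h)$ has at most $k$ edges (that is, $H$ is obtained from $G$ by at most $k$ edge contractions). Grid Contraction is the problem of deciding, for a finite simple graph $G$ and an integer $k\ge 0$ (the parameter), whether $G$ is $k$-contractible to some $(r\times q)$-grid with $r,q\ge 2$. Theorem. Grid Contraction admits a kernel with $O(k^4)$ vertices and edges. That is, there are a constant $C$ and an algorithm which, given an instance $(G,k)$, runs in time polynomial in the size of the instance ($G$ given by its adjacency matrix, $k$ in binary) and returns an instance $(G',k')$ with $k'\le k$ such that $(G',k')$ is a yes-instance iff $(G,k)$ is one, and $|V(G')|\le C(k^4+1)$ and $|E(G')|\le C(k^4+1)$. -/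

import Mathlib

/-! ### Grids and contractions -/

namespace GridContraction

/-- The `r × q` grid: vertices are the pairs `(i, j)`, and two of them are adjacent iff
`|i₁ - i₂| + |j₁ - j₂| = 1`. -/
def gridGraph (r q : ℕ) : SimpleGraph (Fin r × Fin q) where
  Adj x y := ((x.1 : ℤ) - (y.1 : ℤ)).natAbs + ((x.2 : ℤ) - (y.2 : ℤ)).natAbs = 1
  symm := ⟨by intro x y h; omega⟩
  loopless := ⟨by intro x h; omega⟩

/-- `G` is contractible to `H` via `ψ`: the map `ψ` is onto, all witness sets
`W(h) = {v | ψ v = h}` are connected (and non-empty) in `G`, and distinct `h`, `h'` are adjacent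
in `H` iff some edge of `G` joins `W(h)` and `W(h')`. -/
structure IsContractibleVia {V W : Type*} (G : SimpleGraph V) (H : SimpleGraph W) (ψ : V → W) :
    Prop where
  surjective : Function.Surjective ψ
  connected : ∀ h : W, (G.induce {v | ψ v = h}).Connected
  adj_iff : ∀ h h' : W, h ≠ h' →
    (H.Adj h h' ↔ ∃ u v : V, ψ u = h ∧ ψ v = h' ∧ G.Adj u v)

/-- `F` is a union of spanning trees of the witness sets of `ψ`, one for each witness set. -/
structure IsSpanningForestOf {V W : Type*} (G : SimpleGraph V) (ψ : V → W) (F : SimpleGraph V) :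
    Prop where
  le : F ≤ G
  inside : ∀ u v : V, F.Adj u v → ψ u = ψ v
  isTree : ∀ h : W, (F.induce {v | ψ v = h}).IsTree

/-- `G` is `k`-contractible to `H`: it is contractible to `H` via some map such that the union of
spanning trees of the witness sets has at most `k` edges. -/
def IsKContractible {V W : Type*} [Finite V] (G : SimpleGraph V) (H : SimpleGraph W) (k : ℕ) :
    Prop :=
  ∃ ψ : V → W, IsContractibleVia G H ψ ∧
    ∃ F : SimpleGraph V, IsSpanningForestOf G ψ F ∧ F.edgeSet.ncard ≤ k

/-- An instance: a finite simple graph (on the vertices `0, …, n - 1`) and a number `k`, the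
parameter. -/
structure Inst where
  n : ℕ
  graph : SimpleGraph (Fin n)
  k : ℕ

/-- Yes-instances: the graph is `k`-contractible to a grid with at least two rows and at least two
columns. -/
def Inst.IsYes (I : Inst) : Prop :=
  ∃ r q : ℕ, 2 ≤ r ∧ 2 ≤ q ∧ IsKContractible I.graph (gridGraph r q) I.k

/-- The number of bits of an instance: adjacency matrix, and `k` in binary. -/
def Inst.size (I : Inst) : ℕ := I.n * I.n + Nat.size I.k

end GridContraction

/-! ### Random access machines

Structured programs for a random access machine with number variables and (two-dimensional)
arrays of numbers. The only arithmetic is addition and truncated subtraction, so that one step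
lengthens the binary representation of the largest stored number by at most one bit. Hence
counting every operation as one step gives the same polynomial-time functions as
Turing machines. -/

namespace RAM

/-- A memory state: the contents of the variables, and of the cells `(i, j)` of the arrays. -/
@[ext]
structure State where
  var : ℕ → ℕ
  arr : ℕ → ℕ → ℕ → ℕ

/-- Arithmetic expressions; `read a i j` is the content of cell `(i, j)` of array `a`. -/
inductive Expr where
  | const (c : ℕ)
  | var (x : ℕ)
  | read (a : ℕ) (i j : Expr)
  | add (e f : Expr)
  | sub (e f : Expr)

/-- The value of an expression. -/
def Expr.eval (s : State) : Expr → ℕ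
  | .const c => c
  | .var x => s.var x
  | .read a i j => s.arr a (i.eval s) (j.eval s)
  | .add e f => e.eval s + f.eval s
  | .sub e f => e.eval s - f.eval s

/-- The number of operations in the evaluation of an expression. -/
def Expr.cost : Expr → ℕ
  | .const _ => 1
  | .var _ => 1
  | .read _ i j => i.cost + j.cost + 1
  | .add e f => e.cost + f.cost + 1
  | .sub e f => e.cost + f.cost + 1

/-- Programs. A test `e` of `ite` and `loop` is true iff its value is not `0`; `loop e p` is
"while `e` do `p`". -/
inductive Prog where
  | skip
  | assign (x : ℕ) (e : Expr)
  | store (a : ℕ) (i j e : Expr)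
  | seq (p q : Prog)
  | ite (e : Expr) (p q : Prog)
  | loop (e : Expr) (p : Prog)

/-- Assignment of a value to a variable. -/
def State.setVar (s : State) (x v : ℕ) : State :=
  ⟨Function.update s.var x v, s.arr⟩

/-- Assignment of a value to a cell of an array. -/
def State.setArr (s : State) (a i j v : ℕ) : State :=
  ⟨s.var, Function.update s.arr a
    (Function.update (s.arr a) i (Function.update (s.arr a i) j v))⟩

/-- `Exec p s t s'`: started in the state `s`, the program `p` halts after exactly `t` steps in the
state `s'`. -/
inductive Exec : Prog → State → ℕ → State → Prop where
  | skip (s : State) : Exec .skip s 1 s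
  | assign (x : ℕ) (e : Expr) (s : State) :
      Exec (.assign x e) s (e.cost + 1) (s.setVar x (e.eval s))
  | store (a : ℕ) (i j e : Expr) (s : State) :
      Exec (.store a i j e) s (i.cost + j.cost + e.cost + 1)
        (s.setArr a (i.eval s) (j.eval s) (e.eval s))
  | seq {p q : Prog} {s s' s'' : State} {t t' : ℕ} :
      Exec p s t s' → Exec q s' t' s'' → Exec (.seq p q) s (t + t') s''
  | ite_true {e : Expr} {p q : Prog} {s s' : State} {t : ℕ} :
      e.eval s ≠ 0 → Exec p s t s' → Exec (.ite e p q) s (e.cost + 1 + t) s'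
  | ite_false {e : Expr} {p q : Prog} {s s' : State} {t : ℕ} :
      e.eval s = 0 → Exec q s t s' → Exec (.ite e p q) s (e.cost + 1 + t) s'
  | loop_true {e : Expr} {p : Prog} {s s' s'' : State} {t t' : ℕ} :
      e.eval s ≠ 0 → Exec p s t s' → Exec (.loop e p) s' t' s'' →
        Exec (.loop e p) s (e.cost + 1 + t + t') s''
  | loop_false {e : Expr} {p : Prog} {s : State} :
      e.eval s = 0 → Exec (.loop e p) s (e.cost + 1) s

end RAM

/-! ### Polynomial-time maps between instances, and kernels -/

namespace GridContraction

open Classical in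
/-- The input state: `n` in variable `0`, `k` in variable `1`, the adjacency matrix in
array `0`, and zeros everywhere else. -/
noncomputable def Inst.toState (I : Inst) : RAM.State where
  var x := if x = 0 then I.n else if x = 1 then I.k else 0
  arr a i j :=
    if a = 0 ∧ ∃ (hi : i < I.n) (hj : j < I.n), I.graph.Adj ⟨i, hi⟩ ⟨j, hj⟩ then 1 else 0

open Classical in
/-- The output convention: the state `s` holds the instance `I`, in the same format as the input;
what is stored elsewhere does not matter. -/
def Inst.IsOutput (I : Inst) (s : RAM.State) : Prop :=
  s.var 0 = I.n ∧ s.var 1 = I.k ∧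
    ∀ i j : Fin I.n, s.arr 0 i j = if I.graph.Adj i j then 1 else 0

/-- The map `f` is computed by one program, whose number of steps is at most a polynomial in the
size of the instance. -/
def IsPolyTime (f : Inst → Inst) : Prop :=
  ∃ (P : RAM.Prog) (p : Polynomial ℕ), ∀ I : Inst, ∃ (t : ℕ) (s : RAM.State),
    RAM.Exec P I.toState t s ∧ (f I).IsOutput s ∧ t ≤ p.eval I.size

/-- `f` is a kernelization algorithm: it runs in polynomial time, its output is a yes-instance
iff its input is one, and it does not increase the parameter. -/
structure IsKernelization (f : Inst → Inst) : Prop where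
  polyTime : IsPolyTime f
  isYes_iff : ∀ I : Inst, (f I).IsYes ↔ I.IsYes
  param_le : ∀ I : Inst, (f I).k ≤ I.k

end GridContraction

/-! ### A language of terms with bounded sums, compiled to RAM programs -/

namespace RAM

/-! Any union of spanning trees of the witness sets has `|V| - rq` edges, so the question is whether
some contraction onto an `r × q` grid leaves at most `k` vertices beyond one per cell. Such a map
has at most `2k` vertices that share a cell; everywhere else the graph looks like the grid. Long
regular pieces can be shortened, and a yes-instance without long regular pieces is small.

Shortening. A slab is the product of a graph `P` and a path, attached to the rest only at its first
and last columns; let `P` be connected with at least two vertices. Among `6k + 3` columns there are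
`2k + 1` disjoint triples of consecutive ones, so in some triple all vertices are alone in their
cells (`GridMap.exists_aloneColumns`). The 4-cycles of the triple then become unit squares,
consecutive squares over an edge of `P` form a straight strip, and connectedness of `P` spreads this
to all rows. Up to a symmetry of the grid, the triple is therefore exactly three full columns of the
grid (`GridMap.exists_aligned`). Hence `|P| = r`, and inserting or deleting a column there changes
both `|V|` and `rq` by `r`, which preserves the excess (`contractible_slabGraph_succ`).

Finding slabs. From an edge, transport across 4-cycles yields the first two columns, breadth-first
search yields the others as levels, and the local conditions `IsSlab` certify the outcome; whatever
passes the test with `M = 6k + 4` levels may be shortened (`Detects.contractible_iff`). Conversely,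
if a yes-instance has a grid side of length at least `(k + 1)(M + 2)`, then one of `k + 1` disjoint
blocks of `M + 2` columns has only single-vertex cells, and the search from its corner succeeds
(`GridMap.exists_cleanZone`, `CleanZone.detects`). So when nothing is detected both sides are below
`6(k + 1)²`, whence `|V| ≤ 36(k + 1)⁴ + k` (`card_le_of_not_detects`). The edges are linear in `|V|`
up to `O(k²)`, since a vertex sees at most five cells (`Contractible.sum_adj_le`). A graph that
exceeds these bounds is replaced by a fixed no-instance.

Running time. The algorithm is written in a small language whose only loops run over `0, …, N - 1`;
every program of it compiles to a polynomial-time RAM program (`Term.exec_compile`,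
`Cmd.exec_compile`). -/

/-- Terms; `sum x t` is the sum of the values of `t` for `x = 0, …, N - 1`, where `N` is the value
of variable `0`. -/
inductive Term where
  | const (c : ℕ)
  | var (x : ℕ)
  | read (a : ℕ) (i j : Term)
  | add (e f : Term)
  | sub (e f : Term)
  | ite (c e f : Term)
  | sum (x : ℕ) (t : Term)

/-- The value of a term. -/
def Term.eval : Term → State → ℕ
  | .const c, _ => c
  | .var x, s => s.var x
  | .read a i j, s => s.arr a (i.eval s) (j.eval s)
  | .add e f, s => e.eval s + f.eval s
  | .sub e f, s => e.eval s - f.eval s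
  | .ite c e f, s => if c.eval s ≠ 0 then e.eval s else f.eval s
  | .sum x t, s => ∑ i ∈ Finset.range (s.var 0), t.eval (s.setVar x i)

/-- All variables of the term are below `D`, and variable `0` is not bound in it. -/
def Term.WF (D : ℕ) : Term → Prop
  | .const _ => True
  | .var x => x < D
  | .read _ i j => i.WF D ∧ j.WF D
  | .add e f => e.WF D ∧ f.WF D
  | .sub e f => e.WF D ∧ f.WF D
  | .ite c e f => c.WF D ∧ e.WF D ∧ f.WF D
  | .sum x t => 0 < x ∧ x < D ∧ t.WF D

/-- `for x = 0, …, N - 1 do p`, after which `x` gets back its old value, saved in `v`. -/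
def forProg (x v : ℕ) (p : Prog) : Prog :=
  .seq (.assign v (.var x)) (.seq (.assign x (.const 0))
    (.seq (.loop (.sub (.var 0) (.var x)) (.seq p (.assign x (.add (.var x) (.const 1)))))
      (.assign x (.var v))))

/-- A program which stores the value of a term in variable `d`. -/
def Term.compile : Term → ℕ → Prog
  | .const c, d => .assign d (.const c)
  | .var x, d => .assign d (.var x)
  | .read a i j, d => .seq (i.compile d) (.seq (j.compile (d + 1))
      (.assign d (.read a (.var d) (.var (d + 1)))))
  | .add e f, d => .seq (e.compile d) (.seq (f.compile (d + 1))
      (.assign d (.add (.var d) (.var (d + 1)))))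
  | .sub e f, d => .seq (e.compile d) (.seq (f.compile (d + 1))
      (.assign d (.sub (.var d) (.var (d + 1)))))
  | .ite c e f, d => .seq (c.compile d) (.ite (.var d) (e.compile d) (f.compile d))
  | .sum x t, d => .seq (.assign d (.const 0)) (forProg x (d + 1)
      (.seq (t.compile (d + 2)) (.assign d (.add (.var d) (.var (d + 2))))))

open Polynomial in
/-- A bound for the running time of `Term.compile`, in terms of the value of variable `0`. -/
noncomputable def Term.time : Term → Polynomial ℕ
  | .const _ => 2
  | .var _ => 2
  | .read _ i j => i.time + j.time + 4
  | .add e f => e.time + f.time + 4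
  | .sub e f => e.time + f.time + 4
  | .ite c e f => c.time + e.time + f.time + 2
  | .sum _ t => X * (t.time + 4 + 8) + 12 + 2

@[simp] lemma State.setVar_var (s : State) (x v y : ℕ) :
    (s.setVar x v).var y = if y = x then v else s.var y := by
  simp [State.setVar, Function.update_apply]

@[simp] lemma State.setVar_arr (s : State) (x v : ℕ) : (s.setVar x v).arr = s.arr := rfl

/-- The test `N - x` is non-zero exactly while the counter is below `N`. Evaluating it costs `4` per
round, including the last, failing one. -/
lemma exec_counting_loop {x N c : ℕ} {p : Prog} (I : ℕ → State → Prop)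
    (hI : ∀ i s, I i s → s.var 0 = N ∧ s.var x = i)
    (hstep : ∀ i < N, ∀ s, I i s → ∃ t s', Exec p s t s' ∧ I (i + 1) s' ∧ t ≤ c)
    (n : ℕ) : ∀ i s, i + n = N → I i s →
      ∃ t s', Exec (.loop (.sub (.var 0) (.var x)) p) s t s' ∧ I N s' ∧ t ≤ n * (c + 4) + 4 := by
  induction n with
  | zero =>
    intro i s hi h
    obtain rfl : i = N := by omega
    refine ⟨_, s, .loop_false ?_, h, ?_⟩
    · simp [Expr.eval, hI _ _ h]
    · simp [Expr.cost]
  | succ n ih =>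
    intro i s hi h
    obtain ⟨t, s', h1, h2, h3⟩ := hstep i (by omega) s h
    obtain ⟨t', s'', h4, h5, h6⟩ := ih (i + 1) s' (by omega) h2
    refine ⟨_, s'', .loop_true ?_ h1 h4, h5, ?_⟩
    · simp only [Expr.eval, hI _ _ h]; omega
    · simp only [Expr.cost]
      have : (n + 1) * (c + 4) = n * (c + 4) + (c + 4) := by ring
      omega

/-- The invariant `J` has to survive arbitrary changes of `x`, since the counter is initialised,
incremented and finally restored outside the body. Per round, `8` pays for the test and the
increment; `12` covers saving, resetting, the last test and restoring. -/
lemma exec_forProg {x v N c : ℕ} {p : Prog} {s : State} (J : ℕ → State → Prop)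
    (hJ : ∀ i s', J i s' → s'.var 0 = N ∧ s'.var v = s.var x)
    (hJx : ∀ i s' z, J i s' → J i (s'.setVar x z))
    (hstep : ∀ i < N, ∀ s', J i s' → s'.var x = i →
      ∃ t s'', Exec p s' t s'' ∧ J (i + 1) s'' ∧ s''.var x = i ∧ t ≤ c)
    (h0 : J 0 (s.setVar v (s.var x))) :
    ∃ t s', Exec (forProg x v p) s t s' ∧ J N s' ∧ s'.var x = s.var x ∧
      t ≤ N * (c + 8) + 12 := by
  obtain ⟨t, s', h1, h2, h3⟩ := exec_counting_loop (x := x) (N := N) (c := c + 4)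
    (p := .seq p (.assign x (.add (.var x) (.const 1))))
    (fun i s' => J i s' ∧ s'.var x = i)
    (fun i s' h => ⟨(hJ _ _ h.1).1, h.2⟩)
    (by
      rintro i hi s' ⟨h1, h2⟩
      obtain ⟨t, s'', h3, h4, h5, h6⟩ := hstep i hi s' h1 h2
      refine ⟨_, _, .seq h3 (.assign _ _ _), ⟨hJx _ _ _ h4, ?_⟩, ?_⟩
      · simp [Expr.eval, h5]
      · simp only [Expr.cost]; omega)
    N 0 ((s.setVar v (s.var x)).setVar x 0) (by omega) ⟨hJx _ _ _ h0, by simp⟩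
  refine ⟨_, _, .seq (.assign _ _ _) (.seq (.assign _ _ _) (.seq h1 (.assign _ _ _))),
    hJx _ _ _ h2.1, ?_, ?_⟩
  · simp [Expr.eval, (hJ _ _ h2.1).2]
  · simp only [Expr.cost]
    have : N * (c + 4 + 4) = N * (c + 8) := by ring
    omega

/-- The states have the same arrays and the same variables below `D`. -/
def State.Agree (D : ℕ) (s s₀ : State) : Prop :=
  s.arr = s₀.arr ∧ ∀ y < D, s.var y = s₀.var y

/-- Two states are compared because the running program also holds temporaries, stored from `d ≥ D`
on. The value of a well-formed term depends only on the arrays and the variables below `D`, so it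
may be computed in the clean state `s₀`. -/
lemma Term.exec_compile {D : ℕ} (hD : 0 < D) (e : Term) (he : e.WF D) (d : ℕ) (hd : D ≤ d)
    (s₀ s : State) (hs : s.Agree D s₀) :
    ∃ t s', Exec (e.compile d) s t s' ∧ s'.arr = s.arr ∧ (∀ y < d, s'.var y = s.var y) ∧
      s'.var d = e.eval s₀ ∧ t ≤ e.time.eval (s₀.var 0) := by
  induction e generalizing d s₀ s with
  | const c =>
    refine ⟨_, _, .assign _ _ _, rfl, ?_, ?_, ?_⟩
    · intro y hy; simp; omega
    · simp [Term.eval, Expr.eval]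
    · simp [Expr.cost, Term.time]
  | var x =>
    refine ⟨_, _, .assign _ _ _, rfl, ?_, ?_, ?_⟩
    · intro y hy; simp; omega
    · simp [Term.eval, Expr.eval, hs.2 x he]
    · simp [Expr.cost, Term.time]
  | read a i j ihi ihj =>
    obtain ⟨t1, s1, h1, a1, v1, r1, b1⟩ := ihi he.1 d hd s₀ s hs
    have hs1 : s1.Agree D s₀ := ⟨a1.trans hs.1, fun y hy => (v1 y (by omega)).trans (hs.2 y hy)⟩
    obtain ⟨t2, s2, h2, a2, v2, r2, b2⟩ := ihj he.2 (d + 1) (by omega) s₀ s1 hs1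
    refine ⟨_, _, .seq h1 (.seq h2 (.assign _ _ _)), a2.trans a1, ?_, ?_, ?_⟩
    · intro y hy
      simp only [State.setVar_var]
      rw [if_neg (by omega), v2 y (by omega), v1 y hy]
    · simp [Term.eval, Expr.eval, r2, v2 d (by omega), r1, a2, a1, hs.1]
    · simp [Expr.cost, Term.time]; omega
  | add e f ihi ihj =>
    obtain ⟨t1, s1, h1, a1, v1, r1, b1⟩ := ihi he.1 d hd s₀ s hs
    have hs1 : s1.Agree D s₀ := ⟨a1.trans hs.1, fun y hy => (v1 y (by omega)).trans (hs.2 y hy)⟩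
    obtain ⟨t2, s2, h2, a2, v2, r2, b2⟩ := ihj he.2 (d + 1) (by omega) s₀ s1 hs1
    refine ⟨_, _, .seq h1 (.seq h2 (.assign _ _ _)), a2.trans a1, ?_, ?_, ?_⟩
    · intro y hy
      simp only [State.setVar_var]
      rw [if_neg (by omega), v2 y (by omega), v1 y hy]
    · simp [Term.eval, Expr.eval, r2, v2 d (by omega), r1]
    · simp [Expr.cost, Term.time]; omega
  | sub e f ihi ihj =>
    obtain ⟨t1, s1, h1, a1, v1, r1, b1⟩ := ihi he.1 d hd s₀ s hs
    have hs1 : s1.Agree D s₀ := ⟨a1.trans hs.1, fun y hy => (v1 y (by omega)).trans (hs.2 y hy)⟩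
    obtain ⟨t2, s2, h2, a2, v2, r2, b2⟩ := ihj he.2 (d + 1) (by omega) s₀ s1 hs1
    refine ⟨_, _, .seq h1 (.seq h2 (.assign _ _ _)), a2.trans a1, ?_, ?_, ?_⟩
    · intro y hy
      simp only [State.setVar_var]
      rw [if_neg (by omega), v2 y (by omega), v1 y hy]
    · simp [Term.eval, Expr.eval, r2, v2 d (by omega), r1]
    · simp [Expr.cost, Term.time]; omega
  | ite c e f ihc ihe ihf =>
    obtain ⟨t1, s1, h1, a1, v1, r1, b1⟩ := ihc he.1 d hd s₀ s hs
    have hs1 : s1.Agree D s₀ := ⟨a1.trans hs.1, fun y hy => (v1 y (by omega)).trans (hs.2 y hy)⟩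
    by_cases hc : c.eval s₀ = 0
    · obtain ⟨t2, s2, h2, a2, v2, r2, b2⟩ := ihf he.2.2 d hd s₀ s1 hs1
      refine ⟨_, _, .seq h1 (.ite_false (by simp [Expr.eval, r1, hc]) h2), a2.trans a1, ?_, ?_, ?_⟩
      · intro y hy; rw [v2 y hy, v1 y hy]
      · simp [Term.eval, hc, r2]
      · simp [Expr.cost, Term.time]; omega
    · obtain ⟨t2, s2, h2, a2, v2, r2, b2⟩ := ihe he.2.1 d hd s₀ s1 hs1
      refine ⟨_, _, .seq h1 (.ite_true (by simp [Expr.eval, r1, hc]) h2), a2.trans a1, ?_, ?_, ?_⟩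
      · intro y hy; rw [v2 y hy, v1 y hy]
      · simp [Term.eval, hc, r2]
      · simp [Expr.cost, Term.time]; omega
  | sum x e ih =>
    obtain ⟨hx0, hxD, he⟩ := he
    obtain ⟨t, s', h1, h2, h3, h4⟩ := exec_forProg (x := x) (v := d + 1) (N := s₀.var 0)
      (c := e.time.eval (s₀.var 0) + 4)
      (p := .seq (e.compile (d + 2)) (.assign d (.add (.var d) (.var (d + 2)))))
      (s := s.setVar d 0)
      (fun i s' => s'.arr = s.arr ∧ (∀ y < d, y ≠ x → s'.var y = s.var y) ∧
        s'.var (d + 1) = s.var x ∧ s'.var d = ∑ j ∈ Finset.range i, e.eval (s₀.setVar x j))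
      (by
        rintro i s' ⟨h1, h2, h3, h4⟩
        refine ⟨?_, ?_⟩
        · rw [h2 0 (by omega) (by omega), hs.2 0 hD]
        · rw [h3]; simp; omega)
      (by
        rintro i s' z ⟨h1, h2, h3, h4⟩
        refine ⟨h1, ?_, ?_, ?_⟩
        · intro y hy hyx; simp [hyx, h2 y hy hyx]
        · simp [h3]; omega
        · simp [h4]; omega)
      (by
        rintro i hi s' ⟨h1, h2, h3, h4⟩ hix
        obtain ⟨t2, s2, e2, a2, v2, r2, b2⟩ := ih he (d + 2) (by omega) (s₀.setVar x i) s' (by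
          refine ⟨by simpa [h1] using hs.1, ?_⟩
          intro y hy
          by_cases hyx : y = x
          · subst hyx; simp [hix]
          · simp only [State.setVar_var, if_neg hyx]
            rw [h2 y (by omega) hyx, hs.2 y hy])
        refine ⟨_, _, .seq e2 (.assign _ _ _), ⟨a2.trans h1, ?_, ?_, ?_⟩, ?_, ?_⟩
        · intro y hy hyx
          simp only [State.setVar_var]
          rw [if_neg (by omega), v2 y (by omega), h2 y hy hyx]
        · simp only [State.setVar_var]
          rw [if_neg (by omega), v2 _ (by omega), h3]
        · simp only [State.setVar_var, Expr.eval, if_true]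
          rw [v2 d (by omega), r2, h4, Finset.sum_range_succ]
        · simp only [State.setVar_var]
          rw [if_neg (by omega), v2 _ (by omega), hix]
        · simp only [Expr.cost]
          have : (s₀.setVar x i).var 0 = s₀.var 0 := by simp; omega
          rw [this] at b2
          omega)
      (by
        refine ⟨rfl, ?_, ?_, ?_⟩
        · intro y hy hyx
          simp only [State.setVar_var]
          rw [if_neg (by omega), if_neg (by omega)]
        · simp; omega
        · simp)
    refine ⟨_, _, .seq (.assign _ _ _) h1, h2.1, ?_, ?_, ?_⟩
    · intro y hy
      by_cases hyx : y = x
      · rw [hyx, h3]; simp; omega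
      · exact h2.2.1 y hy hyx
    · simpa [Term.eval] using h2.2.2.2
    · simp only [Expr.cost, Term.time, Polynomial.eval_add, Polynomial.eval_mul,
        Polynomial.eval_X, Polynomial.eval_ofNat]
      omega

/-! ### Commands with bounded loops and their compilation -/

/-- Commands; `rep x c` executes `c` for `x = 0, …, N - 1`, where `N` is the value of
variable `0`. -/
inductive Cmd where
  | set (x : ℕ) (e : Term)
  | store (a : ℕ) (i j e : Term)
  | seq (c c' : Cmd)
  | cond (e : Term) (c : Cmd)
  | rep (x : ℕ) (c : Cmd)

/-- The states in the iteration of a command `f` for `x = 0, 1, …`. -/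
def iterStates (f : State → State) (x : ℕ) (s : State) : ℕ → State
  | 0 => s
  | i + 1 => f ((iterStates f x s i).setVar x i)

/-- The effect of a command. -/
def Cmd.run : Cmd → State → State
  | .set x e, s => s.setVar x (e.eval s)
  | .store a i j e, s => s.setArr a (i.eval s) (j.eval s) (e.eval s)
  | .seq c c', s => c'.run (c.run s)
  | .cond e c, s => if e.eval s ≠ 0 then c.run s else s
  | .rep x c, s => (iterStates c.run x s (s.var 0)).setVar x (s.var x)

/-- The command does not assign a value to the variable `y`. -/
def Cmd.Keeps (y : ℕ) : Cmd → Prop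
  | .set x _ => x ≠ y
  | .store _ _ _ _ => True
  | .seq c c' => c.Keeps y ∧ c'.Keeps y
  | .cond _ c => c.Keeps y
  | .rep x c => x = y ∨ c.Keeps y

/-- All variables of the command are below `D`, and loop variables and variable `0` are not
assigned to. -/
def Cmd.WF (D : ℕ) : Cmd → Prop
  | .set x e => 0 < x ∧ x < D ∧ e.WF D
  | .store _ i j e => i.WF D ∧ j.WF D ∧ e.WF D
  | .seq c c' => c.WF D ∧ c'.WF D
  | .cond e c => e.WF D ∧ c.WF D
  | .rep x c => 0 < x ∧ x < D ∧ c.WF D ∧ c.Keeps x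

/-- A program for a command, which uses the variables from `d` on as temporary storage. -/
def Cmd.compile : Cmd → ℕ → Prog
  | .set x e, d => .seq (e.compile d) (.assign x (.var d))
  | .store a i j e, d => .seq (i.compile d) (.seq (j.compile (d + 1)) (.seq (e.compile (d + 2))
      (.store a (.var d) (.var (d + 1)) (.var (d + 2)))))
  | .seq c c', d => .seq (c.compile d) (c'.compile d)
  | .cond e c, d => .seq (e.compile d) (.ite (.var d) (c.compile d) .skip)
  | .rep x c, d => forProg x d (c.compile (d + 1))

open Polynomial in
/-- A bound for the running time of `Cmd.compile`. -/
noncomputable def Cmd.time : Cmd → Polynomial ℕ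
  | .set _ e => e.time + 2
  | .store _ i j e => i.time + j.time + e.time + 4
  | .seq c c' => c.time + c'.time
  | .cond e c => e.time + c.time + 3
  | .rep _ c => X * (c.time + 8) + 12

lemma Cmd.Keeps.run {y : ℕ} {c : Cmd} (h : c.Keeps y) (s : State) :
    (c.run s).var y = s.var y := by
  induction c generalizing s with
  | set x e => simp [Cmd.run, Ne.symm h]
  | store a i j e => rfl
  | seq c c' ih ih' => rw [Cmd.run, ih' h.2, ih h.1]
  | cond e c ih =>
    rw [Cmd.run]; split_ifs
    · exact ih h s
    · rfl
  | rep x c ih =>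
    -- The counter of a loop is restored at the end, whatever the body does to it.
    by_cases hx : y = x
    · simp [Cmd.run, hx]
    · have h' := h.resolve_left (Ne.symm hx)
      have key : ∀ n, (iterStates c.run x s n).var y = s.var y := by
        intro n
        induction n with
        | zero => rfl
        | succ n ihn => rw [iterStates, ih h']; simp [hx, ihn]
      simp [Cmd.run, hx, key]

lemma Cmd.WF.keeps_zero {D : ℕ} {c : Cmd} (h : c.WF D) : c.Keeps 0 := by
  induction c with
  | set x e => exact Nat.pos_iff_ne_zero.1 h.1
  | store a i j e => trivial
  | seq c c' ih ih' => exact ⟨ih h.1, ih' h.2⟩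
  | cond e c ih => exact ih h.2
  | rep x c ih => exact Or.inr (ih h.2.2.1)

/-- The source semantics ignores temporaries, so the states agree only below `D`; in addition the
temporaries between `D` and `d` must survive, because enclosing loops keep their saved counters
there. -/
lemma Cmd.exec_compile {D : ℕ} (hD : 0 < D) (c : Cmd) (hc : c.WF D) (d : ℕ) (hd : D ≤ d)
    (s₀ s : State) (hs : s.Agree D s₀) :
    ∃ t s', Exec (c.compile d) s t s' ∧ s'.Agree D (c.run s₀) ∧
      (∀ y, D ≤ y → y < d → s'.var y = s.var y) ∧ t ≤ c.time.eval (s₀.var 0) := by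
  induction c generalizing d s₀ s with
  | set x e =>
    obtain ⟨hx, hxD, he⟩ := hc
    obtain ⟨t1, s1, h1, a1, v1, r1, b1⟩ := e.exec_compile hD he d hd s₀ s hs
    refine ⟨_, _, .seq h1 (.assign _ _ _), ⟨a1.trans hs.1, ?_⟩, ?_, ?_⟩
    · intro y hy
      simp only [State.setVar_var, Cmd.run, Expr.eval, r1]
      rw [v1 y (by omega), hs.2 y hy]
    · intro y hy hyd
      simp only [State.setVar_var]
      rw [if_neg (by omega), v1 y hyd]
    · simp [Expr.cost, Cmd.time]; omega
  | store a i j e =>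
    obtain ⟨hi, hj, he⟩ := hc
    obtain ⟨t1, s1, h1, a1, v1, r1, b1⟩ := i.exec_compile hD hi d hd s₀ s hs
    have hs1 : s1.Agree D s₀ := ⟨a1.trans hs.1, fun y hy => (v1 y (by omega)).trans (hs.2 y hy)⟩
    obtain ⟨t2, s2, h2, a2, v2, r2, b2⟩ := j.exec_compile hD hj (d + 1) (by omega) s₀ s1 hs1
    have hs2 : s2.Agree D s₀ :=
      ⟨a2.trans hs1.1, fun y hy => (v2 y (by omega)).trans (hs1.2 y hy)⟩
    obtain ⟨t3, s3, h3, a3, v3, r3, b3⟩ := e.exec_compile hD he (d + 2) (by omega) s₀ s2 hs2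
    refine ⟨_, _, .seq h1 (.seq h2 (.seq h3 (.store _ _ _ _ _))), ⟨?_, ?_⟩, ?_, ?_⟩
    · simp only [State.setArr, Cmd.run, Expr.eval, r3]
      rw [v3 d (by omega), v2 d (by omega), r1, v3 (d + 1) (by omega), r2, a3, hs2.1]
    · intro y hy
      simp only [State.setArr, Cmd.run]
      rw [v3 y (by omega), hs2.2 y hy]
    · intro y hy hyd
      simp only [State.setArr]
      rw [v3 y (by omega), v2 y (by omega), v1 y (by omega)]
    · simp [Expr.cost, Cmd.time]; omega
  | seq c c' ih ih' =>
    obtain ⟨t1, s1, h1, a1, v1, b1⟩ := ih hc.1 d hd s₀ s hs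
    obtain ⟨t2, s2, h2, a2, v2, b2⟩ := ih' hc.2 d hd (c.run s₀) s1 a1
    refine ⟨_, _, .seq h1 h2, a2, fun y hy hyd => (v2 y hy hyd).trans (v1 y hy hyd), ?_⟩
    rw [hc.1.keeps_zero.run] at b2
    simp [Cmd.time]; omega
  | cond e c ih =>
    obtain ⟨t1, s1, h1, a1, v1, r1, b1⟩ := e.exec_compile hD hc.1 d hd s₀ s hs
    have hs1 : s1.Agree D s₀ := ⟨a1.trans hs.1, fun y hy => (v1 y (by omega)).trans (hs.2 y hy)⟩
    by_cases he : e.eval s₀ = 0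
    · refine ⟨_, _, .seq h1 (.ite_false (by simp [Expr.eval, r1, he]) (.skip _)), ?_, ?_, ?_⟩
      · simpa [Cmd.run, he] using hs1
      · exact fun y _ hyd => v1 y hyd
      · simp [Expr.cost, Cmd.time]; omega
    · obtain ⟨t2, s2, h2, a2, v2, b2⟩ := ih hc.2 d hd s₀ s1 hs1
      refine ⟨_, _, .seq h1 (.ite_true (by simp [Expr.eval, r1, he]) h2), ?_, ?_, ?_⟩
      · simpa [Cmd.run, he] using a2
      · exact fun y hy hyd => (v2 y hy hyd).trans (v1 y hyd)
      · simp [Expr.cost, Cmd.time]; omega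
  | rep x c ih =>
    obtain ⟨hx0, hxD, hc, hkx⟩ := hc
    have hvar0 : ∀ i, (iterStates c.run x s₀ i).var 0 = s₀.var 0 := by
      intro i
      induction i with
      | zero => rfl
      | succ i ihi => rw [iterStates, hc.keeps_zero.run]; simp [ihi]; omega
    obtain ⟨t, s', h1, h2, h3, h4⟩ := exec_forProg (x := x) (v := d) (N := s₀.var 0)
      (c := c.time.eval (s₀.var 0)) (p := c.compile (d + 1)) (s := s)
      (fun i s' => s'.arr = (iterStates c.run x s₀ i).arr ∧
        (∀ y < D, y ≠ x → s'.var y = (iterStates c.run x s₀ i).var y) ∧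
        s'.var d = s.var x ∧ ∀ y, D ≤ y → y < d → s'.var y = s.var y)
      (by
        rintro i s' ⟨h1, h2, h3, h4⟩
        exact ⟨by rw [h2 0 hD (by omega), hvar0], h3⟩)
      (by
        rintro i s' z ⟨h1, h2, h3, h4⟩
        refine ⟨h1, ?_, ?_, ?_⟩
        · intro y hy hyx; simp [hyx, h2 y hy hyx]
        · simp [h3]; omega
        · intro y hy hyd
          simp only [State.setVar_var]
          rw [if_neg (by omega), h4 y hy hyd])
      (by
        rintro i hi s' ⟨h1, h2, h3, h4⟩ hix
        obtain ⟨t2, s2, e2, a2, v2, b2⟩ := ih hc (d + 1) (by omega)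
          ((iterStates c.run x s₀ i).setVar x i) s' (by
          refine ⟨h1, ?_⟩
          intro y hy
          by_cases hyx : y = x
          · subst hyx; simp [hix]
          · simp only [State.setVar_var, if_neg hyx]
            rw [h2 y hy hyx])
        refine ⟨_, _, e2, ⟨a2.1, fun y hy _ => a2.2 y hy, ?_, ?_⟩, ?_, ?_⟩
        · rw [v2 d hd (by omega), h3]
        · intro y hy hyd
          rw [v2 y hy (by omega), h4 y hy hyd]
        · rw [a2.2 x hxD, hkx.run]; simp
        · have : ((iterStates c.run x s₀ i).setVar x i).var 0 = s₀.var 0 := by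
            simp [hvar0]; omega
          rwa [this] at b2)
      (by
        refine ⟨hs.1, ?_, ?_, ?_⟩
        · intro y hy hyx
          simp only [State.setVar_var]
          rw [if_neg (by omega), hs.2 y hy]; rfl
        · simp
        · intro y hy hyd
          simp; omega)
    refine ⟨_, _, h1, ⟨h2.1, ?_⟩, h2.2.2.2, ?_⟩
    · intro y hy
      by_cases hyx : y = x
      · rw [hyx, h3]; simp [Cmd.run, hs.2 x hxD]
      · rw [h2.2.1 y hy hyx]; simp [Cmd.run, hyx]
    · simpa [Cmd.time] using h4

end RAM

/-! ### Contractions to grids in coordinates -/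

namespace GridContraction

/-- If `F` is a union of spanning trees of the `|W|` witness sets, then it has `|V| - |W|`
edges. -/
lemma IsSpanningForestOf.ncard_edgeSet {V W : Type*} [Finite V] {G F : SimpleGraph V} {ψ : V → W}
    (hψ : Function.Surjective ψ) (hF : IsSpanningForestOf G ψ F) :
    F.edgeSet.ncard + Nat.card W = Nat.card V := by
  classical
  have : Finite W := Finite.of_surjective ψ hψ
  have := Fintype.ofFinite V
  have := Fintype.ofFinite W
  have h1 : ∑ v, F.degree v = 2 * F.edgeFinset.card := F.sum_degrees_eq_twice_card_edges
  -- A tree on `m` vertices has degree sum `2m - 2`. Degrees in `F` are degrees in the trees,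
  -- because no edge of `F` leaves its witness set.
  have h2 : ∀ h : W, ∑ v with ψ v = h, F.degree v + 2 =
      2 * (Finset.univ.filter fun v => ψ v = h).card := by
    intro h
    have ht := (hF.isTree h).card_edgeFinset
    have hs := (F.induce {v | ψ v = h}).sum_degrees_eq_twice_card_edges
    have hd : ∀ v : {v | ψ v = h}, (F.induce {v | ψ v = h}).degree v = F.degree v := by
      intro v
      apply SimpleGraph.degree_induce_of_neighborSet_subset
      intro w hw
      have := hF.inside _ _ hw
      exact this.symm.trans v.2
    simp only [hd] at hs
    have hs' : ∑ v : {v | ψ v = h}, F.degree (v : V) = ∑ v with ψ v = h, F.degree v := by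
      rw [Finset.sum_subtype (p := fun v => ψ v = h)]
      · rfl
      · simp
    have hc : Fintype.card {v | ψ v = h} = (Finset.univ.filter fun v => ψ v = h).card := by
      rw [Fintype.card_subtype]; rfl
    omega
  have h3 := Finset.sum_congr rfl fun h (_ : h ∈ (Finset.univ : Finset W)) => h2 h
  have h4 : ∑ h : W, ∑ v with ψ v = h, F.degree v = ∑ v, F.degree v := by
    convert! Finset.sum_fiberwise Finset.univ ψ fun v => F.degree v
  have h5 : ∑ h : W, (Finset.univ.filter fun v => ψ v = h).card = Fintype.card V := by
    rw [← Finset.card_univ, Finset.card_eq_sum_card_fiberwise (f := ψ) (t := Finset.univ) (by simp)]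
  rw [Finset.sum_add_distrib, ← Finset.mul_sum, h4, h5, h1] at h3
  simp only [Finset.sum_const, Finset.card_univ, smul_eq_mul] at h3
  rw [← SimpleGraph.coe_edgeFinset, Set.ncard_coe_finset, Nat.card_eq_fintype_card,
    Nat.card_eq_fintype_card]
  omega

/-- Each connected witness set has a spanning tree; their union is the forest. -/
lemma IsContractibleVia.exists_isSpanningForestOf {V W : Type*} [Finite V] {G : SimpleGraph V}
    {H : SimpleGraph W} {ψ : V → W} (h : IsContractibleVia G H ψ) :
    ∃ F, IsSpanningForestOf G ψ F := by
  have := fun w => (h.connected w).exists_isTree_le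
  choose T hT hT' using this
  let F : SimpleGraph V :=
    { Adj := fun u v => ∃ e : ψ u = ψ v, (T (ψ v)).Adj ⟨u, e⟩ ⟨v, rfl⟩
      symm := ⟨by
        rintro u v ⟨e, h⟩
        -- Symmetry changes the index of the tree from `ψ v` to `ψ u`; a free index `w` makes the
        -- substitution possible.
        have key : ∀ w (e1 : ψ u = w) (e2 : ψ v = w), (T w).Adj ⟨u, e1⟩ ⟨v, e2⟩ →
            ∃ e : ψ v = ψ u, (T (ψ u)).Adj ⟨v, e⟩ ⟨u, rfl⟩ := by
          rintro w rfl e2 h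
          exact ⟨e2, h.symm⟩
        exact key _ e rfl h⟩
      loopless := ⟨by rintro u ⟨e, h⟩; exact h.ne rfl⟩ }
  have hFT : ∀ w, F.induce {v | ψ v = w} = T w := by
    intro w
    ext ⟨u, hu⟩ ⟨v, hv⟩
    simp only [Set.mem_ofPred_eq] at hu hv
    subst hv
    simp [F, hu]
  refine ⟨F, ?_, ?_, ?_⟩
  · rintro u v ⟨e, h⟩
    exact hT _ h
  · rintro u v ⟨e, h⟩
    exact e
  · intro w
    rw [hFT]
    exact hT' w

/-- All spanning forests have the same number of edges, `|V| - |W|`, so the choice of the forest is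
irrelevant and the budget becomes a condition on the number of vertices. -/
lemma isKContractible_iff {V W : Type*} [Finite V] (G : SimpleGraph V) (H : SimpleGraph W)
    (k : ℕ) : IsKContractible G H k ↔
      ∃ ψ : V → W, IsContractibleVia G H ψ ∧ Nat.card V ≤ Nat.card W + k := by
  constructor
  · rintro ⟨ψ, h, F, hF, hk⟩
    have := hF.ncard_edgeSet h.surjective
    exact ⟨ψ, h, by omega⟩
  · rintro ⟨ψ, h, hk⟩
    obtain ⟨F, hF⟩ := h.exists_isSpanningForestOf
    have := hF.ncard_edgeSet h.surjective
    exact ⟨ψ, h, F, hF, by omega⟩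

/-! ### Maps to a grid given by two coordinate functions -/

/-- The cells `(x, y)` and `(x', y')` are equal or adjacent in the grid. -/
def Near (x y x' y' : ℕ) : Prop :=
  (x = x' ∧ (y = y' ∨ y + 1 = y' ∨ y' + 1 = y)) ∨ (y = y' ∧ (x + 1 = x' ∨ x' + 1 = x))

/-- The map with coordinates `X` and `Y` contracts `G` to the `r × q` grid. -/
structure GridMap {V : Type*} (G : SimpleGraph V) (r q : ℕ) (X Y : V → ℕ) : Prop where
  X_lt : ∀ v, X v < r
  Y_lt : ∀ v, Y v < q
  conn : ∀ a < r, ∀ b < q, (G.induce {v | X v = a ∧ Y v = b}).Connected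
  near : ∀ u v, G.Adj u v → Near (X u) (Y u) (X v) (Y v)
  edgeX : ∀ a b, a + 1 < r → b < q →
    ∃ u v, X u = a ∧ Y u = b ∧ X v = a + 1 ∧ Y v = b ∧ G.Adj u v
  edgeY : ∀ a b, a < r → b + 1 < q →
    ∃ u v, X u = a ∧ Y u = b ∧ X v = a ∧ Y v = b + 1 ∧ G.Adj u v

lemma gridGraph_adj_iff {r q : ℕ} (x y : Fin r × Fin q) : (gridGraph r q).Adj x y ↔
    x ≠ y ∧ Near x.1 x.2 y.1 y.2 := by
  obtain ⟨a, b⟩ := x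
  obtain ⟨c, d⟩ := y
  simp only [gridGraph, Near, ne_eq, Prod.mk.injEq, Fin.ext_iff]
  omega

lemma gridMap_of_isContractibleVia {V : Type*} {G : SimpleGraph V} {r q : ℕ}
    {ψ : V → Fin r × Fin q} (h : IsContractibleVia G (gridGraph r q) ψ) :
    GridMap G r q (fun v => (ψ v).1) (fun v => (ψ v).2) := by
  refine ⟨fun v => (ψ v).1.2, fun v => (ψ v).2.2, ?_, ?_, ?_, ?_⟩
  · intro a ha b hb
    have := h.connected (⟨a, ha⟩, ⟨b, hb⟩)
    have e : {v | ψ v = (⟨a, ha⟩, ⟨b, hb⟩)} = {v | ((ψ v).1 : ℕ) = a ∧ ((ψ v).2 : ℕ) = b} := by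
      ext v; simp [Prod.ext_iff, Fin.ext_iff]
    rwa [e] at this
  · intro u v huv
    by_cases e : ψ u = ψ v
    · rw [e]; simp [Near]
    · have := (h.adj_iff _ _ e).2 ⟨u, v, rfl, rfl, huv⟩
      exact ((gridGraph_adj_iff _ _).1 this).2
  · intro a b ha hb
    obtain ⟨u, v, hu, hv, huv⟩ := (h.adj_iff (⟨a, by omega⟩, ⟨b, hb⟩) (⟨a + 1, ha⟩, ⟨b, hb⟩)
      (by simp)).1 (by rw [gridGraph_adj_iff]; simp [Near])
    exact ⟨u, v, by simp [hu], by simp [hu], by simp [hv], by simp [hv], huv⟩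
  · intro a b ha hb
    obtain ⟨u, v, hu, hv, huv⟩ := (h.adj_iff (⟨a, ha⟩, ⟨b, by omega⟩) (⟨a, ha⟩, ⟨b + 1, hb⟩)
      (by simp)).1 (by rw [gridGraph_adj_iff]; simp [Near])
    exact ⟨u, v, by simp [hu], by simp [hu], by simp [hv], by simp [hv], huv⟩

lemma GridMap.exists_cell {V : Type*} {G : SimpleGraph V} {r q : ℕ} {X Y : V → ℕ}
    (h : GridMap G r q X Y) {a b : ℕ} (ha : a < r) (hb : b < q) : ∃ v, X v = a ∧ Y v = b := by
  obtain ⟨v⟩ := (h.conn a ha b hb).nonempty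
  exact ⟨v, v.2⟩

lemma GridMap.exists_edge {V : Type*} {G : SimpleGraph V} {r q : ℕ} {X Y : V → ℕ}
    (h : GridMap G r q X Y) {a b a' b' : ℕ} (ha : a < r) (hb : b < q) (ha' : a' < r) (hb' : b' < q)
    (hn : Near a b a' b') (hne : a ≠ a' ∨ b ≠ b') :
    ∃ u v, X u = a ∧ Y u = b ∧ X v = a' ∧ Y v = b' ∧ G.Adj u v := by
  rcases hn with ⟨rfl, e | e | e⟩ | ⟨rfl, e | e⟩
  · omega
  · subst e; exact h.edgeY _ _ ha hb'
  · subst e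
    obtain ⟨u, v, h1, h2, h3, h4, h5⟩ := h.edgeY _ _ ha hb
    exact ⟨v, u, h3, h4, h1, h2, h5.symm⟩
  · subst e; exact h.edgeX _ _ ha' hb
  · subst e
    obtain ⟨u, v, h1, h2, h3, h4, h5⟩ := h.edgeX _ _ ha hb
    exact ⟨v, u, h3, h4, h1, h2, h5.symm⟩

lemma GridMap.isContractibleVia {V : Type*} {G : SimpleGraph V} {r q : ℕ} {X Y : V → ℕ}
    (h : GridMap G r q X Y) : IsContractibleVia G (gridGraph r q)
      (fun v => (⟨X v, h.X_lt v⟩, ⟨Y v, h.Y_lt v⟩)) := by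
  refine ⟨?_, ?_, ?_⟩
  · rintro ⟨⟨a, ha⟩, ⟨b, hb⟩⟩
    obtain ⟨v, h1, h2⟩ := h.exists_cell ha hb
    exact ⟨v, by simp [h1, h2]⟩
  · rintro ⟨⟨a, ha⟩, ⟨b, hb⟩⟩
    have := h.conn a ha b hb
    have e : {v | ((⟨X v, h.X_lt v⟩, ⟨Y v, h.Y_lt v⟩) : Fin r × Fin q) = (⟨a, ha⟩, ⟨b, hb⟩)} =
        {v | X v = a ∧ Y v = b} := by
      ext v; simp
    rwa [e]
  · rintro ⟨⟨a, ha⟩, ⟨b, hb⟩⟩ ⟨⟨a', ha'⟩, ⟨b', hb'⟩⟩ hne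
    rw [gridGraph_adj_iff]
    simp only [ne_eq, Prod.mk.injEq, Fin.mk.injEq] at hne
    constructor
    · rintro ⟨-, hn⟩
      obtain ⟨u, v, rfl, rfl, rfl, rfl, h5⟩ := h.exists_edge ha hb ha' hb' hn (by omega)
      exact ⟨u, v, rfl, rfl, h5⟩
    · rintro ⟨u, v, hu, hv, huv⟩
      simp only [Prod.mk.injEq, Fin.mk.injEq] at hu hv
      obtain ⟨rfl, rfl⟩ := hu
      obtain ⟨rfl, rfl⟩ := hv
      exact ⟨by simpa using hne, h.near u v huv⟩

/-- `G` can be contracted to some grid by contracting at most `k` edges. -/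
def Contractible {V : Type*} (G : SimpleGraph V) (k : ℕ) : Prop :=
  ∃ (r q : ℕ) (X Y : V → ℕ), 2 ≤ r ∧ 2 ≤ q ∧ GridMap G r q X Y ∧ Nat.card V ≤ r * q + k

lemma Inst.isYes_iff (I : Inst) : I.IsYes ↔ Contractible I.graph I.k := by
  constructor
  · rintro ⟨r, q, hr, hq, h⟩
    obtain ⟨ψ, h, hk⟩ := (isKContractible_iff _ _ _).1 h
    exact ⟨r, q, _, _, hr, hq, gridMap_of_isContractibleVia h, by simpa using hk⟩
  · rintro ⟨r, q, X, Y, hr, hq, h, hk⟩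
    exact ⟨r, q, hr, hq, (isKContractible_iff _ _ _).2 ⟨_, h.isContractibleVia, by simpa using hk⟩⟩

/-- Connectedness of an induced subgraph passes along a map of the vertices. -/
lemma connected_induce_of_map {V V' : Type*} {G : SimpleGraph V} {G' : SimpleGraph V'} {s : Set V}
    {s' : Set V'} (f : V → V') (hs : Set.MapsTo f s s') (hsurj : Set.SurjOn f s s')
    (hadj : ∀ u ∈ s, ∀ v ∈ s, G.Adj u v → G'.Adj (f u) (f v)) (h : (G.induce s).Connected) :
    (G'.induce s').Connected := by
  refine h.map (⟨fun v => ⟨f v, hs v.2⟩, ?_⟩ : G.induce s →g G'.induce s') ?_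
  · rintro ⟨u, hu⟩ ⟨v, hv⟩ huv
    exact hadj u hu v hv huv
  · rintro ⟨w, hw⟩
    obtain ⟨v, hv, rfl⟩ := hsurj hw
    exact ⟨⟨v, hv⟩, rfl⟩

lemma connected_induce_singleton {V : Type*} (G : SimpleGraph V) {s : Set V} {v : V}
    (h : s = {v}) : (G.induce s).Connected := by
  subst h
  have : Subsingleton ({v} : Set V) := by simp
  have : Nonempty ({v} : Set V) := ⟨⟨v, rfl⟩⟩
  exact ⟨fun a b => by rw [Subsingleton.elim a b]⟩

lemma GridMap.of_iso {V V' : Type*} {G : SimpleGraph V} {G' : SimpleGraph V'} (e : G ≃g G')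
    {r q : ℕ} {X Y : V' → ℕ} (h : GridMap G' r q X Y) :
    GridMap G r q (fun v => X (e v)) (fun v => Y (e v)) := by
  refine ⟨fun v => h.X_lt _, fun v => h.Y_lt _, ?_, ?_, ?_, ?_⟩
  · intro a ha b hb
    refine connected_induce_of_map e.symm ?_ ?_ ?_ (h.conn a ha b hb)
    · intro v hv; simpa using hv
    · intro v hv; exact ⟨e v, by simpa using hv, by simp⟩
    · intro u _ v _ huv; exact e.symm.map_rel_iff.2 huv
  · intro u v huv
    exact h.near _ _ (e.map_rel_iff.2 huv)
  · intro a b ha hb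
    obtain ⟨u, v, h1, h2, h3, h4, h5⟩ := h.edgeX a b ha hb
    exact ⟨e.symm u, e.symm v, by simpa, by simpa, by simpa, by simpa, e.symm.map_rel_iff.2 h5⟩
  · intro a b ha hb
    obtain ⟨u, v, h1, h2, h3, h4, h5⟩ := h.edgeY a b ha hb
    exact ⟨e.symm u, e.symm v, by simpa, by simpa, by simpa, by simpa, e.symm.map_rel_iff.2 h5⟩

lemma contractible_congr {V V' : Type*} {G : SimpleGraph V} {G' : SimpleGraph V'} (e : G ≃g G')
    (k : ℕ) : Contractible G k ↔ Contractible G' k := by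
  constructor
  · rintro ⟨r, q, X, Y, hr, hq, h, hk⟩
    exact ⟨r, q, _, _, hr, hq, h.of_iso e.symm, by rwa [Nat.card_congr e.symm.toEquiv]⟩
  · rintro ⟨r, q, X, Y, hr, hq, h, hk⟩
    exact ⟨r, q, _, _, hr, hq, h.of_iso e, by rwa [Nat.card_congr e.toEquiv]⟩

/-- Transposing the grid. -/
lemma GridMap.swap {V : Type*} {G : SimpleGraph V} {r q : ℕ} {X Y : V → ℕ}
    (h : GridMap G r q X Y) : GridMap G q r Y X := by
  refine ⟨h.Y_lt, h.X_lt, ?_, ?_, ?_, ?_⟩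
  · intro a ha b hb
    have := h.conn b hb a ha
    have e : {v | Y v = a ∧ X v = b} = {v | X v = b ∧ Y v = a} := by
      ext v; exact and_comm
    rwa [e]
  · intro u v huv
    have := h.near u v huv
    unfold Near at *; omega
  · intro a b ha hb
    obtain ⟨u, v, h1, h2, h3, h4, h5⟩ := h.edgeY b a hb ha
    exact ⟨u, v, h2, h1, h4, h3, h5⟩
  · intro a b ha hb
    obtain ⟨u, v, h1, h2, h3, h4, h5⟩ := h.edgeX b a hb ha
    exact ⟨u, v, h2, h1, h4, h3, h5⟩

/-- Reflecting the grid. -/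
lemma GridMap.reflect {V : Type*} {G : SimpleGraph V} {r q : ℕ} {X Y : V → ℕ}
    (h : GridMap G r q X Y) : GridMap G r q X (fun v => q - 1 - Y v) := by
  have hY := h.Y_lt
  refine ⟨h.X_lt, fun v => by have := hY v; omega, ?_, ?_, ?_, ?_⟩
  · intro a ha b hb
    have := h.conn a ha (q - 1 - b) (by omega)
    have e : {v | X v = a ∧ q - 1 - Y v = b} = {v | X v = a ∧ Y v = q - 1 - b} := by
      ext v; have := hY v; simp only [Set.mem_ofPred_eq]; omega
    rwa [e]
  · intro u v huv
    have := h.near u v huv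
    have := hY u
    have := hY v
    unfold Near at *; omega
  · intro a b ha hb
    obtain ⟨u, v, h1, h2, h3, h4, h5⟩ := h.edgeX a (q - 1 - b) ha (by omega)
    exact ⟨u, v, h1, by omega, h3, by omega, h5⟩
  · intro a b ha hb
    obtain ⟨u, v, h1, h2, h3, h4, h5⟩ := h.edgeY a (q - 1 - (b + 1)) ha (by omega)
    exact ⟨v, u, h3, by omega, h1, by omega, h5.symm⟩

/-- The vertex `v` is alone in its cell. -/
def Alone {V : Type*} (X Y : V → ℕ) (v : V) : Prop :=
  ∀ w, X w = X v → Y w = Y v → w = v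

/-- Two vertices which are alone in their cells are adjacent iff the cells are. -/
lemma GridMap.adj_iff_of_alone {V : Type*} {G : SimpleGraph V} {r q : ℕ} {X Y : V → ℕ}
    (h : GridMap G r q X Y) {u v : V} (hu : Alone X Y u) (hv : Alone X Y v) (huv : u ≠ v) :
    G.Adj u v ↔ Near (X u) (Y u) (X v) (Y v) := by
  refine ⟨h.near u v, fun hn => ?_⟩
  obtain ⟨u', v', h1, h2, h3, h4, h5⟩ := h.exists_edge (h.X_lt u) (h.Y_lt u) (h.X_lt v) (h.Y_lt v)
    hn (by by_contra hc; push Not at hc; exact huv (hv u hc.1 hc.2))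
  rwa [hu u' h1 h2, hv v' h3 h4] at h5

open Classical in
/-- There is a set of at most `k` vertices whose complement contains exactly one vertex of each
cell. -/
lemma GridMap.exists_representatives {V : Type*} [Fintype V] {G : SimpleGraph V} {r q k : ℕ}
    {X Y : V → ℕ} (h : GridMap G r q X Y) (hk : Nat.card V ≤ r * q + k) :
    ∃ (ρ : V → V) (B : Finset V), (∀ v, X (ρ v) = X v ∧ Y (ρ v) = Y v) ∧
      (∀ u v, X u = X v → Y u = Y v → ρ u = ρ v) ∧ (∀ v, v ∉ B ↔ ρ v = v) ∧ B.card ≤ k := by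
  have hex : ∀ x : Fin r × Fin q, ∃ v, X v = x.1 ∧ Y v = x.2 :=
    fun x => h.exists_cell x.1.2 x.2.2
  choose g hg using hex
  let f : V → Fin r × Fin q := fun v => (⟨X v, h.X_lt v⟩, ⟨Y v, h.Y_lt v⟩)
  have hfg : ∀ x, f (g x) = x := fun x => by
    simp [f, hg]
  refine ⟨fun v => g (f v), Finset.univ.filter fun v => g (f v) ≠ v, ?_, ?_, ?_, ?_⟩
  · intro v; simpa [f] using hg (f v)
  · intro u v h1 h2
    simp [f, h1, h2]
  · intro v; simp
  · have h1 : (Finset.univ.filter fun v => g (f v) = v).card = r * q := by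
      have : (Finset.univ.filter fun v => g (f v) = v) = Finset.univ.image g := by
        ext v
        simp only [Finset.mem_filter, Finset.mem_univ, true_and, Finset.mem_image]
        exact ⟨fun e => ⟨_, e⟩, by rintro ⟨x, rfl⟩; rw [hfg]⟩
      rw [this, Finset.card_image_of_injective _ (Function.LeftInverse.injective hfg)]
      simp
    have h2 := Finset.card_filter_add_card_filter_not (s := (Finset.univ : Finset V))
      (fun v => g (f v) = v)
    rw [Nat.card_eq_fintype_card] at hk
    simp only [Finset.card_univ] at h2
    simp only [ne_eq]
    omega

end GridContraction

/-! ### Slabs: inserting and deleting columns -/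

namespace GridContraction

variable {U P : Type*}

/-- The product of the graph `GP` and a path with `m` vertices, the first and the last copy of `GP`
being attached to a graph `GU` by the relations `L` and `R`. -/
def slabGraph (GU : SimpleGraph U) (GP : SimpleGraph P) (L R : U → P → Prop) (m : ℕ) :
    SimpleGraph (U ⊕ (Fin m × P)) where
  Adj
    | .inl u, .inl v => GU.Adj u v
    | .inl u, .inr (i, p) => ((i : ℕ) = 0 ∧ L u p) ∨ ((i : ℕ) + 1 = m ∧ R u p)
    | .inr (i, p), .inl u => ((i : ℕ) = 0 ∧ L u p) ∨ ((i : ℕ) + 1 = m ∧ R u p)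
    | .inr (i, p), .inr (j, p') => (i = j ∧ GP.Adj p p') ∨
        (((i : ℕ) + 1 = j ∨ (j : ℕ) + 1 = i) ∧ p = p')
  symm := ⟨by
    rintro (u | ⟨i, p⟩) (v | ⟨j, p'⟩) h
    · exact GU.adj_symm h
    · exact h
    · exact h
    · rcases h with ⟨rfl, h⟩ | ⟨h, rfl⟩
      · exact Or.inl ⟨rfl, h.symm⟩
      · exact Or.inr ⟨h.symm, rfl⟩⟩
  loopless := ⟨by
    rintro (u | ⟨i, p⟩) h
    · exact GU.loopless.irrefl _ h
    · rcases h with ⟨_, h⟩ | ⟨h, _⟩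
      · exact h.ne rfl
      · omega⟩

section adj

variable (GU : SimpleGraph U) (GP : SimpleGraph P) (L R : U → P → Prop) {m : ℕ}

@[simp] lemma slabGraph_inl_inl (u v : U) :
    (slabGraph GU GP L R m).Adj (.inl u) (.inl v) ↔ GU.Adj u v := Iff.rfl

@[simp] lemma slabGraph_inl_inr (u : U) (i : Fin m) (p : P) :
    (slabGraph GU GP L R m).Adj (.inl u) (.inr (i, p)) ↔
      ((i : ℕ) = 0 ∧ L u p) ∨ ((i : ℕ) + 1 = m ∧ R u p) := Iff.rfl

@[simp] lemma slabGraph_inr_inl (u : U) (i : Fin m) (p : P) :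
    (slabGraph GU GP L R m).Adj (.inr (i, p)) (.inl u) ↔
      ((i : ℕ) = 0 ∧ L u p) ∨ ((i : ℕ) + 1 = m ∧ R u p) := Iff.rfl

@[simp] lemma slabGraph_inr_inr (i j : Fin m) (p p' : P) :
    (slabGraph GU GP L R m).Adj (.inr (i, p)) (.inr (j, p')) ↔
      (i = j ∧ GP.Adj p p') ∨ (((i : ℕ) + 1 = j ∨ (j : ℕ) + 1 = i) ∧ p = p') := Iff.rfl

end adj

/-- The vertices of a slab with `m` columns as those of a slab with `m + 1` columns outside
column `j`. -/
def skipColumn (m j : ℕ) : U ⊕ (Fin m × P) → U ⊕ (Fin (m + 1) × P)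
  | .inl u => .inl u
  | .inr (i, p) => .inr (⟨if (i : ℕ) < j then i else i + 1, by split_ifs <;> omega⟩, p)

@[simp] lemma skipColumn_inl (m j : ℕ) (u : U) :
    skipColumn (P := P) m j (.inl u) = .inl u := rfl

@[simp] lemma skipColumn_inr (m j : ℕ) (i : Fin m) (p : P) :
    skipColumn (U := U) m j (.inr (i, p)) =
      .inr (⟨if (i : ℕ) < j then i else i + 1, by split_ifs <;> omega⟩, p) := rfl

lemma skipColumn_of_lt {m j : ℕ} {i : Fin m} (h : (i : ℕ) < j) (p : P) :
    skipColumn (U := U) m j (.inr (i, p)) = .inr (i.castSucc, p) := by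
  simp [Fin.ext_iff, h]

lemma skipColumn_of_ge {m j : ℕ} {i : Fin m} (h : j ≤ i) (p : P) :
    skipColumn (U := U) m j (.inr (i, p)) = .inr (i.succ, p) := by
  simp [Fin.ext_iff, Nat.not_lt.2 h]

lemma skipColumn_injective (m j : ℕ) :
    Function.Injective (skipColumn (U := U) (P := P) m j) := by
  rintro (u | ⟨i, p⟩) (v | ⟨i', p'⟩) h
  · simpa using h
  · simp at h
  · simp at h
  · simp only [skipColumn_inr, Sum.inr.injEq, Prod.mk.injEq, Fin.mk.injEq] at h
    obtain ⟨h, rfl⟩ := h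
    have : i = i' := by ext; split_ifs at h <;> omega
    rw [this]

/-- A vertex outside column `j` comes from the slab with one column less. -/
lemma exists_skipColumn_eq {m j : ℕ} (hj : j ≤ m) (v : U ⊕ (Fin (m + 1) × P)) :
    (∃ p, v = .inr (⟨j, by omega⟩, p)) ∨ ∃ w, skipColumn m j w = v := by
  rcases v with u | ⟨i, p⟩
  · exact Or.inr ⟨.inl u, rfl⟩
  · rcases lt_trichotomy (i : ℕ) j with h | h | h
    · exact Or.inr ⟨.inr (⟨i, by omega⟩, p), by simp [h]⟩
    · exact Or.inl ⟨p, by simp [← h]⟩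
    · refine Or.inr ⟨.inr (⟨i - 1, by omega⟩, p), ?_⟩
      simp only [skipColumn_inr, Sum.inr.injEq, Prod.mk.injEq, and_true, Fin.ext_iff]
      split_ifs <;> omega

lemma skipColumn_ne {m j : ℕ} (w : U ⊕ (Fin m × P)) (i : Fin (m + 1)) (hi : (i : ℕ) = j) (p : P) :
    skipColumn m j w ≠ .inr (i, p) := by
  rcases w with u | ⟨i', p'⟩
  · simp
  · simp only [skipColumn_inr, ne_eq, Sum.inr.injEq, Prod.mk.injEq, Fin.ext_iff, not_and]
    intro h
    split_ifs at h <;> omega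

/-- `u` and `v` are in the columns `j - 1` and `j`, and in the same row. -/
def Bridge (m j : ℕ) (u v : U ⊕ (Fin m × P)) : Prop :=
  ∃ (i i' : Fin m) (p : P), (i : ℕ) + 1 = j ∧ (i' : ℕ) = j ∧ u = .inr (i, p) ∧ v = .inr (i', p)

/-- Shortening a slab removes column `j` and joins its two neighbours in every row; the bridges are
these new edges. Since `0 < j < m`, the removed column is neither first nor last, so the attachment
to `U` is untouched. -/
lemma slabGraph_adj_iff_skipColumn (GU : SimpleGraph U) (GP : SimpleGraph P) (L R : U → P → Prop)
    {m j : ℕ} (hj : 0 < j) (hjm : j < m) (u v : U ⊕ (Fin m × P)) :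
    (slabGraph GU GP L R m).Adj u v ↔
      (slabGraph GU GP L R (m + 1)).Adj (skipColumn m j u) (skipColumn m j v) ∨
        Bridge m j u v ∨ Bridge m j v u := by
  rcases u with u | ⟨i, p⟩ <;> rcases v with v | ⟨i', p'⟩
  · simp [Bridge]
  · simp only [slabGraph_inl_inr, skipColumn_inl, skipColumn_inr, Bridge, reduceCtorEq, false_and,
      and_false, exists_false, or_false]
    apply or_congr
    · apply and_congr_left; intro _
      by_cases hi : (i' : ℕ) < j
      · simp only [hi, if_true]
      · simp only [hi, if_false]; constructor <;> intro _ <;> omega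
    · apply and_congr_left; intro _
      by_cases hi : (i' : ℕ) < j
      · simp only [hi, if_true]; omega
      · simp only [hi, if_false]; omega
  · simp only [slabGraph_inr_inl, skipColumn_inl, skipColumn_inr, Bridge, reduceCtorEq, false_and,
      and_false, exists_false, or_false]
    apply or_congr
    · apply and_congr_left; intro _
      by_cases hi : (i : ℕ) < j
      · simp only [hi, if_true]
      · simp only [hi, if_false]; constructor <;> intro _ <;> omega
    · apply and_congr_left; intro _
      by_cases hi : (i : ℕ) < j
      · simp only [hi, if_true]; omega
      · simp only [hi, if_false]; omega
  · have hb : ∀ (i i' : Fin m) (p p' : P), Bridge (U := U) m j (.inr (i, p)) (.inr (i', p')) ↔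
        (i : ℕ) + 1 = j ∧ (i' : ℕ) = j ∧ p = p' := by
      intro i i' p p'
      constructor
      · rintro ⟨a, b, c, h1, h2, h3, h4⟩
        simp only [Sum.inr.injEq, Prod.mk.injEq] at h3 h4
        obtain ⟨rfl, rfl⟩ := h3
        obtain ⟨rfl, rfl⟩ := h4
        exact ⟨h1, h2, rfl⟩
      · rintro ⟨h1, h2, rfl⟩
        exact ⟨i, i', p, h1, h2, rfl, rfl⟩
    simp only [slabGraph_inr_inr, skipColumn_inr, hb, Fin.ext_iff]
    by_cases hp : p = p'
    · subst hp
      simp only [SimpleGraph.irrefl, and_false, and_true, false_or]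
      split_ifs <;> omega
    · simp only [hp, and_false, or_false, Ne.symm hp]
      apply and_congr_left; intro _; split_ifs <;> omega

variable {GU : SimpleGraph U} {GP : SimpleGraph P} {L R : U → P → Prop}

/-- The columns `j - 1`, `j` and `j + 1` of a slab are mapped bijectively to the columns `d - 1`,
`d` and `d + 1` of the grid, and rows of the slab to rows of the grid. -/
structure Aligned (m j r d : ℕ) (X Y : U ⊕ (Fin m × P) → ℕ) (ρ : P → ℕ) : Prop where
  j_pos : 0 < j
  j_lt : j + 1 < m
  d_pos : 0 < d
  injective : Function.Injective ρ
  lt : ∀ p, ρ p < r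
  surj : ∀ a < r, ∃ p, ρ p = a
  X_eq : ∀ (i : Fin m) p, (i : ℕ) + 1 = j ∨ (i : ℕ) = j ∨ (i : ℕ) = j + 1 → X (.inr (i, p)) = ρ p
  Y_eq : ∀ (i : Fin m) p, (i : ℕ) + 1 = j ∨ (i : ℕ) = j ∨ (i : ℕ) = j + 1 →
    Y (.inr (i, p)) + j = d + i
  eq_of_Y : ∀ v, Y v + 1 = d ∨ Y v = d ∨ Y v = d + 1 →
    ∃ (i : Fin m) (p : P), v = .inr (i, p) ∧ Y v + j = d + i

/-- Deleting a column of a slab which is mapped to a column of the grid. -/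
lemma GridMap.deleteColumn {m j r q d : ℕ} {X Y : U ⊕ (Fin (m + 1) × P) → ℕ} {ρ : P → ℕ}
    (h : GridMap (slabGraph GU GP L R (m + 1)) r (q + 1) X Y)
    (ha : Aligned (m + 1) j r d X Y ρ) :
    ∃ X' Y', GridMap (slabGraph GU GP L R m) r q X' Y' := by
  have hj0 := ha.j_pos
  have hjm := ha.j_lt
  have hd0 := ha.d_pos
  have hadj := slabGraph_adj_iff_skipColumn GU GP L R hj0 (show j < m by omega)
  set ι := skipColumn (U := U) (P := P) m j with hι
  -- Grid column `d` is filled by slab column `j` and nothing else. Together with `hex` this says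
  -- that the surviving vertices are those outside grid column `d`.
  have hYd : ∀ w, Y (ι w) ≠ d := by
    intro w hw
    obtain ⟨i, p, h1, h2⟩ := ha.eq_of_Y _ (Or.inr (Or.inl hw))
    exact skipColumn_ne w i (by omega) p h1
  have hex : ∀ v, Y v ≠ d → ∃ w, ι w = v := by
    intro v hv
    rcases exists_skipColumn_eq (show j ≤ m by omega) v with ⟨p, rfl⟩ | hw
    · exact absurd (ha.Y_eq ⟨j, by omega⟩ p (by simp)) (by simp only; omega)
    · exact hw
  have hbr : ∀ u v, Bridge m j u v → X (ι u) = X (ι v) ∧ Y (ι u) + 1 = d ∧ Y (ι v) = d + 1 := by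
    rintro _ _ ⟨i, i', p, h1, h2, rfl, rfl⟩
    rw [hι, skipColumn_of_lt (by omega), skipColumn_of_ge (by omega)]
    have h3 := ha.Y_eq i.castSucc p (by simp; omega)
    have h4 := ha.Y_eq i'.succ p (by simp; omega)
    rw [ha.X_eq _ _ (by simp; omega), ha.X_eq _ _ (by simp; omega)]
    simp only [Fin.val_castSucc, Fin.val_succ] at h3 h4
    omega
  have hdq : ∀ v, X v < r → d < q := by
    intro v hv
    obtain ⟨p, -⟩ := ha.surj (X v) hv
    have h1 := h.Y_lt (.inr (⟨j + 1, by omega⟩, p))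
    have h2 := ha.Y_eq ⟨j + 1, by omega⟩ p (by simp)
    simp only at h2
    omega
  -- The grid columns to the right of `d` move one place to the left.
  refine ⟨fun w => X (ι w), fun w => if Y (ι w) < d then Y (ι w) else Y (ι w) - 1,
    fun w => h.X_lt _, ?_, ?_, ?_, ?_, ?_⟩
  · intro w
    have h1 := h.Y_lt (ι w)
    have h2 := hdq _ (h.X_lt (ι w))
    split_ifs <;> omega
  · intro a ha' b hb
    have key : ∀ w, (if Y (ι w) < d then Y (ι w) else Y (ι w) - 1) = b ↔
        Y (ι w) = if b < d then b else b + 1 := by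
      intro w
      have := hYd w
      split_ifs <;> omega
    have hc := h.conn a ha' (if b < d then b else b + 1) (by split_ifs <;> omega)
    have hbd : (if b < d then b else b + 1) ≠ d := by split_ifs <;> omega
    have : Nonempty (U ⊕ (Fin m × P)) := by
      obtain ⟨v, h1, h2⟩ := hc.nonempty
      exact ⟨(hex v (by rw [h2]; exact hbd)).choose⟩
    choose! f hf using hex
    refine connected_induce_of_map f ?_ ?_ ?_ hc
    · rintro v ⟨h1, h2⟩
      have := hf v (by rw [h2]; exact hbd)
      refine ⟨?_, ?_⟩
      · rw [this]; exact h1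
      · rw [key, this]; exact h2
    · rintro w ⟨h1, h2⟩
      rw [key] at h2
      refine ⟨ι w, ⟨h1, h2⟩, skipColumn_injective m j ?_⟩
      exact hf (ι w) (by rw [h2]; exact hbd)
    · rintro u ⟨_, hu⟩ v ⟨_, hv⟩ huv
      rw [hadj, hf u (by rw [hu]; exact hbd), hf v (by rw [hv]; exact hbd)]
      exact Or.inl huv
  · intro u v huv
    have hu := hYd u
    have hv := hYd v
    rcases (hadj u v).1 huv with h1 | h1 | h1
    · have := h.near _ _ h1
      unfold Near at *
      split_ifs <;> omega
    · have := hbr _ _ h1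
      unfold Near
      split_ifs <;> omega
    · have := hbr _ _ h1
      unfold Near
      split_ifs <;> omega
  · intro a b ha' hb
    obtain ⟨u, v, h1, h2, h3, h4, h5⟩ := h.edgeX a (if b < d then b else b + 1) ha'
      (by split_ifs <;> omega)
    obtain ⟨u, rfl⟩ := hex u (by split_ifs at h2 <;> omega)
    obtain ⟨v, rfl⟩ := hex v (by split_ifs at h4 <;> omega)
    refine ⟨u, v, h1, ?_, h3, ?_, (hadj u v).2 (Or.inl h5)⟩ <;> split_ifs at * <;> omega
  · intro a b ha' hb
    -- The new columns `d - 1` and `d` are the old `d - 1` and `d + 1`; between them the bridges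
    -- provide the grid edges. All other grid edges are inherited.
    by_cases hbd : b + 1 = d
    · obtain ⟨p, hp⟩ := ha.surj a ha'
      have hB : Bridge (U := U) m j (.inr (⟨j - 1, by omega⟩, p)) (.inr (⟨j, by omega⟩, p)) :=
        ⟨_, _, p, by simp only; omega, rfl, rfl, rfl⟩
      have h6 := hbr _ _ hB
      have h7 : X (ι (.inr (⟨j, by omega⟩, p))) = a := by
        rw [hι, skipColumn_of_ge (by simp), ha.X_eq _ _ (by simp), hp]
      refine ⟨_, _, ?_, ?_, ?_, ?_, (hadj _ _).2 (Or.inr (Or.inl hB))⟩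
      · omega
      · split_ifs <;> omega
      · omega
      · split_ifs <;> omega
    · obtain ⟨u, v, h1, h2, h3, h4, h5⟩ := h.edgeY a (if b < d then b else b + 1) ha'
        (by split_ifs <;> omega)
      obtain ⟨u, rfl⟩ := hex u (by split_ifs at h2 <;> omega)
      obtain ⟨v, rfl⟩ := hex v (by split_ifs at h4 <;> omega)
      refine ⟨u, v, h1, ?_, h3, ?_, (hadj u v).2 (Or.inl h5)⟩ <;> split_ifs at * <;> omega

/-- A vertex of an inner column leaves its column only along its row. -/
lemma slabGraph_adj_skipColumn {m j : ℕ} (hj : 0 < j) (hjm : j < m) (p : P)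
    (w : U ⊕ (Fin m × P)) :
    (slabGraph GU GP L R (m + 1)).Adj (.inr (⟨j, by omega⟩, p)) (skipColumn m j w) ↔
      ∃ i : Fin m, w = .inr (i, p) ∧ ((i : ℕ) + 1 = j ∨ (i : ℕ) = j) := by
  rcases w with u | ⟨i, p'⟩
  · simp only [skipColumn_inl, slabGraph_inr_inl, reduceCtorEq, false_and, exists_false, iff_false]
    omega
  · have e : (∃ i' : Fin m, (Sum.inr (i, p') : U ⊕ (Fin m × P)) = .inr (i', p) ∧
        ((i' : ℕ) + 1 = j ∨ (i' : ℕ) = j)) ↔ p' = p ∧ ((i : ℕ) + 1 = j ∨ (i : ℕ) = j) := by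
      constructor
      · rintro ⟨i', h1, h2⟩
        simp only [Sum.inr.injEq, Prod.mk.injEq] at h1
        obtain ⟨rfl, rfl⟩ := h1
        exact ⟨rfl, h2⟩
      · rintro ⟨rfl, h⟩
        exact ⟨i, rfl, h⟩
    rw [e]
    rcases lt_or_ge (i : ℕ) j with h | h
    · rw [skipColumn_of_lt h]
      simp only [slabGraph_inr_inr, Fin.ext_iff, Fin.val_castSucc]
      constructor
      · rintro (⟨h1, _⟩ | ⟨h1, rfl⟩)
        · omega
        · exact ⟨rfl, by omega⟩
      · rintro ⟨rfl, h1⟩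
        exact Or.inr ⟨by omega, rfl⟩
    · rw [skipColumn_of_ge h]
      simp only [slabGraph_inr_inr, Fin.ext_iff, Fin.val_succ]
      constructor
      · rintro (⟨h1, _⟩ | ⟨h1, rfl⟩)
        · omega
        · exact ⟨rfl, by omega⟩
      · rintro ⟨rfl, h1⟩
        exact Or.inr ⟨by omega, rfl⟩

/-- Inserting a column into a slab, next to a column which is mapped to a column of the grid. -/
lemma GridMap.insertColumn {m j r q d : ℕ} {X' Y' : U ⊕ (Fin m × P) → ℕ} {ρ : P → ℕ}
    (h : GridMap (slabGraph GU GP L R m) r q X' Y') (ha : Aligned m j r d X' Y' ρ) :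
    ∃ X Y, GridMap (slabGraph GU GP L R (m + 1)) r (q + 1) X Y := by
  have hj0 := ha.j_pos
  have hjm := ha.j_lt
  -- The new column receives index `j + 1`, between the old columns `j` and `j + 1`, and becomes the
  -- new grid column `d + 1`.
  have hadj := slabGraph_adj_iff_skipColumn GU GP L R (show 0 < j + 1 by omega) hjm
  set ι := skipColumn (U := U) (P := P) m (j + 1) with hι
  have hinj : Function.Injective ι := skipColumn_injective m (j + 1)
  let new : P → U ⊕ (Fin (m + 1) × P) := fun p => .inr (⟨j + 1, by omega⟩, p)
  have hnew : ∀ p, ¬ ∃ w, ι w = new p := by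
    rintro p ⟨w, hw⟩
    exact skipColumn_ne w ⟨j + 1, by omega⟩ rfl p hw
  have hcases : ∀ v, (∃ p, v = new p) ∨ ∃ w, ι w = v :=
    fun v => exists_skipColumn_eq (show j + 1 ≤ m by omega) v
  obtain ⟨X, hX, hXnew⟩ : ∃ X : U ⊕ (Fin (m + 1) × P) → ℕ, (∀ w, X (ι w) = X' w) ∧
      ∀ p, X (new p) = ρ p := by
    -- Only the vertices of the new column lie outside the range of `ι`, so the value `0` on `U` is
    -- never used.
    refine ⟨Function.extend ι X' (Sum.elim (fun _ => 0) fun x => ρ x.2), ?_, ?_⟩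
    · exact fun w => hinj.extend_apply _ _ _
    · intro p; rw [Function.extend_apply' _ _ _ (hnew p)]; rfl
  obtain ⟨Y, hY, hYnew⟩ : ∃ Y : U ⊕ (Fin (m + 1) × P) → ℕ,
      (∀ w, Y (ι w) = if Y' w ≤ d then Y' w else Y' w + 1) ∧ ∀ p, Y (new p) = d + 1 := by
    refine ⟨Function.extend ι (fun w => if Y' w ≤ d then Y' w else Y' w + 1) fun _ => d + 1,
      ?_, ?_⟩
    · exact fun w => hinj.extend_apply _ _ _
    · intro p; rw [Function.extend_apply' _ _ _ (hnew p)]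
  have hYd : ∀ w, Y (ι w) ≠ d + 1 := by
    intro w; rw [hY]; split_ifs <;> omega
  have hj' : ∀ (i : Fin m) p, (i : ℕ) = j ∨ (i : ℕ) = j + 1 →
      X' (.inr (i, p)) = ρ p ∧ Y' (.inr (i, p)) + j = d + i :=
    fun i p hi => ⟨ha.X_eq i p (Or.inr hi), ha.Y_eq i p (Or.inr hi)⟩
  have hdq : ∀ a < r, d + 1 < q := by
    intro a har
    obtain ⟨p, -⟩ := ha.surj a har
    have h1 := h.Y_lt (.inr (⟨j + 1, by omega⟩, p))
    have h2 := (hj' ⟨j + 1, by omega⟩ p (by simp)).2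
    simp only at h2
    omega
  have hbr : ∀ u v, Bridge m (j + 1) u v → X' u = X' v ∧ Y' u = d ∧ Y' v = d + 1 := by
    rintro _ _ ⟨i, i', p, h1, h2, rfl, rfl⟩
    have h3 := hj' i p (by omega)
    have h4 := hj' i' p (by omega)
    omega
  -- In the longer slab the new column separates the two ends of a bridge. Conversely, by `hbr2`,
  -- any two vertices in the same grid row and in the columns `d` and `d + 1` form a bridge. So no
  -- edge of the longer slab between old vertices spans the inserted grid column.
  have hbr' : ∀ u v, Bridge m (j + 1) u v →
      ¬ (slabGraph GU GP L R (m + 1)).Adj (ι u) (ι v) := by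
    rintro _ _ ⟨i, i', p, h1, h2, rfl, rfl⟩
    rw [hι, skipColumn_of_lt (by omega), skipColumn_of_ge (by omega)]
    simp only [slabGraph_inr_inr, Fin.ext_iff, Fin.val_castSucc, Fin.val_succ]
    omega
  have hbr2 : ∀ u v, X' u = X' v → Y' u = d → Y' v = d + 1 → Bridge m (j + 1) u v := by
    intro u v h1 h2 h3
    obtain ⟨i, p, rfl, h4⟩ := ha.eq_of_Y u (by omega)
    obtain ⟨i', p', rfl, h5⟩ := ha.eq_of_Y v (by omega)
    have h6 := (hj' i p (by omega)).1
    have h7 := (hj' i' p' (by omega)).1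
    have : p = p' := ha.injective (by omega)
    subst this
    exact ⟨i, i', p, by omega, by omega, rfl, rfl⟩
  have hcol : ∀ p, ∃ w, X' w = ρ p ∧ Y' w = d ∧
      (slabGraph GU GP L R (m + 1)).Adj (new p) (ι w) := by
    intro p
    have h1 := hj' ⟨j, by omega⟩ p (Or.inl rfl)
    refine ⟨.inr (⟨j, by omega⟩, p), h1.1, by simpa using h1.2, ?_⟩
    exact (slabGraph_adj_skipColumn (by omega) hjm p _).2 ⟨_, rfl, by simp⟩
  have hcol' : ∀ p, ∃ w, X' w = ρ p ∧ Y' w = d + 1 ∧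
      (slabGraph GU GP L R (m + 1)).Adj (new p) (ι w) := by
    intro p
    have h1 := hj' ⟨j + 1, by omega⟩ p (Or.inr rfl)
    refine ⟨.inr (⟨j + 1, by omega⟩, p), h1.1, by have := h1.2; simp only at this; omega, ?_⟩
    exact (slabGraph_adj_skipColumn (by omega) hjm p _).2 ⟨_, rfl, by simp⟩
  have hnear : ∀ p w, (slabGraph GU GP L R (m + 1)).Adj (new p) (ι w) →
      X' w = ρ p ∧ (Y' w = d ∨ Y' w = d + 1) := by
    intro p w hw
    obtain ⟨i, rfl, hi⟩ := (slabGraph_adj_skipColumn (by omega) hjm p _).1 hw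
    have := hj' i p (by omega)
    omega
  refine ⟨X, Y, ?_, ?_, ?_, ?_, ?_, ?_⟩
  · intro v
    rcases hcases v with ⟨p, rfl⟩ | ⟨w, rfl⟩
    · rw [hXnew]; exact ha.lt p
    · rw [hX]; exact h.X_lt w
  · intro v
    rcases hcases v with ⟨p, rfl⟩ | ⟨w, rfl⟩
    · rw [hYnew]
      have := hdq _ (ha.lt p)
      omega
    · rw [hY]
      have := h.Y_lt w
      split_ifs <;> omega
  · intro a har b hb
    by_cases hbd : b = d + 1
    · subst hbd
      obtain ⟨p, rfl⟩ := ha.surj a har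
      apply connected_induce_singleton _ (v := new p)
      ext v
      simp only [Set.mem_ofPred_eq, Set.mem_singleton_iff]
      constructor
      · rintro ⟨h1, h2⟩
        rcases hcases v with ⟨p', rfl⟩ | ⟨w, rfl⟩
        · rw [hXnew] at h1
          rw [ha.injective h1]
        · exact absurd h2 (hYd w)
      · rintro rfl
        exact ⟨hXnew p, hYnew p⟩
    · have hdq' := hdq a har
      have key : ∀ w, Y (ι w) = b ↔ Y' w = if b ≤ d then b else b - 1 := by
        intro w
        rw [hY]
        split_ifs <;> omega
      have hc := h.conn a har (if b ≤ d then b else b - 1) (by split_ifs <;> omega)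
      refine connected_induce_of_map ι ?_ ?_ ?_ hc
      · rintro w ⟨h1, h2⟩
        exact ⟨(hX w).trans h1, (key w).2 h2⟩
      · rintro v ⟨h1, h2⟩
        rcases hcases v with ⟨p, rfl⟩ | ⟨w, rfl⟩
        · rw [hYnew] at h2; omega
        · exact ⟨w, ⟨(hX w).symm.trans h1, (key w).1 h2⟩, rfl⟩
      · rintro u ⟨_, hu⟩ v ⟨_, hv⟩ huv
        rcases (hadj u v).1 huv with h1 | h1 | h1
        · exact h1
        · have := hbr _ _ h1; omega
        · have := hbr _ _ h1; omega
  · intro u v huv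
    rcases hcases u with ⟨p, rfl⟩ | ⟨u, rfl⟩ <;> rcases hcases v with ⟨p', rfl⟩ | ⟨v, rfl⟩
    · have hpp : GP.Adj p p' := by
        rcases huv with ⟨_, h1⟩ | ⟨h1, _⟩
        · exact h1
        · simp at h1
      have h1 := h.near (.inr (⟨j, by omega⟩, p)) (.inr (⟨j, by omega⟩, p'))
        ((slabGraph_inr_inr _ _ _ _ _ _ _ _).2 (Or.inl ⟨rfl, hpp⟩))
      have h2 := hj' ⟨j, by omega⟩ p (Or.inl rfl)
      have h3 := hj' ⟨j, by omega⟩ p' (Or.inl rfl)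
      rw [hXnew, hXnew, hYnew, hYnew]
      unfold Near at *
      omega
    · have := hnear _ _ huv
      rw [hXnew, hYnew, hX, hY]
      unfold Near
      split_ifs <;> omega
    · have := hnear _ _ huv.symm
      rw [hXnew, hYnew, hX, hY]
      unfold Near
      split_ifs <;> omega
    · have h1 := h.near u v ((hadj u v).2 (Or.inl huv))
      have h2 : ¬ (X' u = X' v ∧ Y' u = d ∧ Y' v = d + 1) :=
        fun ⟨e1, e2, e3⟩ => hbr' _ _ (hbr2 u v e1 e2 e3) huv
      have h3 : ¬ (X' v = X' u ∧ Y' v = d ∧ Y' u = d + 1) :=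
        fun ⟨e1, e2, e3⟩ => hbr' _ _ (hbr2 v u e1 e2 e3) huv.symm
      rw [hX, hX, hY, hY]
      unfold Near at *
      split_ifs <;> omega
  · intro a b har hb
    by_cases hbd : b = d + 1
    · subst hbd
      have h1 := hdq _ har
      -- The new column is a copy of column `j`, so its vertical grid edges come from the edges of
      -- `P` that realise those of grid column `d`.
      obtain ⟨u, v, h2, h3, h4, h5, h6⟩ := h.edgeX a d har (by omega)
      obtain ⟨i, p, rfl, h7⟩ := ha.eq_of_Y u (by omega)
      obtain ⟨i', p', rfl, h8⟩ := ha.eq_of_Y v (by omega)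
      have h9 := hj' i p (by omega)
      have h10 := hj' i' p' (by omega)
      refine ⟨new p, new p', ?_, hYnew p, ?_, hYnew p', ?_⟩
      · rw [hXnew]; omega
      · rw [hXnew]; omega
      · rcases h6 with ⟨_, h6⟩ | ⟨h6, _⟩
        · exact Or.inl ⟨rfl, h6⟩
        · omega
    · have h1 := hdq _ har
      obtain ⟨u, v, h2, h3, h4, h5, h6⟩ := h.edgeX a (if b ≤ d then b else b - 1) har
        (by split_ifs <;> omega)
      refine ⟨ι u, ι v, (hX u).trans h2, ?_, (hX v).trans h4, ?_, ?_⟩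
      · rw [hY, h3]; split_ifs <;> omega
      · rw [hY, h5]; split_ifs <;> omega
      · rcases (hadj u v).1 h6 with h7 | h7 | h7
        · exact h7
        · have := hbr _ _ h7; omega
        · have := hbr _ _ h7; omega
  · intro a b har hb
    have h1 := hdq _ har
    by_cases hbd : b = d
    · subst hbd
      obtain ⟨p, rfl⟩ := ha.surj a har
      obtain ⟨w, h2, h3, h4⟩ := hcol p
      exact ⟨ι w, new p, (hX w).trans h2, by rw [hY, h3]; simp, hXnew p, hYnew p, h4.symm⟩
    · by_cases hbd' : b = d + 1
      · subst hbd'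
        obtain ⟨p, rfl⟩ := ha.surj a har
        obtain ⟨w, h2, h3, h4⟩ := hcol' p
        exact ⟨new p, ι w, hXnew p, hYnew p, (hX w).trans h2, by rw [hY, h3]; simp, h4⟩
      · obtain ⟨u, v, h2, h3, h4, h5, h6⟩ := h.edgeY a (if b ≤ d then b else b - 1) har
          (by split_ifs <;> omega)
        refine ⟨ι u, ι v, (hX u).trans h2, ?_, (hX v).trans h4, ?_, ?_⟩
        · rw [hY, h3]; split_ifs <;> omega
        · rw [hY, h5]; split_ifs <;> omega
        · rcases (hadj u v).1 h6 with h7 | h7 | h7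
          · exact h7
          · have := hbr _ _ h7; split_ifs at h3 h5 <;> omega
          · have := hbr _ _ h7; split_ifs at h3 h5 <;> omega

end GridContraction

/-! ### Columns of a slab which are columns of the grid -/

namespace GridContraction

variable {U P : Type*} {GU : SimpleGraph U} {GP : SimpleGraph P} {L R : U → P → Prop}

/-- Four cells of the grid which form a cycle form a square. -/
lemma near_square {xa ya xb yb xc yc xd yd : ℕ} (h1 : Near xa ya xb yb) (h2 : Near xb yb xc yc)
    (h3 : Near xd yd xc yc) (h4 : Near xa ya xd yd) (n1 : ¬ (xa = xb ∧ ya = yb))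
    (n2 : ¬ (xb = xc ∧ yb = yc)) (n3 : ¬ (xd = xc ∧ yd = yc)) (n4 : ¬ (xa = xd ∧ ya = yd))
    (n5 : ¬ (xa = xc ∧ ya = yc)) (n6 : ¬ (xb = xd ∧ yb = yd)) :
    xa + xc = xb + xd ∧ ya + yc = yb + yd ∧
      ((xa = xb ∧ yb = yc) ∨ (ya = yb ∧ xb = xc)) := by
  rcases h1 with ⟨rfl, rfl | rfl | rfl⟩ | ⟨rfl, rfl | rfl⟩ <;>
  rcases h2 with ⟨rfl, h2⟩ | ⟨rfl, h2⟩ <;>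
  rcases h4 with ⟨rfl, h4⟩ | ⟨rfl, h4⟩ <;>
  rcases h3 with ⟨h3', h3⟩ | ⟨h3', h3⟩ <;> omega

/-- Two squares of the grid with a common side lie in a straight strip. -/
lemma near_straight {xa ya xb yb xc yc xb' yb' xc' yc' : ℕ} (h1 : Near xa ya xb yb)
    (h2 : Near xb yb xc yc) (n1 : ¬ (xa = xb ∧ ya = yb)) (n2 : ¬ (xb = xc ∧ yb = yc))
    (n3 : ¬ (xa = xc ∧ ya = yc)) (n4 : ¬ (xb = xb' ∧ yb = yb'))
    (s1 : (xa = xb ∧ yb = yb') ∨ (ya = yb ∧ xb = xb'))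
    (s2 : (xb = xc ∧ yc = yc') ∨ (yb = yc ∧ xc = xc'))
    (s3 : xb + xc' = xc + xb') (s4 : yb + yc' = yc + yb') :
    (xb = xa ∧ xc = xb ∧ (yb = ya + 1 ∧ yc = yb + 1 ∨ ya = yb + 1 ∧ yb = yc + 1)) ∨
    (yb = ya ∧ yc = yb ∧ (xb = xa + 1 ∧ xc = xb + 1 ∨ xa = xb + 1 ∧ xb = xc + 1)) := by
  rcases s1 with ⟨rfl, rfl⟩ | ⟨rfl, rfl⟩ <;> rcases s2 with ⟨rfl, rfl⟩ | ⟨rfl, rfl⟩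
  · refine Or.inl ⟨rfl, rfl, ?_⟩
    rcases h1 with ⟨-, h1⟩ | ⟨h1, h1'⟩ <;> rcases h2 with ⟨-, h2⟩ | ⟨h2, h2'⟩ <;> omega
  · omega
  · omega
  · refine Or.inr ⟨rfl, rfl, ?_⟩
    rcases h1 with ⟨h1, h1'⟩ | ⟨-, h1⟩ <;> rcases h2 with ⟨h2, h2'⟩ | ⟨-, h2⟩ <;> omega

/-- All vertices in the columns `j - 1`, `j` and `j + 1` are alone in their cells. -/
def AloneColumns (m j : ℕ) (X Y : U ⊕ (Fin m × P) → ℕ) : Prop :=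
  ∀ (i : Fin m) (p : P), (i : ℕ) + 1 = j ∨ (i : ℕ) = j ∨ (i : ℕ) = j + 1 → Alone X Y (.inr (i, p))

-- The bad vertices are the at most `k` non-representatives and their at most `k` representatives; a
-- vertex that is not bad shares its cell with nobody. These `2k` vertices cannot meet all of the
-- `2k + 1` disjoint triples of columns available.
open Classical in
lemma GridMap.exists_aloneColumns [Finite U] [Finite P] {m r q k : ℕ}
    {X Y : U ⊕ (Fin m × P) → ℕ} (h : GridMap (slabGraph GU GP L R m) r q X Y)
    (hk : Nat.card (U ⊕ (Fin m × P)) ≤ r * q + k) (hm : 6 * k + 3 ≤ m) :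
    ∃ j, 0 < j ∧ j + 1 < m ∧ AloneColumns m j X Y := by
  have := Fintype.ofFinite U
  have := Fintype.ofFinite P
  obtain ⟨ρ, B, h1, h2, h3, h4⟩ := h.exists_representatives hk
  -- The number of the triple that contains a vertex. Vertices of `U` count towards triple `0`,
  -- which is harmless.
  let g : U ⊕ (Fin m × P) → ℕ := Sum.elim (fun _ => 0) fun x => x.1 / 3
  have hcard : ((B ∪ B.image ρ).image g).card < (Finset.range (2 * k + 1)).card := by
    have e1 := Finset.card_image_le (s := B ∪ B.image ρ) (f := g)
    have e2 := Finset.card_union_le B (B.image ρ)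
    have e3 := Finset.card_image_le (s := B) (f := ρ)
    rw [Finset.card_range]
    omega
  obtain ⟨b, hb1, hb2⟩ := Finset.exists_mem_notMem_of_card_lt_card hcard
  rw [Finset.mem_range] at hb1
  -- The middle column of the triple `3b, 3b + 1, 3b + 2`.
  refine ⟨3 * b + 1, by omega, by omega, ?_⟩
  intro i p hi w hw1 hw2
  have hbad : Sum.inr (i, p) ∉ B ∪ B.image ρ := by
    intro hmem
    refine hb2 (Finset.mem_image.2 ⟨_, hmem, ?_⟩)
    simp only [g, Sum.elim_inr]
    omega
  rw [Finset.mem_union, not_or, Finset.mem_image, h3] at hbad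
  by_contra hne
  have e := (h2 w _ hw1 hw2).trans hbad.1
  refine hbad.2 ⟨w, ?_, e⟩
  by_contra hwB
  rw [h3, e] at hwB
  exact hne hwB.symm

/-- The vertices of row `p` in the columns `j - 1`, `j` and `j + 1` are mapped to successive cells
of a row of the grid. -/
def Ascending (m j : ℕ) (X Y : U ⊕ (Fin m × P) → ℕ) (p : P) : Prop :=
  ∀ (i i' : Fin m), ((i : ℕ) + 1 = j ∧ (i' : ℕ) = j ∨ (i : ℕ) = j ∧ (i' : ℕ) = j + 1) →
    X (.inr (i', p)) = X (.inr (i, p)) ∧ Y (.inr (i', p)) = Y (.inr (i, p)) + 1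

/-- An edge of `P` and two consecutive columns span a 4-cycle; its vertices are alone in their
cells, hence in four distinct cells, and `near_square` applies. Consequently the displacement from
column to column is the same in adjacent rows. -/
lemma GridMap.square {m j r q : ℕ} {X Y : U ⊕ (Fin m × P) → ℕ}
    (h : GridMap (slabGraph GU GP L R m) r q X Y) (hal : AloneColumns m j X Y) {p p' : P}
    (hp : GP.Adj p p') {i i' : Fin m}
    (hi : (i : ℕ) + 1 = j ∧ (i' : ℕ) = j ∨ (i : ℕ) = j ∧ (i' : ℕ) = j + 1) :
    X (.inr (i, p)) + X (.inr (i', p')) = X (.inr (i', p)) + X (.inr (i, p')) ∧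
    Y (.inr (i, p)) + Y (.inr (i', p')) = Y (.inr (i', p)) + Y (.inr (i, p')) ∧
    (X (.inr (i, p)) = X (.inr (i', p)) ∧ Y (.inr (i', p)) = Y (.inr (i', p')) ∨
      Y (.inr (i, p)) = Y (.inr (i', p)) ∧ X (.inr (i', p)) = X (.inr (i', p'))) := by
  have hne : ∀ (a b : Fin m) (c d : P), (a : ℕ) + 1 = j ∨ (a : ℕ) = j ∨ (a : ℕ) = j + 1 →
      (a ≠ b ∨ c ≠ d) → ¬ (X (.inr (a, c)) = X (.inr (b, d)) ∧ Y (.inr (a, c)) = Y (.inr (b, d))) := by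
    rintro a b c d ha hab ⟨e1, e2⟩
    have := hal a c ha (.inr (b, d)) e1.symm e2.symm
    simp only [Sum.inr.injEq, Prod.mk.injEq] at this
    rcases hab with hab | hab
    · exact hab this.1.symm
    · exact hab this.2.symm
  have hii : i ≠ i' := by rintro rfl; omega
  refine near_square (h.near _ _ ?_) (h.near _ _ ?_) (h.near _ _ ?_) (h.near _ _ ?_)
    (hne _ _ _ _ (by omega) (Or.inl hii)) (hne _ _ _ _ (by omega) (Or.inr hp.ne))
    (hne _ _ _ _ (by omega) (Or.inl hii)) (hne _ _ _ _ (by omega) (Or.inr hp.ne))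
    (hne _ _ _ _ (by omega) (Or.inl hii)) (hne _ _ _ _ (by omega) (Or.inl hii.symm))
  · rw [slabGraph_inr_inr]; exact Or.inr ⟨by omega, rfl⟩
  · rw [slabGraph_inr_inr]; exact Or.inl ⟨rfl, hp⟩
  · rw [slabGraph_inr_inr]; exact Or.inr ⟨by omega, rfl⟩
  · rw [slabGraph_inr_inr]; exact Or.inl ⟨rfl, hp⟩

/-- One well-placed row determines the others: squares carry its direction to adjacent rows, and `P`
is connected. The middle column then lies in a single grid column and fills it, since edges that run
along that grid column cannot leave the slab column. -/
lemma GridMap.aligned_of_ascending {m j r q : ℕ} {X Y : U ⊕ (Fin m × P) → ℕ} (hGP : GP.Connected)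
    (h : GridMap (slabGraph GU GP L R m) r q X Y) (hal : AloneColumns m j X Y) (hj : 0 < j)
    (hjm : j + 1 < m) {p0 : P} (hp0 : Ascending m j X Y p0) : ∃ d ρ, Aligned m j r d X Y ρ := by
  obtain ⟨i0, hi0⟩ : ∃ i : Fin m, (i : ℕ) + 1 = j := ⟨⟨j - 1, by omega⟩, by simp only; omega⟩
  obtain ⟨i1, hi1⟩ : ∃ i : Fin m, (i : ℕ) = j := ⟨⟨j, by omega⟩, rfl⟩
  obtain ⟨i2, hi2⟩ : ∃ i : Fin m, (i : ℕ) = j + 1 := ⟨⟨j + 1, by omega⟩, rfl⟩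
  -- Induction along a walk in `P`. The sides of a square are perpendicular, so moving to an
  -- adjacent row leaves `Y` unchanged.
  have hall : ∀ p, Ascending m j X Y p ∧ Y (.inr (i1, p)) = Y (.inr (i1, p0)) := by
    intro p
    have := (SimpleGraph.reachable_iff_reflTransGen _ _).1 (hGP p0 p)
    induction this with
    | refl => exact ⟨hp0, rfl⟩
    | tail _ hpp ih =>
      obtain ⟨ih1, ih2⟩ := ih
      constructor
      · intro i i' hi
        have e1 := ih1 i i' hi
        have e2 := h.square hal hpp hi
        omega
      · have e1 := ih1 i0 i1 (Or.inl ⟨hi0, hi1⟩)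
        have e2 := h.square hal hpp (Or.inl ⟨hi0, hi1⟩)
        omega
  set d := Y (.inr (i1, p0)) with hd
  have hcol : ∀ (i : Fin m) p, (i : ℕ) + 1 = j ∨ (i : ℕ) = j ∨ (i : ℕ) = j + 1 →
      X (.inr (i, p)) = X (.inr (i1, p)) ∧ Y (.inr (i, p)) + j = d + i := by
    intro i p hi
    obtain ⟨e1, e2⟩ := hall p
    have e3 := e1 i0 i1 (Or.inl ⟨hi0, hi1⟩)
    have e4 := e1 i1 i2 (Or.inr ⟨hi1, hi2⟩)
    rcases hi with hi | hi | hi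
    · obtain rfl : i = i0 := by ext; omega
      omega
    · obtain rfl : i = i1 := by ext; omega
      omega
    · obtain rfl : i = i2 := by ext; omega
      omega
  have hcell : ∀ v p, X v = X (.inr (i1, p)) → Y v = d → v = .inr (i1, p) :=
    fun v p e1 e2 => hal i1 p (by omega) v e1 (by rw [e2, (hall p).2])
  -- A neighbour of the middle column lies in the columns `j - 1`, `j` or `j + 1`, whose grid
  -- columns differ; with `Y v = d` it must lie in column `j`.
  have hnb : ∀ u v p, (slabGraph GU GP L R m).Adj u v → X u = X (.inr (i1, p)) → Y u = d →
      Y v = d → ∃ p', X (.inr (i1, p')) = X v := by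
    intro u v p huv e1 e2 e3
    obtain rfl := hcell u p e1 e2
    rcases v with v | ⟨i, p'⟩
    · rw [slabGraph_inr_inl] at huv; omega
    · rw [slabGraph_inr_inr] at huv
      rcases huv with ⟨rfl, _⟩ | ⟨e4, rfl⟩
      · exact ⟨p', rfl⟩
      · have := hcol i p (by omega)
        omega
  have hdq := h.Y_lt (.inr (i1, p0))
  -- From any occupied row the grid edges of column `d` lead down to row `0`, and from there up to
  -- every row.
  have hsurj : ∀ a < r, ∃ p, X (.inr (i1, p)) = a := by
    have hdown : ∀ n, (∃ p, X (.inr (i1, p)) = n) → ∃ p, X (.inr (i1, p)) = 0 := by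
      intro n
      induction n with
      | zero => exact id
      | succ n ih =>
        rintro ⟨p, hp⟩
        obtain ⟨u, v, e1, e2, e3, e4, e5⟩ := h.edgeX n d (by rw [← hp]; exact h.X_lt _) hdq
        obtain ⟨p', hp'⟩ := hnb v u p e5.symm (by omega) e4 e2
        exact ih ⟨p', by omega⟩
    intro a
    induction a with
    | zero => intro _; exact hdown _ ⟨p0, rfl⟩
    | succ a ih =>
      intro har
      obtain ⟨p, hp⟩ := ih (by omega)
      obtain ⟨u, v, e1, e2, e3, e4, e5⟩ := h.edgeX a d har hdq
      obtain ⟨p', hp'⟩ := hnb u v p e5 (by omega) e2 e4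
      exact ⟨p', by omega⟩
  refine ⟨d, fun p => X (.inr (i1, p)), hj, hjm, ?_, ?_, fun p => h.X_lt _, hsurj,
    fun i p hi => (hcol i p hi).1, fun i p hi => (hcol i p hi).2, ?_⟩
  · have := (hcol i0 p0 (by omega)).2
    omega
  · intro p p' hpp
    have := hcell (.inr (i1, p)) p' hpp (hall p).2
    simpa using this
  · intro v hv
    obtain ⟨p, hp⟩ := hsurj _ (h.X_lt v)
    obtain ⟨i, hi, hi'⟩ : ∃ i : Fin m, ((i : ℕ) + 1 = j ∨ (i : ℕ) = j ∨ (i : ℕ) = j + 1) ∧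
        Y v + j = d + i := by
      rcases hv with hv | hv | hv
      · exact ⟨i0, by omega, by omega⟩
      · exact ⟨i1, by omega, by omega⟩
      · exact ⟨i2, by omega, by omega⟩
    have := hcol i p hi
    exact ⟨i, p, hal i p hi v (by omega) (by omega), hi'⟩

/-- After a symmetry of the grid, some column of a long slab is a column of the grid, and so are
its neighbours. -/
lemma GridMap.exists_aligned [Finite U] [Finite P] [Nontrivial P] (hGP : GP.Connected)
    {m r q k : ℕ} {X Y : U ⊕ (Fin m × P) → ℕ} (h : GridMap (slabGraph GU GP L R m) r q X Y)
    (hr : 2 ≤ r) (hq : 2 ≤ q) (hk : Nat.card (U ⊕ (Fin m × P)) ≤ r * q + k)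
    (hm : 6 * k + 3 ≤ m) :
    ∃ r' q' X' Y' j d ρ, GridMap (slabGraph GU GP L R m) r' q' X' Y' ∧ 2 ≤ r' ∧ 2 ≤ q' ∧
      r' * q' = r * q ∧ Aligned m j r' d X' Y' ρ := by
  obtain ⟨j, hj, hjm, hal⟩ := h.exists_aloneColumns hk hm
  have hsw : AloneColumns m j Y X := fun i p hi w h1 h2 => hal i p hi w h2 h1
  have hrefl : ∀ {X Y : U ⊕ (Fin m × P) → ℕ} {q : ℕ}, (∀ v, Y v < q) → AloneColumns m j X Y →
      AloneColumns m j X fun v => q - 1 - Y v := by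
    intro X Y q hY hal i p hi w h1 h2
    have e1 := hY w
    have e2 := hY (.inr (i, p))
    exact hal i p hi w h1 (by simp only at h2; omega)
  obtain ⟨p0⟩ := hGP.nonempty
  -- A second row is essential: a single path could turn a corner of the grid.
  obtain ⟨p1, hp1⟩ := hGP.preconnected.exists_adj_of_nontrivial p0
  obtain ⟨i0, hi0⟩ : ∃ i : Fin m, (i : ℕ) + 1 = j := ⟨⟨j - 1, by omega⟩, by simp only; omega⟩
  obtain ⟨i1, hi1⟩ : ∃ i : Fin m, (i : ℕ) = j := ⟨⟨j, by omega⟩, rfl⟩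
  obtain ⟨i2, hi2⟩ : ∃ i : Fin m, (i : ℕ) = j + 1 := ⟨⟨j + 1, by omega⟩, rfl⟩
  have s1 := h.square hal hp1 (Or.inl ⟨hi0, hi1⟩)
  have s2 := h.square hal hp1 (Or.inr ⟨hi1, hi2⟩)
  have n1 := h.near (.inr (i0, p0)) (.inr (i1, p0))
    ((slabGraph_inr_inr _ _ _ _ _ _ _ _).2 (Or.inr ⟨by omega, rfl⟩))
  have n2 := h.near (.inr (i1, p0)) (.inr (i2, p0))
    ((slabGraph_inr_inr _ _ _ _ _ _ _ _).2 (Or.inr ⟨by omega, rfl⟩))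
  have hne : ∀ i i' : Fin m, (i : ℕ) + 1 = j ∨ (i : ℕ) = j ∨ (i : ℕ) = j + 1 →
      (i : ℕ) ≠ i' → ¬ (X (.inr (i, p0)) = X (.inr (i', p0)) ∧
        Y (.inr (i, p0)) = Y (.inr (i', p0))) := by
    rintro i i' hi hii ⟨e1, e2⟩
    have := hal i p0 hi (.inr (i', p0)) e1.symm e2.symm
    simp only [Sum.inr.injEq, Prod.mk.injEq, and_true] at this
    exact hii (by rw [this])
  have hne' : ¬ (X (.inr (i1, p0)) = X (.inr (i1, p1)) ∧
      Y (.inr (i1, p0)) = Y (.inr (i1, p1))) := by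
    rintro ⟨e1, e2⟩
    have := hal i1 p0 (by omega) (.inr (i1, p1)) e1.symm e2.symm
    simp only [Sum.inr.injEq, Prod.mk.injEq, true_and] at this
    exact hp1.ne this.symm
  have d1 := hne i0 i1 (by omega) (by omega)
  have d2 := hne i1 i2 (by omega) (by omega)
  have d3 := hne i0 i2 (by omega) (by omega)
  have hasc : ∀ (X Y : U ⊕ (Fin m × P) → ℕ), X (.inr (i1, p0)) = X (.inr (i0, p0)) →
      X (.inr (i2, p0)) = X (.inr (i1, p0)) → Y (.inr (i1, p0)) = Y (.inr (i0, p0)) + 1 →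
      Y (.inr (i2, p0)) = Y (.inr (i1, p0)) + 1 → Ascending m j X Y p0 := by
    rintro X Y e1 e2 e3 e4 i i' (⟨h1, h2⟩ | ⟨h1, h2⟩)
    · obtain rfl : i = i0 := by ext; omega
      obtain rfl : i' = i1 := by ext; omega
      exact ⟨e1, e3⟩
    · obtain rfl : i = i1 := by ext; omega
      obtain rfl : i' = i2 := by ext; omega
      exact ⟨e2, e4⟩
  have b0 := h.Y_lt (.inr (i0, p0))
  have b1 := h.Y_lt (.inr (i1, p0))
  have b2 := h.Y_lt (.inr (i2, p0))
  have c0 := h.X_lt (.inr (i0, p0))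
  have c1 := h.X_lt (.inr (i1, p0))
  have c2 := h.X_lt (.inr (i2, p0))
  -- Row `p0` runs straight in one of the four directions; transposing and reflecting the grid make
  -- it ascending.
  have hcases := near_straight n1 n2 d1 d2 d3 hne' s1.2.2 s2.2.2 s2.1 s2.2.1
  clear s1 s2 n1 n2 d1 d2 d3 hne hne'
  rcases hcases with ⟨e1, e2, ⟨e3, e4⟩ | ⟨e3, e4⟩⟩ | ⟨e1, e2, ⟨e3, e4⟩ | ⟨e3, e4⟩⟩
  · obtain ⟨d, ρ, ha⟩ := h.aligned_of_ascending hGP hal hj hjm (hasc _ _ e1 e2 e3 e4)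
    exact ⟨r, q, _, _, j, d, ρ, h, hr, hq, rfl, ha⟩
  · obtain ⟨d, ρ, ha⟩ := h.reflect.aligned_of_ascending hGP (hrefl h.Y_lt hal) hj hjm
      (hasc _ _ e1 e2 (by omega) (by omega))
    exact ⟨r, q, _, _, j, d, ρ, h.reflect, hr, hq, rfl, ha⟩
  · obtain ⟨d, ρ, ha⟩ := h.swap.aligned_of_ascending hGP hsw hj hjm (hasc _ _ e1 e2 e3 e4)
    exact ⟨q, r, _, _, j, d, ρ, h.swap, hq, hr, mul_comm _ _, ha⟩
  · obtain ⟨d, ρ, ha⟩ := h.swap.reflect.aligned_of_ascending hGP (hrefl h.X_lt hsw) hj hjm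
      (hasc _ _ e1 e2 (by omega) (by omega))
    exact ⟨q, r, _, _, j, d, ρ, h.swap.reflect, hq, hr, mul_comm _ _, ha⟩

/-- This makes the count balance: a slab column has as many vertices as a grid column has cells. -/
lemma Aligned.card_eq {m j r d : ℕ} {X Y : U ⊕ (Fin m × P) → ℕ} {ρ : P → ℕ}
    (ha : Aligned m j r d X Y ρ) : Nat.card P = r := by
  have : Function.Bijective fun p => (⟨ρ p, ha.lt p⟩ : Fin r) :=
    ⟨fun p p' h => ha.injective (by simpa using h), fun a => by
      obtain ⟨p, hp⟩ := ha.surj a a.2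
      exact ⟨p, Fin.ext hp⟩⟩
  rw [Nat.card_congr (Equiv.ofBijective _ this), Nat.card_fin]

lemma card_slab [Finite U] [Finite P] (m : ℕ) :
    Nat.card (U ⊕ (Fin m × P)) = Nat.card U + m * Nat.card P := by
  rw [Nat.card_sum, Nat.card_prod, Nat.card_fin]

/-- One column more or less in a long slab does not matter. -/
theorem contractible_slabGraph_succ [Finite U] [Finite P] [Nontrivial P] (hGP : GP.Connected)
    {m k : ℕ} (hm : 6 * k + 3 ≤ m) :
    Contractible (slabGraph GU GP L R m) k ↔ Contractible (slabGraph GU GP L R (m + 1)) k := by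
  constructor
  · rintro ⟨r, q, X, Y, hr, hq, h, hk⟩
    obtain ⟨r', q', X', Y', j, d, ρ, h', hr', hq', e, ha⟩ := h.exists_aligned hGP hr hq hk hm
    obtain ⟨X'', Y'', h''⟩ := h'.insertColumn ha
    refine ⟨r', q' + 1, X'', Y'', hr', by omega, h'', ?_⟩
    rw [card_slab] at hk ⊢
    have e1 := ha.card_eq
    have e2 : (m + 1) * Nat.card P = m * Nat.card P + r' := by rw [e1]; ring
    have e3 : r' * (q' + 1) = r' * q' + r' := by ring
    omega
  · rintro ⟨r, q, X, Y, hr, hq, h, hk⟩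
    obtain ⟨r', q', X', Y', j, d, ρ, h', hr', hq', e, ha⟩ :=
      h.exists_aligned hGP hr hq hk (by omega)
    -- The columns `d - 1`, `d` and `d + 1` of the grid exist, so at least two remain after the
    -- deletion.
    have hq3 : 3 ≤ q' := by
      obtain ⟨p, -⟩ := ha.surj 0 (by omega)
      have h1 := h'.Y_lt (.inr (⟨j + 1, ha.j_lt⟩, p))
      have h2 := ha.Y_eq ⟨j + 1, ha.j_lt⟩ p (by simp)
      have h3 := ha.d_pos
      simp only at h2
      omega
    obtain ⟨q', rfl⟩ : ∃ q'', q' = q'' + 1 := ⟨q' - 1, by omega⟩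
    obtain ⟨X'', Y'', h''⟩ := h'.deleteColumn ha
    refine ⟨r', q', X'', Y'', hr', by omega, h'', ?_⟩
    rw [card_slab] at hk ⊢
    have e1 := ha.card_eq
    have e2 : (m + 1) * Nat.card P = m * Nat.card P + r' := by rw [e1]; ring
    have e3 : r' * (q' + 1) = r' * q' + r' := by ring
    omega

end GridContraction

/-! ### Slabs described by levels -/

namespace GridContraction

variable {V : Type*}

/-- The levels `1, …, M` are the columns of a slab with `M` columns. -/
structure IsSlab (G : SimpleGraph V) (M : ℕ) (lev : V → ℕ) : Prop where
  up : ∀ v, 1 ≤ lev v → lev v < M → ∃ w, G.Adj v w ∧ lev w = lev v + 1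
  up_unique : ∀ v w w', 1 ≤ lev v → lev v < M → G.Adj v w → G.Adj v w' → lev w = lev v + 1 →
    lev w' = lev v + 1 → w = w'
  down : ∀ v, 2 ≤ lev v → lev v ≤ M → ∃ w, G.Adj v w ∧ lev w + 1 = lev v
  down_unique : ∀ v w w', 2 ≤ lev v → lev v ≤ M → G.Adj v w → G.Adj v w' → lev w + 1 = lev v →
    lev w' + 1 = lev v → w = w'
  comm : ∀ v w v' w', 1 ≤ lev v → lev v < M → lev w = lev v → lev v' = lev v + 1 →
    lev w' = lev v + 1 → G.Adj v v' → G.Adj w w' → (G.Adj v w ↔ G.Adj v' w')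
  span : ∀ v w, G.Adj v w → 1 ≤ lev v → lev v ≤ M → 1 ≤ lev w → lev w ≤ M → lev w ≤ lev v + 1
  inner : ∀ v w, G.Adj v w → 2 ≤ lev v → lev v < M → 1 ≤ lev w ∧ lev w ≤ M

/-- The graph obtained from `G` by contracting the edges between the levels `1` and `2`, on the
vertices outside level `2`. -/
def removeLevel (G : SimpleGraph V) (lev : V → ℕ) : SimpleGraph V where
  Adj u w := lev u ≠ 2 ∧ lev w ≠ 2 ∧
    (G.Adj u w ∨ ∃ v, lev v = 2 ∧ G.Adj u v ∧ G.Adj w v ∧ u ≠ w)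
  symm := ⟨by
    rintro u w ⟨h1, h2, h3 | ⟨v, h4, h5, h6, h7⟩⟩
    · exact ⟨h2, h1, Or.inl h3.symm⟩
    · exact ⟨h2, h1, Or.inr ⟨v, h4, h6, h5, h7.symm⟩⟩⟩
  loopless := ⟨by
    rintro u ⟨_, _, h3 | ⟨v, _, _, _, h⟩⟩
    · exact h3.ne rfl
    · exact h rfl⟩

lemma nonempty_iso_induce {A : Type*} {H : SimpleGraph A} {G : SimpleGraph V} {S : Set V}
    (f : A → V) (hf : Function.Injective f) (hS : Set.range f = S)
    (hadj : ∀ a b, G.Adj (f a) (f b) ↔ H.Adj a b) : Nonempty (H ≃g G.induce S) := by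
  subst hS
  exact ⟨⟨Equiv.ofInjective f hf, by intro a b; exact hadj a b⟩⟩

open Classical in
/-- The vertex of level `i + 1` in the row of `p`. -/
noncomputable def climb (G : SimpleGraph V) (lev : V → ℕ) (p : V) : ℕ → V
  | 0 => p
  | i + 1 => if h : ∃ w, G.Adj (climb G lev p i) w ∧ lev w = lev (climb G lev p i) + 1 then h.choose
      else climb G lev p i

namespace IsSlab

variable {G : SimpleGraph V} {M : ℕ} {lev : V → ℕ}

/-- Below level `M` the condition `up` supplies a next vertex, so the default branch of `climb` is
never taken there. -/
lemma climb_spec (h : IsSlab G M lev) {p : V} (hp : lev p = 1) (i : ℕ) (hi : i < M) :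
    lev (climb G lev p i) = i + 1 ∧
      (i + 1 < M → G.Adj (climb G lev p i) (climb G lev p (i + 1))) := by
  induction i with
  | zero =>
    refine ⟨hp, fun hM => ?_⟩
    have hex := h.up p (by omega) (by omega)
    have : climb G lev p 1 = hex.choose := by rw [climb]; exact dif_pos hex
    rw [this]
    exact hex.choose_spec.1
  | succ i ih =>
    obtain ⟨h1, h2⟩ := ih (by omega)
    have hstep : ∀ i, lev (climb G lev p i) = i + 1 → i + 1 < M →
        G.Adj (climb G lev p i) (climb G lev p (i + 1)) ∧
          lev (climb G lev p (i + 1)) = i + 1 + 1 := by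
      intro i h1 hM
      have hex := h.up (climb G lev p i) (by omega) (by omega)
      have : climb G lev p (i + 1) = hex.choose := by rw [climb]; exact dif_pos hex
      rw [this]
      have := hex.choose_spec
      exact ⟨this.1, by omega⟩
    have h3 := (hstep i h1 hi).2
    exact ⟨h3, fun hM => (hstep _ h3 hM).1⟩

lemma climb_injective (h : IsSlab G M lev) {p p' : V} (hp : lev p = 1) (hp' : lev p' = 1) (i : ℕ)
    (hi : i < M) (e : climb G lev p i = climb G lev p' i) : p = p' := by
  induction i with
  | zero => exact e
  | succ i ih =>
    have h1 := h.climb_spec hp i (by omega)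
    have h2 := h.climb_spec hp' i (by omega)
    have h3 := h.climb_spec hp (i + 1) hi
    apply ih (by omega)
    refine h.down_unique (climb G lev p (i + 1)) _ _ (by omega) (by omega) (h1.2 hi).symm ?_
      (by omega) (by omega)
    rw [e]
    exact (h2.2 hi).symm

lemma exists_climb (h : IsSlab G M lev) (i : ℕ) (hi : i < M) (v : V) (hv : lev v = i + 1) :
    ∃ p, lev p = 1 ∧ climb G lev p i = v := by
  induction i generalizing v with
  | zero => exact ⟨v, hv, rfl⟩
  | succ i ih =>
    obtain ⟨w, h1, h2⟩ := h.down v (by omega) (by omega)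
    obtain ⟨p, hp, rfl⟩ := ih (by omega) w (by omega)
    have h3 := h.climb_spec hp i (by omega)
    have h4 := h.climb_spec hp (i + 1) hi
    exact ⟨p, hp, h.up_unique (climb G lev p i) _ _ (by omega) (by omega) (h3.2 hi) h1.symm
      (by omega) (by omega)⟩

lemma climb_adj_climb (h : IsSlab G M lev) {p p' : V} (hp : lev p = 1) (hp' : lev p' = 1) (i : ℕ)
    (hi : i < M) : G.Adj (climb G lev p i) (climb G lev p' i) ↔ G.Adj p p' := by
  induction i with
  | zero => exact Iff.rfl
  | succ i ih =>
    have h1 := h.climb_spec hp i (by omega)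
    have h2 := h.climb_spec hp' i (by omega)
    have h3 := h.climb_spec hp (i + 1) hi
    have h4 := h.climb_spec hp' (i + 1) hi
    rw [← ih (by omega)]
    exact (h.comm _ _ _ _ (by omega) (by omega) (by omega) (by omega) (by omega) (h1.2 hi)
      (h2.2 hi)).symm

lemma climb_adj_climb_succ (h : IsSlab G M lev) {p p' : V} (hp : lev p = 1) (hp' : lev p' = 1)
    (i : ℕ) (hi : i + 1 < M) :
    G.Adj (climb G lev p i) (climb G lev p' (i + 1)) ↔ p = p' := by
  have h1 := h.climb_spec hp i (by omega)
  have h3 := h.climb_spec hp (i + 1) hi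
  have h4 := h.climb_spec hp' (i + 1) hi
  constructor
  · intro hadj
    exact h.climb_injective hp hp' (i + 1) hi
      (h.up_unique (climb G lev p i) _ _ (by omega) (by omega) (h1.2 hi) hadj (by omega) (by omega))
  · rintro rfl
    exact h1.2 hi

/-- The parametrization of a graph with a slab. -/
noncomputable def param (G : SimpleGraph V) (S : Set V) (M : ℕ) (lev : V → ℕ) :
    {v // v ∈ S ∧ (lev v = 0 ∨ M < lev v)} ⊕ (Fin M × {v // lev v = 1}) → V :=
  Sum.elim (fun u => u) fun x => climb G lev x.2 x.1

/-- By `inner`, only the levels `1` and `M` see vertices outside the slab; by `span`, edges join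
equal or consecutive levels. Uniqueness of the vertices above and below makes consecutive levels
adjacent only along rows, and `comm` makes all levels copies of level `1`. -/
lemma adj_param_iff (h : IsSlab G M lev) (S : Set V)
    (a b : {v // v ∈ S ∧ (lev v = 0 ∨ M < lev v)} ⊕ (Fin M × {v // lev v = 1})) :
    G.Adj (param G S M lev a) (param G S M lev b) ↔
      (slabGraph (G.induce {v | v ∈ S ∧ (lev v = 0 ∨ M < lev v)}) (G.induce {v | lev v = 1})
        (fun u p => G.Adj u (climb G lev p 0)) (fun u p => G.Adj u (climb G lev p (M - 1)))
        M).Adj a b := by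
  have key : ∀ (u : {v // v ∈ S ∧ (lev v = 0 ∨ M < lev v)}) (i : Fin M) (p : {v // lev v = 1}),
      G.Adj u (climb G lev p i) ↔ ((i : ℕ) = 0 ∧ G.Adj u (climb G lev p 0)) ∨
        ((i : ℕ) + 1 = M ∧ G.Adj u (climb G lev p (M - 1))) := by
    intro u i p
    have h1 := h.climb_spec p.2 i i.2
    have h2 := u.2.2
    constructor
    · intro hadj
      by_cases hi : (i : ℕ) = 0
      · rw [hi] at hadj; exact Or.inl ⟨hi, hadj⟩
      · by_cases hi' : (i : ℕ) + 1 = M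
        · have : (i : ℕ) = M - 1 := by omega
          rw [this] at hadj
          exact Or.inr ⟨hi', hadj⟩
        · have := h.inner _ _ hadj.symm (by omega) (by omega)
          omega
    · rintro (⟨hi, hadj⟩ | ⟨hi, hadj⟩)
      · rwa [hi]
      · have : (i : ℕ) = M - 1 := by omega
        rwa [this]
  rcases a with u | ⟨i, p⟩ <;> rcases b with u' | ⟨i', p'⟩
  · exact Iff.rfl
  · exact key u i' p'
  · rw [SimpleGraph.adj_comm, slabGraph_inr_inl]; exact key u' i p
  · rw [slabGraph_inr_inr]
    simp only [param, Sum.elim_inr]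
    have h1 := h.climb_spec p.2 i i.2
    have h2 := h.climb_spec p'.2 i' i'.2
    rcases lt_trichotomy (i : ℕ) i' with hi | hi | hi
    · by_cases hi' : (i : ℕ) + 1 = i'
      · have := h.climb_adj_climb_succ p.2 p'.2 i (by omega)
        rw [← hi', this]
        constructor
        · intro e; exact Or.inr ⟨Or.inl rfl, Subtype.ext e⟩
        · rintro (⟨e, _⟩ | ⟨_, e⟩)
          · rw [e] at hi; omega
          · rw [e]
      · constructor
        · intro hadj
          have := h.span _ _ hadj (by omega) (by omega) (by omega) (by omega)
          omega
        · rintro (⟨e, _⟩ | ⟨e, _⟩)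
          · rw [e] at hi; omega
          · omega
    · obtain rfl : i = i' := Fin.ext hi
      rw [h.climb_adj_climb p.2 p'.2 i i.2]
      constructor
      · intro e; exact Or.inl ⟨rfl, e⟩
      · rintro (⟨_, e⟩ | ⟨e, _⟩)
        · exact e
        · omega
    · by_cases hi' : (i' : ℕ) + 1 = i
      · have := h.climb_adj_climb_succ p'.2 p.2 i' (by omega)
        rw [← hi', SimpleGraph.adj_comm, this]
        constructor
        · intro e; exact Or.inr ⟨Or.inr rfl, Subtype.ext e.symm⟩
        · rintro (⟨e, _⟩ | ⟨_, e⟩)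
          · rw [e] at hi; omega
          · rw [e]
      · constructor
        · intro hadj
          have := h.span _ _ hadj.symm (by omega) (by omega) (by omega) (by omega)
          omega
        · rintro (⟨e, _⟩ | ⟨e, _⟩)
          · rw [e] at hi; omega
          · omega

lemma param_injective (h : IsSlab G M lev) (S : Set V) :
    Function.Injective (param G S M lev) := by
  have hlev : ∀ (i : Fin M) (p : {v // lev v = 1}), lev (climb G lev p i) = i + 1 :=
    fun i p => (h.climb_spec p.2 i i.2).1
  rintro (u | ⟨i, p⟩) (u' | ⟨i', p'⟩) e
  · exact congrArg _ (Subtype.ext e)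
  · have h1 := hlev i' p'
    have h2 := u.2.2
    change (u : V) = climb G lev p' i' at e
    rw [← e] at h1
    omega
  · have h1 := hlev i p
    have h2 := u'.2.2
    change climb G lev p i = u' at e
    rw [e] at h1
    omega
  · have h1 := hlev i p
    have h2 := hlev i' p'
    change climb G lev p i = climb G lev p' i' at e
    rw [e, h2] at h1
    obtain rfl : i = i' := Fin.ext (by omega)
    rw [Subtype.ext (h.climb_injective p.2 p'.2 i i.2 e)]

lemma range_param (h : IsSlab G M lev) {S : Set V} (hS : ∀ v, 1 ≤ lev v → lev v ≤ M → v ∈ S) :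
    Set.range (param G S M lev) = S := by
  ext v
  constructor
  · rintro ⟨u | ⟨i, p⟩, rfl⟩
    · exact u.2.1
    · have := (h.climb_spec p.2 i i.2).1
      exact hS (climb G lev p i) (by omega) (by omega)
  · intro hv
    by_cases hl : lev v = 0 ∨ M < lev v
    · exact ⟨.inl ⟨v, hv, hl⟩, rfl⟩
    · obtain ⟨p, hp, e⟩ := h.exists_climb (lev v - 1) (by omega) v (by omega)
      exact ⟨.inr (⟨lev v - 1, by omega⟩, ⟨p, hp⟩), e⟩

/-- One level of a slab with many levels can be removed. -/
theorem contractible_removeLevel_iff (h : IsSlab G M lev) {S : Set V} (hfin : S.Finite)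
    (hS : ∀ v, 1 ≤ lev v → lev v ≤ M → v ∈ S) (hconn : (G.induce {v | lev v = 1}).Connected)
    {x y : V} (hx : lev x = 1) (hy : lev y = 1) (hxy : x ≠ y) {k : ℕ} (hM : 6 * k + 4 ≤ M) :
    Contractible ((removeLevel G lev).induce {v | v ∈ S ∧ lev v ≠ 2}) k ↔
      Contractible (G.induce S) k := by
  -- The long slab has `m + 1` columns and the short one still has `m ≥ 6k + 3`. Level `2` is the
  -- column with index `1`, the one to be skipped.
  obtain ⟨m, rfl⟩ : ∃ m, M = m + 1 := ⟨M - 1, by omega⟩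
  have : Finite ({v | v ∈ S ∧ (lev v = 0 ∨ m + 1 < lev v)} : Set V) :=
    (hfin.subset fun v hv => hv.1 : {v | v ∈ S ∧ (lev v = 0 ∨ m + 1 < lev v)}.Finite)
  have : Finite ({v | lev v = 1} : Set V) :=
    (hfin.subset fun v hv => hS v (by have : lev v = 1 := hv; omega)
      (by have : lev v = 1 := hv; omega) : {v | lev v = 1}.Finite)
  have : Nontrivial ({v | lev v = 1} : Set V) := ⟨⟨x, hx⟩, ⟨y, hy⟩, by simpa using hxy⟩
  obtain ⟨e⟩ := nonempty_iso_induce (param G S (m + 1) lev) (h.param_injective S)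
    (h.range_param hS) (h.adj_param_iff S)
  rw [← contractible_congr e, ← contractible_slabGraph_succ hconn (by omega : 6 * k + 3 ≤ m)]
  have hlev : ∀ (p : {v // lev v = 1}), lev (climb G lev p 1) = 2 :=
    fun p => (h.climb_spec p.2 1 (by omega)).1
  have hskip : ∀ w, lev (param G S (m + 1) lev (skipColumn m 1 w)) ≠ 2 := by
    intro w hw
    obtain ⟨p, hp, e⟩ := h.exists_climb 1 (by omega) _ hw
    have := h.param_injective S (a₁ := .inr (⟨1, by omega⟩, ⟨p, hp⟩)) e
    exact skipColumn_ne w ⟨1, by omega⟩ rfl _ this.symm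
  obtain ⟨e'⟩ := nonempty_iso_induce (G := removeLevel G lev) (S := {v | v ∈ S ∧ lev v ≠ 2})
    (fun w => param G S (m + 1) lev (skipColumn m 1 w))
    ((h.param_injective S).comp (skipColumn_injective m 1)) (by
      ext v
      constructor
      · rintro ⟨w, rfl⟩
        exact ⟨(h.range_param hS).subset ⟨_, rfl⟩, hskip w⟩
      · rintro ⟨hv, hv2⟩
        obtain ⟨a, rfl⟩ := (h.range_param hS).superset hv
        rcases exists_skipColumn_eq (show 1 ≤ m by omega) a with ⟨p, rfl⟩ | ⟨w, rfl⟩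
        · exact absurd (hlev p) hv2
        · exact ⟨w, rfl⟩) (by
      intro a b
      rw [slabGraph_adj_iff_skipColumn _ _ _ _ Nat.one_pos (show 1 < m by omega),
        ← h.adj_param_iff S]
      -- A vertex of level `2` has only two neighbours outside its level, in its row; so joining all
      -- its neighbours in `removeLevel` adds just the bridges.
      have hnew : ∀ (p : {v // lev v = 1}) w,
          G.Adj (climb G lev p 1) (param G S (m + 1) lev (skipColumn m 1 w)) ↔
          ∃ i : Fin m, w = .inr (i, p) ∧ ((i : ℕ) + 1 = 1 ∨ (i : ℕ) = 1) := by
        intro p w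
        rw [← slabGraph_adj_skipColumn Nat.one_pos (show 1 < m by omega), ← h.adj_param_iff S]
        rfl
      constructor
      · rintro ⟨_, _, h3 | ⟨v, h4, h5, h6, h7⟩⟩
        · exact Or.inl h3
        · obtain ⟨p, hp, rfl⟩ := h.exists_climb 1 (by omega) v h4
          obtain ⟨i, rfl, hi⟩ := (hnew ⟨p, hp⟩ a).1 h5.symm
          obtain ⟨i', rfl, hi'⟩ := (hnew ⟨p, hp⟩ b).1 h6.symm
          have hne : (i : ℕ) ≠ i' := by
            intro e; exact h7 (by rw [Fin.ext e])
          rcases hi with hi | hi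
          · exact Or.inr (Or.inl ⟨i, i', _, hi, by omega, rfl, rfl⟩)
          · exact Or.inr (Or.inr ⟨i', i, _, by omega, hi, rfl, rfl⟩)
      · have hb : ∀ a b, Bridge m 1 a b → G.Adj (param G S (m + 1) lev (skipColumn m 1 a))
            (param G S (m + 1) lev (skipColumn m 1 b)) ∨ ∃ v, lev v = 2 ∧
            G.Adj (param G S (m + 1) lev (skipColumn m 1 a)) v ∧
            G.Adj (param G S (m + 1) lev (skipColumn m 1 b)) v ∧
            param G S (m + 1) lev (skipColumn m 1 a) ≠
              param G S (m + 1) lev (skipColumn m 1 b) := by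
          rintro a b ⟨i, i', p, h1, h2, rfl, rfl⟩
          refine Or.inr ⟨climb G lev p 1, hlev p, ((hnew _ _).2 ⟨i, rfl, by omega⟩).symm,
            ((hnew _ _).2 ⟨i', rfl, by omega⟩).symm, fun e => ?_⟩
          have := skipColumn_injective m 1 (h.param_injective S e)
          simp only [Sum.inr.injEq, Prod.mk.injEq, and_true] at this
          rw [this] at h1
          omega
        rintro (h3 | h3 | h3)
        · exact ⟨hskip a, hskip b, Or.inl h3⟩
        · exact ⟨hskip a, hskip b, hb a b h3⟩
        · refine ⟨hskip a, hskip b, ?_⟩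
          rcases hb b a h3 with h4 | ⟨v, h4, h5, h6, h7⟩
          · exact Or.inl h4.symm
          · exact Or.inr ⟨v, h4, h6, h5, h7.symm⟩)
  exact (contractible_congr e' k).symm

end IsSlab

end GridContraction

/-! ### Detecting slabs -/

namespace GridContraction

variable {V : Type*}

/-- The pairs of vertices reached from `(a, b)` in `t` steps, a step leading from an edge to the
opposite edge of a cycle of length four. -/
def opposite (G : SimpleGraph V) (a b : V) : ℕ → V → V → Prop
  | 0, x, y => x = a ∧ y = b
  | t + 1, x, y => opposite G a b t x y ∨ ∃ x' y', opposite G a b t x' y' ∧ G.Adj x x' ∧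
      G.Adj y y' ∧ G.Adj x y ∧ x ≠ y' ∧ y ≠ x'

open Classical in
/-- Level `1` and level `2`. -/
noncomputable def initialLevels (T : V → V → Prop) (v : V) : ℕ :=
  if ∃ y, T v y then 1 else if ∃ x, T x v then 2 else 0

open Classical in
/-- Breadth-first search from level `2`, on the vertices outside level `1`. -/
noncomputable def levels (G : SimpleGraph V) (l : V → ℕ) : ℕ → V → ℕ
  | 0, v => l v
  | z + 1, v => if levels G l z v ≠ 0 then levels G l z v else
      if ∃ w, G.Adj v w ∧ levels G l z w = z + 2 then z + 3 else 0

/-- The levels found from the edge from `a` to `b`, with `N` rounds in each search. -/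
noncomputable def searchLevels (G : SimpleGraph V) (N : ℕ) (a b : V) : V → ℕ :=
  levels G (initialLevels (opposite G a b N)) N

/-- A slab with `M` columns is found from the edge from `a` to `b`. -/
structure Detects (G : SimpleGraph V) (N M : ℕ) (a b : V) : Prop where
  isSlab : IsSlab G M (searchLevels G N a b)
  nontrivial : ∃ x, searchLevels G N a b x = 1 ∧ x ≠ a

lemma opposite_mono (G : SimpleGraph V) (a b : V) {s t : ℕ} (h : s ≤ t) {x y : V}
    (hxy : opposite G a b s x y) : opposite G a b t x y := by
  induction h with
  | refl => exact hxy
  | step _ ih => exact Or.inl ih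

/-- The search assigns only `0` or values from `3` on to unlabelled vertices. -/
lemma levels_eq_one_iff (G : SimpleGraph V) (l : V → ℕ) (z : ℕ) (v : V) :
    levels G l z v = 1 ↔ l v = 1 := by
  induction z with
  | zero => rfl
  | succ z ih =>
    rw [levels]
    split_ifs with h1 h2
    · exact ih
    · rw [← ih, not_not.1 h1]; simp
    · rw [← ih, not_not.1 h1]; simp

lemma searchLevels_eq_one_iff (G : SimpleGraph V) (N : ℕ) (a b : V) (v : V) :
    searchLevels G N a b v = 1 ↔ ∃ y, opposite G a b N v y := by
  rw [searchLevels, levels_eq_one_iff, initialLevels]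
  split_ifs with h1 h2
  · simp [h1]
  · simp [h1]
  · simp [h1]

lemma searchLevels_self (G : SimpleGraph V) (N : ℕ) (a b : V) : searchLevels G N a b a = 1 :=
  (searchLevels_eq_one_iff _ _ _ _ _).2 ⟨b, opposite_mono G a b (Nat.zero_le N) ⟨rfl, rfl⟩⟩

/-- A step of `opposite` moves the first vertex to a neighbour, and vertices once reached stay
reached; so each is joined to `a` inside level `1`. Connectedness of the slab columns thus needs no
test. -/
lemma connected_searchLevels (G : SimpleGraph V) (N : ℕ) (a b : V) :
    (G.induce {v | searchLevels G N a b v = 1}).Connected := by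
  have key : ∀ t ≤ N, ∀ x y, opposite G a b t x y → ∃ hx : searchLevels G N a b x = 1,
      (G.induce {v | searchLevels G N a b v = 1}).Reachable ⟨a, searchLevels_self G N a b⟩
        ⟨x, hx⟩ := by
    intro t
    induction t with
    | zero =>
      rintro _ x y ⟨rfl, rfl⟩
      exact ⟨searchLevels_self G N _ _, SimpleGraph.Reachable.refl _⟩
    | succ t ih =>
      rintro ht x y (h | h)
      · exact ih (by omega) x y h
      · have hx : searchLevels G N a b x = 1 :=
          (searchLevels_eq_one_iff _ _ _ _ _).2 ⟨y, opposite_mono G a b ht (Or.inr h)⟩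
        obtain ⟨x', y', h1, h2, -⟩ := h
        obtain ⟨hx', h3⟩ := ih (by omega) x' y' h1
        refine ⟨hx, h3.trans (SimpleGraph.Adj.reachable ?_)⟩
        exact h2.symm
  have : Nonempty ({v | searchLevels G N a b v = 1} : Set V) := ⟨⟨a, searchLevels_self G N a b⟩⟩
  rw [SimpleGraph.connected_iff_exists_forall_reachable]
  refine ⟨⟨a, searchLevels_self G N a b⟩, ?_⟩
  rintro ⟨x, hx⟩
  obtain ⟨y, hy⟩ := (searchLevels_eq_one_iff _ _ _ _ _).1 hx
  exact (key N le_rfl x y hy).2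

/-- A slab which is detected can be shortened. -/
theorem Detects.contractible_iff {G : SimpleGraph V} {N M k : ℕ} {a b : V}
    (h : Detects G N M a b) {S : Set V} (hfin : S.Finite) (hS : ∀ u v, G.Adj u v → u ∈ S)
    (hM : 6 * k + 4 ≤ M) :
    Contractible ((removeLevel G (searchLevels G N a b)).induce
      {v | v ∈ S ∧ searchLevels G N a b v ≠ 2}) k ↔ Contractible (G.induce S) k := by
  obtain ⟨x, hx, hxa⟩ := h.nontrivial
  refine h.isSlab.contractible_removeLevel_iff hfin ?_ (connected_searchLevels G N a b) hx
    (searchLevels_self G N a b) hxa hM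
  intro v h1 h2
  -- Every vertex of the slab has a neighbour, above it or below it, and therefore lies in `S`.
  by_cases hv : searchLevels G N a b v = 1
  · obtain ⟨w, hw, -⟩ := h.isSlab.up v h1 (by omega)
    exact hS v w hw
  · obtain ⟨w, hw, -⟩ := h.isSlab.down v (by omega) h2
    exact hS v w hw

/-! ### Clean zones and their detection -/

/-- Part of `G` is a grid with `M + 2` columns, and only the first and the last of them may have
further neighbours. -/
structure CleanZone (G : SimpleGraph V) (M r : ℕ) (σ : ℕ → ℕ → V) : Prop where
  injective : ∀ i x i' x', i < M + 2 → x < r → i' < M + 2 → x' < r → σ i x = σ i' x' →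
    i = i' ∧ x = x'
  adj_iff : ∀ i x i' x', i < M + 2 → x < r → i' < M + 2 → x' < r →
    (G.Adj (σ i x) (σ i' x') ↔
      (i = i' ∧ (x + 1 = x' ∨ x' + 1 = x)) ∨ (x = x' ∧ (i + 1 = i' ∨ i' + 1 = i)))
  closed : ∀ i x v, 1 ≤ i → i ≤ M → x < r → G.Adj (σ i x) v →
    ∃ i' x', i' < M + 2 ∧ x' < r ∧ v = σ i' x'

namespace CleanZone

variable {G : SimpleGraph V} {M r : ℕ} {σ : ℕ → ℕ → V}

/-- The only 4-cycles through the edge of row `a` between columns `1` and `2` use the same edge of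
an adjacent row. The search starts in row `0`, so row `a` is reached after `a` steps. -/
lemma opposite_iff (h : CleanZone G M r σ) (hr : 0 < r) (hM : 2 ≤ M) (t : ℕ) (x y : V) :
    opposite G (σ 1 0) (σ 2 0) t x y ↔ ∃ a < r, a ≤ t ∧ x = σ 1 a ∧ y = σ 2 a := by
  induction t generalizing x y with
  | zero =>
    constructor
    · rintro ⟨rfl, rfl⟩
      exact ⟨0, hr, le_rfl, rfl, rfl⟩
    · rintro ⟨a, -, h1, rfl, rfl⟩
      obtain rfl : a = 0 := by omega
      exact ⟨rfl, rfl⟩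
  | succ t ih =>
    constructor
    · rintro (h1 | ⟨x', y', h1, h2, h3, h4, h5, h6⟩)
      · obtain ⟨a, ha, hat, rfl, rfl⟩ := (ih _ _).1 h1
        exact ⟨a, ha, by omega, rfl, rfl⟩
      · obtain ⟨a, ha, hat, rfl, rfl⟩ := (ih _ _).1 h1
        obtain ⟨i, c, hi, hc, rfl⟩ := h.closed _ _ _ le_rfl (by omega) ha h2.symm
        obtain ⟨i', c', hi', hc', rfl⟩ := h.closed _ _ _ (by omega) (by omega) ha h3.symm
        rw [h.adj_iff _ _ _ _ (by omega) (by omega) (by omega) (by omega)] at h2 h3 h4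
        have h5' : ¬ (i = 2 ∧ c = a) := by
          rintro ⟨rfl, rfl⟩; exact h5 rfl
        have h6' : ¬ (i' = 1 ∧ c' = a) := by
          rintro ⟨rfl, rfl⟩; exact h6 rfl
        -- The vertices in columns `0` and `3` are not adjacent, so the step must move both ends to
        -- the same adjacent row.
        obtain ⟨rfl, rfl, rfl⟩ : i = 1 ∧ i' = 2 ∧ c' = c := by omega
        exact ⟨c', hc, by omega, rfl, rfl⟩
    · rintro ⟨a, ha, hat, rfl, rfl⟩
      by_cases hat' : a ≤ t
      · exact Or.inl ((ih _ _).2 ⟨a, ha, hat', rfl, rfl⟩)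
      · refine Or.inr ⟨σ 1 (a - 1), σ 2 (a - 1), (ih _ _).2 ⟨a - 1, by omega, by omega, rfl, rfl⟩,
          ?_, ?_, ?_, ?_, ?_⟩
        · rw [h.adj_iff _ _ _ _ (by omega) (by omega) (by omega) (by omega)]; omega
        · rw [h.adj_iff _ _ _ _ (by omega) (by omega) (by omega) (by omega)]; omega
        · rw [h.adj_iff _ _ _ _ (by omega) (by omega) (by omega) (by omega)]; omega
        · intro e
          have := h.injective _ _ _ _ (by omega) (by omega) (by omega) (by omega) e
          omega
        · intro e
          have := h.injective _ _ _ _ (by omega) (by omega) (by omega) (by omega) e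
          omega

lemma initialLevels_eq (h : CleanZone G M r σ) (hr : 0 < r) (hM : 2 ≤ M) {N : ℕ} (hN : r ≤ N + 1) :
    (∀ i a, 1 ≤ i → i ≤ 2 → a < r →
      initialLevels (opposite G (σ 1 0) (σ 2 0) N) (σ i a) = i) ∧
    ∀ v, initialLevels (opposite G (σ 1 0) (σ 2 0) N) v ≠ 0 →
      ∃ i a, 1 ≤ i ∧ i ≤ 2 ∧ a < r ∧ v = σ i a := by
  have hT := h.opposite_iff hr hM N
  constructor
  · intro i a hi1 hi2 ha
    have h2 : i = 2 → ¬ ∃ y, opposite G (σ 1 0) (σ 2 0) N (σ i a) y := by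
      rintro hi ⟨y, hy⟩
      obtain ⟨a', ha', -, e, -⟩ := (hT _ _).1 hy
      have := h.injective _ _ _ _ (by omega) (by omega) (by omega) (by omega) e
      omega
    rw [initialLevels]
    obtain rfl | rfl : i = 1 ∨ i = 2 := by omega
    · rw [if_pos ⟨σ 2 a, (hT _ _).2 ⟨a, ha, by omega, rfl, rfl⟩⟩]
    · rw [if_neg (h2 rfl), if_pos ⟨σ 1 a, (hT _ _).2 ⟨a, ha, by omega, rfl, rfl⟩⟩]
  · intro v hv
    rw [initialLevels] at hv
    split_ifs at hv with h1 h2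
    · obtain ⟨y, hy⟩ := h1
      obtain ⟨a, ha, -, rfl, -⟩ := (hT _ _).1 hy
      exact ⟨1, a, le_rfl, by omega, ha, rfl⟩
    · obtain ⟨y, hy⟩ := h2
      obtain ⟨a, ha, -, -, rfl⟩ := (hT _ _).1 hy
      exact ⟨2, a, by omega, le_rfl, ha, rfl⟩
    · exact absurd rfl hv

/-- Closedness keeps the search inside the zone: the unlabelled neighbours of column `z + 2` form
column `z + 3`. Column `0` is not entered, since it is adjacent only to column `1` among the
labelled ones and level `1` is never extended. -/
lemma levels_of_le (h : CleanZone G M r σ) {l : V → ℕ}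
    (hl : ∀ i a, 1 ≤ i → i ≤ 2 → a < r → l (σ i a) = i)
    (hl' : ∀ v, l v ≠ 0 → ∃ i a, 1 ≤ i ∧ i ≤ 2 ∧ a < r ∧ v = σ i a) (z : ℕ) (hz : z + 2 ≤ M) :
    (∀ i a, 1 ≤ i → i ≤ z + 2 → a < r → levels G l z (σ i a) = i) ∧
    ∀ v, levels G l z v ≠ 0 → ∃ i a, 1 ≤ i ∧ i ≤ z + 2 ∧ a < r ∧ v = σ i a := by
  induction z with
  | zero => exact ⟨hl, hl'⟩
  | succ z ih =>
    obtain ⟨ih1, ih2⟩ := ih (by omega)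
    have hnew : ∀ v, levels G l z v = 0 → (∃ w, G.Adj v w ∧ levels G l z w = z + 2) →
        ∃ a < r, v = σ (z + 3) a := by
      rintro v hv ⟨w, hw1, hw2⟩
      obtain ⟨i, a, hi1, hi2, ha, rfl⟩ := ih2 w (by omega)
      rw [ih1 i a hi1 hi2 ha] at hw2
      subst hw2
      obtain ⟨i', a', hi', ha', rfl⟩ := h.closed _ _ _ (by omega) (by omega) ha hw1.symm
      have h1 : ¬ (1 ≤ i' ∧ i' ≤ z + 2) := by
        rintro ⟨h1, h2⟩
        rw [ih1 i' a' h1 h2 ha'] at hv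
        omega
      rw [h.adj_iff _ _ _ _ (by omega) (by omega) (by omega) (by omega)] at hw1
      obtain rfl : i' = z + 3 := by omega
      exact ⟨a', ha', rfl⟩
    constructor
    · intro i a hi1 hi2 ha
      rw [levels]
      by_cases hi : i ≤ z + 2
      · rw [ih1 i a hi1 hi ha, if_pos (by omega)]
      · obtain rfl : i = z + 3 := by omega
        have h0 : levels G l z (σ (z + 3) a) = 0 := by
          by_contra h0
          obtain ⟨i', a', h1, h2, h3, e⟩ := ih2 _ h0
          have := h.injective _ _ _ _ (by omega) (by omega) (by omega) (by omega) e
          omega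
        rw [if_neg (by omega), if_pos]
        refine ⟨σ (z + 2) a, ?_, ih1 _ _ (by omega) le_rfl ha⟩
        rw [h.adj_iff _ _ _ _ (by omega) (by omega) (by omega) (by omega)]
        omega
    · intro v hv
      rw [levels] at hv
      split_ifs at hv with h1 h2
      · obtain ⟨i, a, h3, h4, h5, h6⟩ := ih2 v h1
        exact ⟨i, a, h3, by omega, h5, h6⟩
      · obtain ⟨a, ha, rfl⟩ := hnew v (by simpa using h1) h2
        exact ⟨z + 3, a, by omega, by omega, ha, rfl⟩
      · exact absurd rfl hv

/-- Later rounds assign only levels above `M`, so further search outside the zone does no damage. -/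
lemma levels_of_ge (h : CleanZone G M r σ) (hM : 2 ≤ M) {l : V → ℕ}
    (hl : ∀ i a, 1 ≤ i → i ≤ 2 → a < r → l (σ i a) = i)
    (hl' : ∀ v, l v ≠ 0 → ∃ i a, 1 ≤ i ∧ i ≤ 2 ∧ a < r ∧ v = σ i a) {z : ℕ} (hz : M ≤ z + 2) :
    (∀ i a, 1 ≤ i → i ≤ M → a < r → levels G l z (σ i a) = i) ∧
    ∀ v, 1 ≤ levels G l z v → levels G l z v ≤ M → ∃ a < r, v = σ (levels G l z v) a := by
  obtain ⟨n, rfl⟩ : ∃ n, z = (M - 2) + n := ⟨z - (M - 2), by omega⟩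
  clear hz
  induction n with
  | zero =>
    have hMM : M - 2 + 2 = M := by omega
    have := h.levels_of_le hl hl' (M - 2) (by omega)
    rw [hMM] at this
    refine ⟨this.1, fun v h1 _ => ?_⟩
    obtain ⟨i, a, h3, h4, h5, rfl⟩ := this.2 v (by simp only [add_zero] at h1; omega)
    rw [add_zero, this.1 i a h3 h4 h5]
    exact ⟨a, h5, rfl⟩
  | succ n ih =>
    rw [← add_assoc]
    constructor
    · intro i a h1 h2 h3
      rw [levels, ih.1 i a h1 h2 h3, if_pos (by omega)]
    · intro v
      rw [levels]
      split_ifs with h1 h2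
      · exact ih.2 v
      · intro h3 h4; omega
      · intro h3; omega

/-- A clean zone is detected. -/
theorem detects (h : CleanZone G M r σ) (hr : 2 ≤ r) (hM : 2 ≤ M) {N : ℕ} (hrN : r ≤ N + 1)
    (hMN : M ≤ N + 2) : Detects G N M (σ 1 0) (σ 2 0) := by
  obtain ⟨hl, hl'⟩ := h.initialLevels_eq (by omega) hM hrN
  obtain ⟨h1, h2⟩ := h.levels_of_ge hM hl hl' hMN
  change ∀ i a, 1 ≤ i → i ≤ M → a < r → searchLevels G N (σ 1 0) (σ 2 0) (σ i a) = i at h1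
  change ∀ v, 1 ≤ searchLevels G N (σ 1 0) (σ 2 0) v → searchLevels G N (σ 1 0) (σ 2 0) v ≤ M →
    ∃ a < r, v = σ (searchLevels G N (σ 1 0) (σ 2 0) v) a at h2
  suffices hs : IsSlab G M (searchLevels G N (σ 1 0) (σ 2 0)) ∧
    ∃ x, searchLevels G N (σ 1 0) (σ 2 0) x = 1 ∧ x ≠ σ 1 0 from ⟨hs.1, hs.2⟩
  generalize searchLevels G N (σ 1 0) (σ 2 0) = lev at *
  have h3 : ∀ v, 1 ≤ lev v → lev v ≤ M → ∃ i a, 1 ≤ i ∧ i ≤ M ∧ a < r ∧ v = σ i a := by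
    intro v e1 e2
    obtain ⟨a, ha, e⟩ := h2 v e1 e2
    exact ⟨lev v, a, e1, e2, ha, e⟩
  have hadj : ∀ i x i' x', i ≤ M → x < r → i' ≤ M → x' < r →
    (G.Adj (σ i x) (σ i' x') ↔
      (i = i' ∧ (x + 1 = x' ∨ x' + 1 = x)) ∨ (x = x' ∧ (i + 1 = i' ∨ i' + 1 = i))) :=
    fun i x i' x' e1 e2 e3 e4 => h.adj_iff i x i' x' (by omega) e2 (by omega) e4
  refine ⟨⟨?_, ?_, ?_, ?_, ?_, ?_, ?_⟩, ?_⟩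
  · intro v e1 e2
    obtain ⟨i, a, i1, i2, ha, rfl⟩ := h3 v e1 (by omega)
    rw [h1 i a i1 i2 ha] at e2 ⊢
    exact ⟨σ (i + 1) a, (hadj _ _ _ _ (by omega) ha (by omega) ha).2 (by omega),
      h1 _ _ (by omega) (by omega) ha⟩
  · intro v w w' e1 e2 e3 e4 e5 e6
    obtain ⟨i, a, i1, i2, ha, rfl⟩ := h3 v e1 (by omega)
    rw [h1 i a i1 i2 ha] at e2 e5 e6
    obtain ⟨j, b, j1, j2, hb, rfl⟩ := h3 w (by omega) (by omega)
    obtain ⟨j', b', j1', j2', hb', rfl⟩ := h3 w' (by omega) (by omega)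
    rw [h1 _ _ j1 j2 hb] at e5
    rw [h1 _ _ j1' j2' hb'] at e6
    rw [hadj _ _ _ _ i2 ha (by omega) (by omega)] at e3 e4
    obtain rfl : j = j' := by omega
    obtain rfl : b = b' := by omega
    rfl
  · intro v e1 e2
    obtain ⟨i, a, i1, i2, ha, rfl⟩ := h3 v (by omega) e2
    rw [h1 i a i1 i2 ha] at e1 ⊢
    exact ⟨σ (i - 1) a, (hadj _ _ _ _ (by omega) ha (by omega) ha).2 (by omega),
      by rw [h1 _ _ (by omega) (by omega) ha]; omega⟩
  · intro v w w' e1 e2 e3 e4 e5 e6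
    obtain ⟨i, a, i1, i2, ha, rfl⟩ := h3 v (by omega) e2
    rw [h1 i a i1 i2 ha] at e1 e5 e6
    obtain ⟨j, b, j1, j2, hb, rfl⟩ := h3 w (by omega) (by omega)
    obtain ⟨j', b', j1', j2', hb', rfl⟩ := h3 w' (by omega) (by omega)
    rw [h1 _ _ j1 j2 hb] at e5
    rw [h1 _ _ j1' j2' hb'] at e6
    rw [hadj _ _ _ _ i2 ha (by omega) (by omega)] at e3 e4
    obtain rfl : j = j' := by omega
    obtain rfl : b = b' := by omega
    rfl
  · intro v w v' w' e1 e2 e3 e4 e5 e6 e7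
    obtain ⟨i, a, i1, i2, ha, rfl⟩ := h3 v e1 (by omega)
    rw [h1 i a i1 i2 ha] at e2 e3 e4 e5
    obtain ⟨j, b, j1, j2, hb, rfl⟩ := h3 w (by omega) (by omega)
    obtain ⟨i', a', i1', i2', ha', rfl⟩ := h3 v' (by omega) (by omega)
    obtain ⟨j', b', j1', j2', hb', rfl⟩ := h3 w' (by omega) (by omega)
    rw [h1 _ _ j1 j2 hb] at e3
    rw [h1 _ _ i1' i2' ha'] at e4
    rw [h1 _ _ j1' j2' hb'] at e5
    rw [hadj _ _ _ _ (by omega) (by omega) (by omega) (by omega)] at e6 e7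
    rw [hadj _ _ _ _ (by omega) (by omega) (by omega) (by omega),
      hadj _ _ _ _ (by omega) (by omega) (by omega) (by omega)]
    omega
  · intro v w e1 e2 e3 e4 e5
    obtain ⟨i, a, i1, i2, ha, rfl⟩ := h3 v e2 e3
    obtain ⟨j, b, j1, j2, hb, rfl⟩ := h3 w e4 e5
    rw [h1 _ _ i1 i2 ha, h1 _ _ j1 j2 hb]
    rw [hadj _ _ _ _ i2 ha j2 hb] at e1
    omega
  · intro v w e1 e2 e3
    obtain ⟨i, a, i1, i2, ha, rfl⟩ := h3 v (by omega) (by omega)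
    rw [h1 i a i1 i2 ha] at e2 e3
    obtain ⟨j, b, hj, hb, rfl⟩ := h.closed _ _ _ i1 i2 ha e1
    rw [h.adj_iff _ _ _ _ (by omega) ha hj hb] at e1
    rw [h1 j b (by omega) (by omega) hb]
    omega
  · refine ⟨σ 1 1, h1 1 1 le_rfl (by omega) (by omega), fun e => ?_⟩
    have := h.injective _ _ _ _ (by omega) (by omega) (by omega) (by omega) e
    omega

end CleanZone

/-! ### Size bounds for graphs contractible to a grid -/

open Classical in
/-- In a grid with many columns there is a clean zone. -/
lemma GridMap.exists_cleanZone {G : SimpleGraph V} {S : Finset V} (hS : ∀ u v, G.Adj u v → u ∈ S)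
    {r q k M : ℕ} {X Y : ↥(S : Set V) → ℕ} (h : GridMap (G.induce (S : Set V)) r q X Y)
    (hr : 0 < r) (hk : S.card ≤ r * q + k) (hq : (k + 1) * (M + 2) ≤ q) :
    ∃ σ, CleanZone G M r σ ∧ ∀ i x, i < M + 2 → x < r → σ i x ∈ S := by
  obtain ⟨ρ, B, h1, h2, h3, h4⟩ := h.exists_representatives (k := k) (by simpa using hk)
  -- Of `k + 1` disjoint blocks of `M + 2` grid columns, one contains none of the at most `k`
  -- non-representatives; every vertex in it is alone in its cell.
  obtain ⟨b, hb1, hb2⟩ := Finset.exists_mem_notMem_of_card_lt_card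
    (s := B.image fun v => Y v / (M + 2)) (t := Finset.range (k + 1))
    (by rw [Finset.card_range]; exact Nat.lt_succ_of_le (Finset.card_image_le.trans h4))
  rw [Finset.mem_range] at hb1
  set c := b * (M + 2) with hc
  have hcq : c + (M + 2) ≤ q := by
    have : (b + 1) * (M + 2) ≤ (k + 1) * (M + 2) := Nat.mul_le_mul_right _ (by omega)
    have : (b + 1) * (M + 2) = c + (M + 2) := by rw [hc]; ring
    omega
  have hdiv : ∀ i, i < M + 2 → (c + i) / (M + 2) = b := by
    intro i hi
    rw [hc, Nat.mul_comm, Nat.mul_add_div (by omega), Nat.div_eq_of_lt hi, add_zero]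
  have halone : ∀ v, c ≤ Y v → Y v < c + (M + 2) → Alone X Y v := by
    intro v hv1 hv2
    have hdv : Y v / (M + 2) = b := by
      have := hdiv (Y v - c) (by omega)
      rwa [show c + (Y v - c) = Y v by omega] at this
    have hB : ∀ w, Y w = Y v → ρ w = w := by
      intro w hw
      rw [← h3]
      intro hwB
      exact hb2 (Finset.mem_image.2 ⟨w, hwB, by rw [hw, hdv]⟩)
    intro w hw1 hw2
    rw [← hB w hw2, ← hB v rfl]
    exact h2 w v hw1 hw2
  have hex : ∀ i x, i < M + 2 → x < r → ∃ v, X v = x ∧ Y v = c + i :=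
    fun i x hi hx => h.exists_cell hx (by omega)
  have : Nonempty (S : Set V) := ⟨(hex 0 0 (by omega) hr).choose⟩
  choose! τ hτ using hex
  have hτ' : ∀ i x, i < M + 2 → x < r → Alone X Y (τ i x) := by
    intro i x hi hx
    have := (hτ i x hi hx).2
    exact halone _ (by omega) (by omega)
  refine ⟨fun i x => τ i x, ⟨?_, ?_, ?_⟩, fun i x _ _ => (τ i x).2⟩
  · intro i x i' x' hi hx hi' hx' e
    have e' : τ i x = τ i' x' := Subtype.ext e
    have e1 := hτ i x hi hx
    have e2 := hτ i' x' hi' hx'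
    rw [e'] at e1
    omega
  · intro i x i' x' hi hx hi' hx'
    have e1 := hτ i x hi hx
    have e2 := hτ i' x' hi' hx'
    by_cases e : i = i' ∧ x = x'
    · obtain ⟨rfl, rfl⟩ := e
      simp
    · have hne : τ i x ≠ τ i' x' := by
        intro e'; rw [e'] at e1; omega
      have := h.adj_iff_of_alone (hτ' i x hi hx) (hτ' i' x' hi' hx') hne
      rw [SimpleGraph.induce_adj] at this
      rw [this, e1.1, e1.2, e2.1, e2.2]
      unfold Near
      omega
  -- One extra grid column on either side of the `M` inner ones contains all further neighbours.
  · intro i x v hi1 hi2 hx hv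
    have hvS := hS _ _ hv.symm
    have hn := h.near (τ i x) ⟨v, hvS⟩ hv
    have e1 := hτ i x (by omega) hx
    have hX := h.X_lt ⟨v, hvS⟩
    rw [e1.1, e1.2] at hn
    unfold Near at hn
    refine ⟨Y ⟨v, hvS⟩ - c, X ⟨v, hvS⟩, by omega, hX, ?_⟩
    have e2 := hτ (Y ⟨v, hvS⟩ - c) (X ⟨v, hvS⟩) (by omega) hX
    have := hτ' (Y ⟨v, hvS⟩ - c) (X ⟨v, hvS⟩) (by omega) hX ⟨v, hvS⟩ (by omega) (by omega)
    exact congrArg Subtype.val this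

/-- If nothing is detected in a yes-instance, then it is small. -/
theorem card_le_of_not_detects {G : SimpleGraph V} {S : Finset V} (hS : ∀ u v, G.Adj u v → u ∈ S)
    {k M N : ℕ} (hM : 2 ≤ M) (hN : S.card ≤ N) (h : Contractible (G.induce (S : Set V)) k)
    (hnot : ∀ a ∈ S, ∀ b ∈ S, ¬ Detects G N M a b) :
    S.card ≤ ((k + 1) * (M + 2)) ^ 2 + k := by
  obtain ⟨r, q, X, Y, hr, hq, h, hk⟩ := h
  have hcard : r * q ≤ S.card := by
    have hsurj : Function.Surjective fun v : (S : Set V) =>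
        ((⟨X v, h.X_lt v⟩, ⟨Y v, h.Y_lt v⟩) : Fin r × Fin q) := h.isContractibleVia.surjective
    simpa using Nat.card_le_card_of_surjective _ hsurj
  -- Stated for arbitrary dimensions, so that it also applies to the transposed grid and bounds `r`.
  have key : ∀ (r q : ℕ) (X Y : ↥(S : Set V) → ℕ), 2 ≤ r → 2 ≤ q →
      GridMap (G.induce (S : Set V)) r q X Y → S.card ≤ r * q + k → r * q ≤ S.card →
      q < (k + 1) * (M + 2) := by
    intro r q X Y hr hq h hk hcard
    by_contra hlt
    push Not at hlt
    obtain ⟨σ, h1, h2⟩ := h.exists_cleanZone hS (by omega) hk hlt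
    -- Both sides of the grid are at most `|S| ≤ N`, so `N` rounds suffice for both searches.
    have e1 : r ≤ r * q := Nat.le_mul_of_pos_right _ (by omega)
    have e2 : q ≤ r * q := Nat.le_mul_of_pos_left _ (by omega)
    have e3 : M + 2 ≤ (k + 1) * (M + 2) := Nat.le_mul_of_pos_left _ (by omega)
    exact hnot _ (h2 1 0 (by omega) (by omega)) _ (h2 2 0 (by omega) (by omega))
      (h1.detects hr hM (by omega) (by omega))
  have hk' : S.card ≤ r * q + k := by simpa using hk
  have e1 := key r q X Y hr hq h hk' hcard
  have e2 := key q r Y X hq hr h.swap (by rwa [mul_comm]) (by rwa [mul_comm])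
  have e3 : r * q ≤ ((k + 1) * (M + 2)) ^ 2 := by
    rw [pow_two]; exact Nat.mul_le_mul (by omega) (by omega)
  omega

open Classical in
/-- A graph which can be contracted to a grid by at most `k` contractions has few edges. -/
theorem Contractible.sum_adj_le {V : Type*} [Fintype V] {G : SimpleGraph V} {k : ℕ}
    (h : Contractible G k) :
    ∑ u : V, ∑ v : V, (if G.Adj u v then 1 else 0) ≤ 5 * Fintype.card V + k * (5 + k) := by
  obtain ⟨r, q, X, Y, hr, hq, h, hk⟩ := h
  obtain ⟨ρ, B, h1, h2, h3, h4⟩ := h.exists_representatives hk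
  -- Neighbours of `u` lie in its own cell and the four around it, each with one representative.
  -- Truncation of `- 1` at the border only repeats a cell.
  have hrep : ∀ u, (Finset.univ.filter fun v => G.Adj u v ∧ v ∉ B).card ≤ 5 := by
    intro u
    let cells : Finset (ℕ × ℕ) := {(X u, Y u), (X u, Y u + 1), (X u, Y u - 1), (X u + 1, Y u),
      (X u - 1, Y u)}
    have hc : cells.card ≤ 5 := Finset.card_le_five
    refine le_trans (Finset.card_le_card_of_injOn (fun v => (X v, Y v)) ?_ ?_) hc
    · intro v hv
      simp only [Finset.coe_filter, Finset.mem_univ, true_and, Set.mem_ofPred_eq] at hv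
      have := h.near u v hv.1
      simp only [cells, Finset.coe_insert, Finset.coe_singleton, Set.mem_insert_iff,
        Set.mem_singleton_iff, Prod.mk.injEq]
      unfold Near at this
      omega
    · intro v hv w hw e
      simp only [Finset.coe_filter, Finset.mem_univ, true_and, Set.mem_ofPred_eq] at hv hw
      simp only [Prod.mk.injEq] at e
      rw [← (h3 v).1 hv.2, ← (h3 w).1 hw.2]
      exact h2 v w e.1 e.2
  have hdeg : ∀ u, (Finset.univ.filter fun v => G.Adj u v).card ≤ 5 + k := by
    intro u
    have : (Finset.univ.filter fun v => G.Adj u v) ⊆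
        (Finset.univ.filter fun v => G.Adj u v ∧ v ∉ B) ∪ B := by
      intro v hv
      simp only [Finset.mem_union, Finset.mem_filter, Finset.mem_univ, true_and] at hv ⊢
      tauto
    have := (Finset.card_le_card this).trans (Finset.card_union_le _ _)
    have := hrep u
    omega
  have hsplit : ∀ u v, (if G.Adj u v then 1 else 0) =
      (if G.Adj u v ∧ v ∉ B then 1 else 0) + if v ∈ B then (if G.Adj u v then 1 else 0) else 0 := by
    intro u v
    by_cases e1 : G.Adj u v <;> by_cases e2 : v ∈ B <;> simp [e1, e2]
  rw [Finset.sum_congr rfl fun u _ => Finset.sum_congr rfl fun v _ => hsplit u v]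
  simp only [Finset.sum_add_distrib]
  apply add_le_add
  · calc _ ≤ ∑ u : V, 5 := by
          apply Finset.sum_le_sum
          intro u _
          rw [← Finset.card_filter]
          exact hrep u
      _ = _ := by simp [mul_comm]
  -- Pairs whose second vertex is a non-representative are counted from that vertex: there are at
  -- most `k` of them, with at most `5 + k` neighbours each.
  · rw [Finset.sum_comm]
    calc _ ≤ ∑ v : V, if v ∈ B then 5 + k else 0 := by
          apply Finset.sum_le_sum
          intro v _
          by_cases e : v ∈ B
          · simp only [e, if_true]
            rw [← Finset.card_filter]
            simp only [SimpleGraph.adj_comm G _ v]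
            exact hdeg v
          · simp [e]
      _ = B.card * (5 + k) := by simp
      _ ≤ _ := Nat.mul_le_mul_right _ h4

end GridContraction

/-! ### Logical terms, and filling arrays -/

namespace RAM

namespace Term

/-- The value of the term is not `0`. -/
def Tru (e : Term) (s : State) : Prop := e.eval s ≠ 0

instance (e : Term) (s : State) : Decidable (e.Tru s) := inferInstanceAs (Decidable (_ ≠ 0))

/-- Negation. -/
def neg (e : Term) : Term := .ite e (.const 0) (.const 1)
/-- Conjunction. -/
def and (e f : Term) : Term := .ite e f (.const 0)
/-- Disjunction. -/
def or (e f : Term) : Term := .ite e (.const 1) f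
/-- Implication. -/
def imp (e f : Term) : Term := .ite e f (.const 1)
/-- Comparison. -/
def le (e f : Term) : Term := neg (.sub e f)
/-- Strict comparison. -/
def lt (e f : Term) : Term := .sub f e
/-- Equality. -/
def eq (e f : Term) : Term := and (le e f) (le f e)
/-- Bounded existential quantification. -/
def ex (x : ℕ) (e : Term) : Term := .sum x e
/-- Bounded universal quantification. -/
def all (x : ℕ) (e : Term) : Term := neg (ex x (neg e))
/-- The truth value, as `0` or `1`. -/
def ind (e : Term) : Term := .ite e (.const 1) (.const 0)

variable (e f : Term) (s : State)

@[simp] lemma eval_const (c : ℕ) : (Term.const c).eval s = c := rfl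
@[simp] lemma eval_var (x : ℕ) : (Term.var x).eval s = s.var x := rfl
@[simp] lemma eval_read (a : ℕ) : (Term.read a e f).eval s = s.arr a (e.eval s) (f.eval s) := rfl
@[simp] lemma eval_add : (Term.add e f).eval s = e.eval s + f.eval s := rfl
@[simp] lemma eval_ite (c : Term) :
    (Term.ite c e f).eval s = if c.Tru s then e.eval s else f.eval s := rfl
@[simp] lemma eval_sum (x : ℕ) :
    (Term.sum x e).eval s = ∑ i ∈ Finset.range (s.var 0), e.eval (s.setVar x i) := rfl

@[simp] lemma tru_read (a : ℕ) :
    (Term.read a e f).Tru s ↔ s.arr a (e.eval s) (f.eval s) ≠ 0 := Iff.rfl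
@[simp] lemma tru_neg : (neg e).Tru s ↔ ¬ e.Tru s := by
  by_cases h : e.eval s = 0 <;> simp [Tru, neg, h]
@[simp] lemma tru_and : (and e f).Tru s ↔ e.Tru s ∧ f.Tru s := by
  by_cases h : e.eval s = 0 <;> simp [Tru, and, h]
@[simp] lemma tru_or : (or e f).Tru s ↔ e.Tru s ∨ f.Tru s := by
  by_cases h : e.eval s = 0 <;> simp [Tru, or, h]
@[simp] lemma tru_imp : (imp e f).Tru s ↔ (e.Tru s → f.Tru s) := by
  by_cases h : e.eval s = 0 <;> simp [Tru, imp, h]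
@[simp] lemma tru_le : (le e f).Tru s ↔ e.eval s ≤ f.eval s := by
  rw [le, tru_neg]; simp [Tru, Term.eval, Nat.sub_eq_zero_iff_le]
@[simp] lemma tru_lt : (lt e f).Tru s ↔ e.eval s < f.eval s := by
  simp [Tru, lt, Term.eval, Nat.sub_eq_zero_iff_le]
@[simp] lemma tru_eq : (eq e f).Tru s ↔ e.eval s = f.eval s := by
  rw [eq, tru_and, tru_le, tru_le]; omega
-- A sum of natural numbers is non-zero iff some summand is.
@[simp] lemma tru_ex (x : ℕ) : (ex x e).Tru s ↔ ∃ i < s.var 0, e.Tru (s.setVar x i) := by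
  simp [Tru, ex]
@[simp] lemma tru_all (x : ℕ) : (all x e).Tru s ↔ ∀ i < s.var 0, e.Tru (s.setVar x i) := by
  simp [all]
@[simp] lemma eval_ind : (ind e).eval s = if e.Tru s then 1 else 0 := rfl

/-- The term does not read the array `a`. -/
def Avoids (a : ℕ) : Term → Prop
  | .const _ => True
  | .var _ => True
  | .read b i j => b ≠ a ∧ i.Avoids a ∧ j.Avoids a
  | .add e f => e.Avoids a ∧ f.Avoids a
  | .sub e f => e.Avoids a ∧ f.Avoids a
  | .ite c e f => c.Avoids a ∧ e.Avoids a ∧ f.Avoids a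
  | .sum _ t => t.Avoids a

/-- An array is overwritten cell by cell; the values still to be computed must not depend on the
cells already changed. -/
lemma Avoids.eval_eq {a : ℕ} {e : Term} (h : e.Avoids a) {s s' : State} (hv : s.var = s'.var)
    (ha : ∀ b ≠ a, s.arr b = s'.arr b) : e.eval s = e.eval s' := by
  induction e generalizing s s' with
  | const c => rfl
  | var x => simp [hv]
  | read b i j ihi ihj => simp [ihi h.2.1 hv ha, ihj h.2.2 hv ha, ha b h.1]
  | add e f ih1 ih2 => simp [ih1 h.1 hv ha, ih2 h.2 hv ha]
  | sub e f ih1 ih2 => simp [Term.eval, ih1 h.1 hv ha, ih2 h.2 hv ha]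
  | ite c e f ih1 ih2 ih3 =>
    simp only [Term.eval, ih1 h.1 hv ha, ih2 h.2.1 hv ha, ih3 h.2.2 hv ha]
  | sum x t ih =>
    simp only [Term.eval, hv]
    exact Finset.sum_congr rfl fun i _ => ih h (by simp [State.setVar, hv]) ha

end Term

lemma Cmd.run_rep_var (x : ℕ) (c : Cmd) (s : State) : ((Cmd.rep x c).run s).var x = s.var x := by
  simp [Cmd.run]

/-- The loop invariant rule. The counter is set before each round and restored at the end, so the
invariant must not depend on it. -/
lemma Cmd.run_rep_induction {x N : ℕ} {c : Cmd} {s : State} (hN : s.var 0 = N)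
    (P : ℕ → State → Prop) (h0 : P 0 s) (hx : ∀ i s' z, P i s' → P i (s'.setVar x z))
    (hstep : ∀ i < N, ∀ s', P i s' → s'.var x = i → P (i + 1) (c.run s')) :
    P N ((Cmd.rep x c).run s) := by
  have key : ∀ i ≤ N, P i (iterStates c.run x s i) := by
    intro i
    induction i with
    | zero => intro _; exact h0
    | succ i ih =>
      intro hi
      exact hstep i (by omega) _ (hx _ _ _ (ih (by omega))) (by simp)
  rw [Cmd.run, hN]
  exact hx _ _ _ (key N le_rfl)

/-! ### Overwriting a whole array -/

/-- All cells `(i, j)` of the arrays outside `i, j < N` contain `0`. -/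
def State.Bounded (s : State) : Prop :=
  ∀ a i j, ¬ (i < s.var 0 ∧ j < s.var 0) → s.arr a i j = 0

/-- The contents of the array `a` are replaced by the values of `f`. -/
def State.fill (s : State) (a : ℕ) (f : ℕ → ℕ → ℕ) : State :=
  ⟨s.var, Function.update s.arr a fun i j => if i < s.var 0 ∧ j < s.var 0 then f i j else 0⟩

@[simp] lemma State.fill_var (s : State) (a : ℕ) (f : ℕ → ℕ → ℕ) : (s.fill a f).var = s.var := rfl

lemma State.fill_arr (s : State) (a : ℕ) (f : ℕ → ℕ → ℕ) (b : ℕ) : (s.fill a f).arr b =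
    if b = a then fun i j => if i < s.var 0 ∧ j < s.var 0 then f i j else 0 else s.arr b := by
  by_cases h : b = a
  · subst h; simp [State.fill]
  · simp [State.fill, h]

lemma State.Bounded.fill {s : State} (h : s.Bounded) (a : ℕ) (f : ℕ → ℕ → ℕ) :
    (s.fill a f).Bounded := by
  intro b i j hij
  rw [State.fill_arr]
  split_ifs with h1
  · exact if_neg hij
  · exact h b i j hij

/-- The command which stores the value of `e` in all cells `(i, j)` of the array `a`; in `e`, the
variables `2` and `3` stand for `i` and `j`. -/
def Cmd.fill (a : ℕ) (e : Term) : Cmd := .rep 2 (.rep 3 (.store a (.var 2) (.var 3) e))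

/-- The loops write only the cells with `i, j < N`; boundedness supplies the zeros elsewhere, so
that the result is again bounded and fills can be chained. -/
lemma Cmd.run_fill {a : ℕ} {e : Term} (he : e.Avoids a) {s : State} (hs : s.Bounded) :
    (Cmd.fill a e).run s = s.fill a fun i j => e.eval ((s.setVar 2 i).setVar 3 j) := by
  have inner : ∀ (s' : State), s'.var 0 = s.var 0 →
      ((Cmd.rep 3 (.store a (.var 2) (.var 3) e)).run s').var = s'.var ∧
      ∀ b i j, ((Cmd.rep 3 (.store a (.var 2) (.var 3) e)).run s').arr b i j =
        if b = a ∧ i = s'.var 2 ∧ j < s.var 0 then e.eval (s'.setVar 3 j) else s'.arr b i j := by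
    intro s' hs'
    have := Cmd.run_rep_induction (x := 3) (c := .store a (.var 2) (.var 3) e) hs'
      (fun n t => (∀ y ≠ 3, t.var y = s'.var y) ∧ ∀ b i j, t.arr b i j =
        if b = a ∧ i = s'.var 2 ∧ j < n then e.eval (s'.setVar 3 j) else s'.arr b i j)
      ⟨fun _ _ => rfl, by simp⟩
      (fun n t z ht => ⟨fun y hy => by simp [hy, ht.1 y hy], ht.2⟩)
      (by
        rintro n hn t ⟨h1, h2⟩ h3
        refine ⟨fun y hy => h1 y hy, fun b i j => ?_⟩
        have h4 : t.var 2 = s'.var 2 := h1 2 (by decide)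
        have h5 : e.eval t = e.eval (s'.setVar 3 n) := by
          apply he.eval_eq
          · funext y
            by_cases hy : y = 3
            · simp [hy, h3]
            · simp [hy, h1 y hy]
          · intro b hb
            funext i j
            rw [h2]; simp [hb]
        simp only [Cmd.run, State.setArr, Term.eval_var, h3, h4, h5]
        by_cases hb : b = a
        · subst hb
          by_cases hi : i = s'.var 2
          · subst hi
            by_cases hj : j = n
            · subst hj; simp
            · have e1 : (j < n + 1) ↔ j < n := by omega
              simp [hj, h2, e1]
          · simp [hi, h2]
        · simp [hb, h2])
    refine ⟨?_, this.2⟩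
    funext y
    by_cases hy : y = 3
    · rw [hy, Cmd.run_rep_var]
    · exact this.1 y hy
  have := Cmd.run_rep_induction (x := 2) (c := .rep 3 (.store a (.var 2) (.var 3) e))
    (s := s) rfl
    (fun n t => (∀ y ≠ 2, t.var y = s.var y) ∧ ∀ b i j, t.arr b i j =
      if b = a ∧ i < n ∧ j < s.var 0 then e.eval ((s.setVar 2 i).setVar 3 j) else s.arr b i j)
    ⟨fun _ _ => rfl, by simp⟩
    (fun n t z ht => ⟨fun y hy => by simp [hy, ht.1 y hy], ht.2⟩)
    (by
      rintro n hn t ⟨h1, h2⟩ h3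
      obtain ⟨h4, h5⟩ := inner t (h1 0 (by decide))
      refine ⟨fun y hy => by rw [h4, h1 y hy], fun b i j => ?_⟩
      rw [h5, h3]
      by_cases hb : b = a
      · subst hb
        by_cases hi : i = n
        · subst hi
          have h6 : e.eval (t.setVar 3 j) = e.eval ((s.setVar 2 i).setVar 3 j) := by
            apply he.eval_eq
            · funext y
              by_cases hy : y = 2
              · simp [hy, h3]
              · simp [hy, h1 y hy]
            · intro b hb
              funext i j
              simp [h2, hb]
          by_cases hj : j < s.var 0
          · simp [hj, h6]
          · simp [hj, h2]
        · have e1 : (i < n + 1) ↔ i < n := by omega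
          simp [hi, h2, e1]
      · simp [hb, h2])
  ext y
  · change ((Cmd.rep 2 _).run s).var y = s.var y
    by_cases hy : y = 2
    · rw [hy, Cmd.run_rep_var]
    · exact this.1 y hy
  · rename_i i j
    rw [Cmd.fill, this.2 y i j, State.fill_arr]
    by_cases hy : y = a
    · subst hy
      by_cases hij : i < s.var 0 ∧ j < s.var 0
      · simp [hij]
      · simp only [true_and, if_neg hij, if_true, hs y i j hij]
    · simp [hy]

end RAM

/-! ### The program -/

namespace GridContraction

open RAM

/-- Adjacency of the vertices in the variables `x` and `y`. -/
def adjTerm (x y : ℕ) : Term := .read 0 (.var x) (.var y)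
/-- The vertex in the variable `x` has been removed. -/
def deadTerm (x : ℕ) : Term := .read 1 (.var x) (.var x)
/-- The level of the vertex in the variable `x`. -/
def levTerm (x : ℕ) : Term := .read 4 (.var x) (.var x)

/-- One round in the computation of `opposite`. -/
def oppositeStep : Term :=
  .or (.read 2 (.var 2) (.var 3)) (.ex 6 (.ex 7 (.and (.read 2 (.var 6) (.var 7))
    (.and (adjTerm 2 6) (.and (adjTerm 3 7) (.and (adjTerm 2 3)
      (.and (.neg (.eq (.var 2) (.var 7))) (.neg (.eq (.var 3) (.var 6))))))))))

/-- The computation of `opposite`, in array `2`. -/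
def oppositeCmd : Cmd :=
  .seq (.fill 2 (.ind (.and (.eq (.var 2) (.var 4)) (.eq (.var 3) (.var 5)))))
    (.rep 13 (.seq (.fill 3 oppositeStep) (.fill 2 (.read 3 (.var 2) (.var 3)))))

/-- The initial levels. -/
def levelsInit : Term :=
  .ite (.ex 6 (.read 2 (.var 2) (.var 6))) (.const 1)
    (.ite (.ex 6 (.read 2 (.var 6) (.var 2))) (.const 2) (.const 0))

/-- One round in the computation of `searchLevels`. -/
def levelsStep : Term :=
  .ite (levTerm 2) (levTerm 2)
    (.ite (.ex 6 (.and (adjTerm 2 6) (.eq (levTerm 6) (.add (.var 14) (.const 2)))))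
      (.add (.var 14) (.const 3)) (.const 0))

/-- The computation of `searchLevels` from `opposite`, in array `4`. -/
def levelsCmd : Cmd :=
  .seq (.fill 4 levelsInit)
    (.rep 14 (.seq (.fill 5 levelsStep) (.fill 4 (.read 5 (.var 2) (.var 3)))))

/-- The number `6k + 4`. -/
def slabTerm : Term :=
  .add (.add (.add (.var 1) (.var 1)) (.add (.var 1) (.var 1)))
    (.add (.add (.var 1) (.var 1)) (.const 4))

/-- The level of the vertex in the variable `x` is at least `c`. -/
def levGe (c x : ℕ) : Term := .le (.const c) (levTerm x)
/-- The level of the vertex in the variable `x` is less than `6k + 4`. -/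
def levLt (x : ℕ) : Term := .lt (levTerm x) slabTerm
/-- The level of the vertex in the variable `x` is at most `6k + 4`. -/
def levLe (x : ℕ) : Term := .le (levTerm x) slabTerm
/-- The level of the vertex in `y` is by one larger than that of the vertex in `x`. -/
def levSucc (x y : ℕ) : Term := .eq (levTerm y) (.add (levTerm x) (.const 1))

/-- The condition `IsSlab.up`. -/
def upTerm : Term :=
  .all 6 (.imp (levGe 1 6) (.imp (levLt 6) (.ex 7 (.and (adjTerm 6 7) (levSucc 6 7)))))
/-- The condition `IsSlab.up_unique`. -/
def upUniqueTerm : Term :=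
  .all 6 (.all 7 (.all 8 (.imp (levGe 1 6) (.imp (levLt 6) (.imp (adjTerm 6 7)
    (.imp (adjTerm 6 8) (.imp (levSucc 6 7) (.imp (levSucc 6 8) (.eq (.var 7) (.var 8))))))))))
/-- The condition `IsSlab.down`. -/
def downTerm : Term :=
  .all 6 (.imp (levGe 2 6) (.imp (levLe 6) (.ex 7 (.and (adjTerm 6 7) (levSucc 7 6)))))
/-- The condition `IsSlab.down_unique`. -/
def downUniqueTerm : Term :=
  .all 6 (.all 7 (.all 8 (.imp (levGe 2 6) (.imp (levLe 6) (.imp (adjTerm 6 7)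
    (.imp (adjTerm 6 8) (.imp (levSucc 7 6) (.imp (levSucc 8 6) (.eq (.var 7) (.var 8))))))))))
/-- The condition `IsSlab.comm`. -/
def commTerm : Term :=
  .all 6 (.all 7 (.all 8 (.all 9 (.imp (levGe 1 6) (.imp (levLt 6)
    (.imp (.eq (levTerm 7) (levTerm 6)) (.imp (levSucc 6 8) (.imp (levSucc 6 9)
    (.imp (adjTerm 6 8) (.imp (adjTerm 7 9)
      (.and (.imp (adjTerm 6 7) (adjTerm 8 9)) (.imp (adjTerm 8 9) (adjTerm 6 7)))))))))))))
/-- The condition `IsSlab.span`. -/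
def spanTerm : Term :=
  .all 6 (.all 7 (.imp (adjTerm 6 7) (.imp (levGe 1 6) (.imp (levLe 6) (.imp (levGe 1 7)
    (.imp (levLe 7) (.le (levTerm 7) (.add (levTerm 6) (.const 1)))))))))
/-- The condition `IsSlab.inner`. -/
def innerTerm : Term :=
  .all 6 (.all 7 (.imp (adjTerm 6 7) (.imp (levGe 2 6) (.imp (levLt 6)
    (.and (levGe 1 7) (levLe 7))))))
/-- The condition `Detects.nontrivial`. -/
def nontrivialTerm : Term :=
  .ex 6 (.and (.eq (levTerm 6) (.const 1)) (.neg (.eq (.var 6) (.var 4))))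

/-- The conditions of `Detects`. -/
def detectTerm : Term :=
  .and upTerm <| .and upUniqueTerm <| .and downTerm <| .and downUniqueTerm <| .and commTerm <|
    .and spanTerm <| .and innerTerm nontrivialTerm

/-- The level of the vertex in the variable `x` is `2`. -/
def levTwo (x : ℕ) : Term := .eq (levTerm x) (.const 2)

/-- The adjacency relation of `removeLevel`. -/
def removeTerm : Term :=
  .and (.neg (levTwo 2)) (.and (.neg (levTwo 3)) (.or (adjTerm 2 3)
    (.ex 6 (.and (levTwo 6) (.and (adjTerm 2 6) (.and (adjTerm 3 6)
      (.neg (.eq (.var 2) (.var 3)))))))))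

/-- The computation of `removeLevel`. -/
def removeCmd : Cmd :=
  .seq (.fill 6 (.ind removeTerm)) <|
  .seq (.fill 7 (.ind (.or (deadTerm 2) (levTwo 2)))) <|
  .seq (.fill 0 (.read 6 (.var 2) (.var 3))) (.fill 1 (.read 7 (.var 2) (.var 3)))

/-- One reduction, if a slab is detected from the vertices in the variables `4` and `5`. -/
def tryCmd : Cmd := .seq oppositeCmd (.seq levelsCmd (.cond detectTerm removeCmd))

/-- The number of remaining vertices before the vertex in the variable `x`. -/
def rankTerm (x : ℕ) : Term :=
  .sum 8 (.ind (.and (.lt (.var 8) (.var x)) (.neg (deadTerm 8))))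

/-- The product of `min (k, N)` and `e`. -/
def mulMinTerm (x : ℕ) (e : Term) : Term := .sum x (.ite (.lt (.var x) (.var 1)) e (.const 0))

/-- The number `2891 (min (k, N) ^ 4 + 1)`. -/
def boundTerm : Term :=
  .add (mulMinTerm 6 (mulMinTerm 7 (mulMinTerm 8 (mulMinTerm 9 (.const 2891))))) (.const 2891)

/-- The adjacency relation of the renumbered graph. -/
def renumberTerm : Term :=
  .ex 6 (.ex 7 (.and (.neg (deadTerm 6)) (.and (.neg (deadTerm 7))
    (.and (.eq (rankTerm 6) (.var 2)) (.and (.eq (rankTerm 7) (.var 3)) (adjTerm 6 7))))))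

/-- The output: the number of vertices in variable `20`, whether it is small in variable `21`, and
the renumbered graph in array `0`. -/
def outputCmd : Cmd :=
  .seq (.set 20 (.sum 6 (.ind (.neg (deadTerm 6))))) <|
  .seq (.set 21 (.ind (.and (.le (.var 20) boundTerm)
    (.le (.sum 6 (.sum 7 (adjTerm 6 7))) boundTerm)))) <|
  .seq (.fill 2 (.ind renumberTerm)) (.fill 0 (.read 2 (.var 2) (.var 3)))

/-- All reductions, and the output. -/
def mainCmd : Cmd := .seq (.rep 12 (.rep 4 (.rep 5 tryCmd))) outputCmd

/-- The whole program. -/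
def kernelProg : Prog :=
  .seq (mainCmd.compile 30) (.ite (.var 21) (.assign 0 (.var 20))
    (.seq (.assign 0 (.const 0)) (.assign 1 (.const 0))))

lemma mainCmd_wf : mainCmd.WF 30 := by
  simp [mainCmd, outputCmd, tryCmd, oppositeCmd, oppositeStep, levelsCmd, levelsInit, levelsStep,
    removeCmd, removeTerm, detectTerm, upTerm, upUniqueTerm, downTerm, downUniqueTerm, commTerm,
    spanTerm, innerTerm, nontrivialTerm, renumberTerm, Cmd.fill, Cmd.WF, Term.WF, Cmd.Keeps,
    rankTerm, boundTerm, mulMinTerm, levTwo, levGe, levLt, levLe, levSucc, slabTerm, levTerm,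
    adjTerm, deadTerm, Term.ind, Term.and, Term.or, Term.imp, Term.neg, Term.le, Term.lt, Term.eq,
    Term.ex, Term.all]

/-- The state represents the graph `G` on the set `S` of remaining vertices. -/
structure Encodes (s : State) (N k : ℕ) (G : SimpleGraph ℕ) (S : Finset ℕ) : Prop where
  var_zero : s.var 0 = N
  var_one : s.var 1 = k
  bounded : s.Bounded
  adj : ∀ i j, s.arr 0 i j = 1 ∧ G.Adj i j ∨ s.arr 0 i j = 0 ∧ ¬ G.Adj i j
  dead : ∀ i, s.arr 1 i i ≠ 0 ↔ i < N ∧ i ∉ S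
  mem : ∀ i j, G.Adj i j → i ∈ S
  lt : ∀ i ∈ S, i < N

namespace Encodes

variable {s : State} {N k : ℕ} {G : SimpleGraph ℕ} {S : Finset ℕ}

lemma adj_iff (h : Encodes s N k G S) (i j : ℕ) : s.arr 0 i j ≠ 0 ↔ G.Adj i j := by
  rcases h.adj i j with ⟨h1, h2⟩ | ⟨h1, h2⟩ <;> simp [h1, h2]

lemma adj_lt (h : Encodes s N k G S) {i j : ℕ} (hij : G.Adj i j) : i < N ∧ j < N :=
  ⟨h.lt _ (h.mem _ _ hij), h.lt _ (h.mem _ _ hij.symm)⟩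

lemma setVar (h : Encodes s N k G S) {x : ℕ} (z : ℕ) (h0 : x ≠ 0) (h1 : x ≠ 1) :
    Encodes (s.setVar x z) N k G S := by
  have e0 : (s.setVar x z).var 0 = s.var 0 := by simp [h0.symm]
  refine ⟨e0.trans h.var_zero, by simp [h1.symm, h.var_one], ?_, h.adj, h.dead, h.mem, h.lt⟩
  intro a i j hij
  rw [e0] at hij
  exact h.bounded a i j hij

lemma fill (h : Encodes s N k G S) {a : ℕ} (f : ℕ → ℕ → ℕ) (h0 : a ≠ 0) (h1 : a ≠ 1) :
    Encodes (s.fill a f) N k G S := by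
  refine ⟨h.var_zero, h.var_one, h.bounded.fill a f, ?_, ?_, h.mem, h.lt⟩
  · intro i j; rw [State.fill_arr, if_neg h0.symm]; exact h.adj i j
  · intro i; rw [State.fill_arr, if_neg h1.symm]; exact h.dead i

end Encodes

/-- Quantifiers of the program range over numbers below `N`, those of `opposite` over all of `ℕ`.
Nothing is lost, since every pair reached lies below `N`; `searchLevels_lt` does the same for
levels. -/
lemma opposite_lt {s : State} {N k : ℕ} {G : SimpleGraph ℕ} {S : Finset ℕ} (h : Encodes s N k G S)
    {a b : ℕ} (ha : a < N) (hb : b < N) {t x y : ℕ} (hxy : opposite G a b t x y) :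
    x < N ∧ y < N := by
  induction t generalizing x y with
  | zero => obtain ⟨rfl, rfl⟩ := hxy; exact ⟨ha, hb⟩
  | succ t ih =>
    rcases hxy with h1 | ⟨x', y', h1, h2, h3, -⟩
    · exact ih h1
    · exact ⟨(h.adj_lt h2).1, (h.adj_lt h3).1⟩

lemma run_oppositeCmd {s : State} {N k : ℕ} {G : SimpleGraph ℕ} {S : Finset ℕ}
    (h : Encodes s N k G S) (ha : s.var 4 < N) (hb : s.var 5 < N) :
    Encodes (oppositeCmd.run s) N k G S ∧ (oppositeCmd.run s).var 4 = s.var 4 ∧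
      (oppositeCmd.run s).var 5 = s.var 5 ∧
      ∀ x y, (oppositeCmd.run s).arr 2 x y ≠ 0 ↔ opposite G (s.var 4) (s.var 5) N x y := by
  rw [oppositeCmd, Cmd.run, Cmd.run_fill (by simp [Term.Avoids, Term.ind, Term.and, Term.eq, Term.le,
    Term.neg]) h.bounded]
  refine Cmd.run_rep_induction (x := 13) (s := s.fill 2 _) h.var_zero
    (fun t s' => Encodes s' N k G S ∧ s'.var 4 = s.var 4 ∧ s'.var 5 = s.var 5 ∧
      ∀ x y, s'.arr 2 x y ≠ 0 ↔ opposite G (s.var 4) (s.var 5) t x y) ?_ ?_ ?_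
  · refine ⟨h.fill _ (by decide) (by decide), rfl, rfl, fun x y => ?_⟩
    simp only [State.fill_arr, if_true, h.var_zero, opposite]
    by_cases hxy : x < N ∧ y < N
    · simp [hxy]
    · simp only [if_neg hxy, ne_eq, not_true_eq_false, false_iff]
      rintro ⟨rfl, rfl⟩
      exact hxy ⟨ha, hb⟩
  · rintro t s' z ⟨h1, h2, h3, h4⟩
    exact ⟨h1.setVar z (by decide) (by decide), by simp [h2], by simp [h3], h4⟩
  · rintro t ht s' ⟨h1, h2, h3, h4⟩ -
    rw [Cmd.run, Cmd.run_fill (by simp [oppositeStep, Term.Avoids, Term.ex, Term.and, Term.eq,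
      Term.le, Term.neg, Term.or, adjTerm]) h1.bounded]
    -- Each round is computed in array `3` and copied to array `2`, because a fill must not read the
    -- array that it writes.
    have h5 := h1.fill (a := 3) (fun i j => oppositeStep.eval ((s'.setVar 2 i).setVar 3 j))
      (by decide) (by decide)
    rw [Cmd.run_fill (by simp [Term.Avoids]) h5.bounded]
    refine ⟨h5.fill _ (by decide) (by decide), h2, h3, fun x y => ?_⟩
    simp only [State.fill_arr, if_true, State.fill_var, h1.var_zero, Term.eval_read, Term.eval_var,
      State.setVar_arr, State.setVar_var, Nat.reduceEqDiff, if_false]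
    by_cases hxy : x < N ∧ y < N
    · simp only [hxy, and_self, if_true, opposite]
      change oppositeStep.Tru _ ↔ _
      simp only [oppositeStep, adjTerm, Term.tru_or, Term.tru_ex, Term.tru_and, Term.tru_neg,
        Term.tru_eq, Term.tru_read, Term.eval_var, State.setVar_var, State.setVar_arr, h4,
        h1.adj_iff, h1.var_zero]
      norm_num
      refine or_congr_right ⟨?_, ?_⟩
      · rintro ⟨i, -, j, -, h6⟩
        exact ⟨i, j, h6⟩
      · rintro ⟨i, j, h6⟩
        exact ⟨i, (h.adj_lt h6.2.1).2, j, (h.adj_lt h6.2.2.1).2, h6⟩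
    · simp only [if_neg hxy, ne_eq, not_true_eq_false, false_iff]
      intro h6
      exact hxy (opposite_lt h ha hb h6)

lemma searchLevels_lt {s : State} {N k : ℕ} {G : SimpleGraph ℕ} {S : Finset ℕ}
    (h : Encodes s N k G S) {a b : ℕ} (ha : a < N) (hb : b < N) {v : ℕ} :
    ∀ {z : ℕ}, levels G (initialLevels (opposite G a b N)) z v ≠ 0 → v < N := by
  intro z
  induction z with
  | zero =>
    intro hv
    simp only [levels, initialLevels] at hv
    split_ifs at hv with h1 h2
    · obtain ⟨y, hy⟩ := h1
      exact (opposite_lt h ha hb hy).1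
    · obtain ⟨y, hy⟩ := h2
      exact (opposite_lt h ha hb hy).2
    · exact absurd rfl hv
  | succ z ih =>
    intro hv
    rw [levels] at hv
    split_ifs at hv with h1 h2
    · exact ih h1
    · obtain ⟨w, hw, -⟩ := h2
      exact (h.adj_lt hw).1
    · exact absurd rfl hv

/-- Levels are kept on the diagonal of array `4`; the loop counter `14` serves as the round number
`z` in `levels`. -/
lemma run_levelsCmd {s : State} {N k : ℕ} {G : SimpleGraph ℕ} {S : Finset ℕ} {a b : ℕ}
    (h : Encodes s N k G S) (ha : a < N) (hb : b < N)
    (hT : ∀ x y, s.arr 2 x y ≠ 0 ↔ opposite G a b N x y) :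
    Encodes (levelsCmd.run s) N k G S ∧ (levelsCmd.run s).var 4 = s.var 4 ∧
      (levelsCmd.run s).var 5 = s.var 5 ∧
      ∀ v, (levelsCmd.run s).arr 4 v v = searchLevels G N a b v := by
  rw [levelsCmd, Cmd.run, Cmd.run_fill (by simp [Term.Avoids, levelsInit, Term.ex]) h.bounded]
  refine Cmd.run_rep_induction (x := 14) (s := s.fill 4 _) h.var_zero
    (fun t s' => Encodes s' N k G S ∧ s'.var 4 = s.var 4 ∧ s'.var 5 = s.var 5 ∧
      ∀ v, s'.arr 4 v v = levels G (initialLevels (opposite G a b N)) t v) ?_ ?_ ?_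
  · refine ⟨h.fill _ (by decide) (by decide), rfl, rfl, fun v => ?_⟩
    simp only [State.fill_arr, if_true, h.var_zero, and_self]
    by_cases hv : v < N
    · have e1 : (∃ i < N, opposite G a b N v i) ↔ ∃ i, opposite G a b N v i :=
        ⟨fun ⟨i, _, hi⟩ => ⟨i, hi⟩, fun ⟨i, hi⟩ => ⟨i, (opposite_lt h ha hb hi).2, hi⟩⟩
      have e2 : (∃ i < N, opposite G a b N i v) ↔ ∃ i, opposite G a b N i v :=
        ⟨fun ⟨i, _, hi⟩ => ⟨i, hi⟩, fun ⟨i, hi⟩ => ⟨i, (opposite_lt h ha hb hi).1, hi⟩⟩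
      simp only [hv, if_true, levelsInit, Term.eval_ite, levels, initialLevels]
      classical
      refine if_congr ?_ rfl (if_congr ?_ rfl rfl)
      · simpa [h.var_zero, hT] using e1
      · simpa [h.var_zero, hT] using e2
    · rw [if_neg hv]
      by_contra h1
      exact hv (searchLevels_lt h ha hb (Ne.symm h1))
  · rintro t s' z ⟨h1, h2, h3, h4⟩
    exact ⟨h1.setVar z (by decide) (by decide), by simp [h2], by simp [h3], h4⟩
  · rintro t ht s' ⟨h1, h2, h3, h4⟩ h14
    rw [Cmd.run, Cmd.run_fill (by simp [levelsStep, levTerm, Term.Avoids, Term.ex, Term.and,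
      Term.eq, Term.le, Term.neg, adjTerm]) h1.bounded]
    have h5 := h1.fill (a := 5) (fun i j => levelsStep.eval ((s'.setVar 2 i).setVar 3 j))
      (by decide) (by decide)
    rw [Cmd.run_fill (by simp [Term.Avoids]) h5.bounded]
    refine ⟨h5.fill _ (by decide) (by decide), h2, h3, fun v => ?_⟩
    simp only [State.fill_arr, if_true, State.fill_var, h1.var_zero, Term.eval_read, Term.eval_var,
      State.setVar_arr, State.setVar_var, Nat.reduceEqDiff, if_false, and_self]
    by_cases hv : v < N
    · have e1 : (∃ i < N, G.Adj v i ∧ levels G (initialLevels (opposite G a b N)) t i = t + 2) ↔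
          ∃ i, G.Adj v i ∧ levels G (initialLevels (opposite G a b N)) t i = t + 2 :=
        ⟨fun ⟨i, _, hi⟩ => ⟨i, hi⟩, fun ⟨i, hi⟩ => ⟨i, (h.adj_lt hi.1).2, hi⟩⟩
      simp only [hv, if_true, levelsStep, Term.eval_ite, levels]
      classical
      refine if_congr (by simp [levTerm, h4]) (by simp [levTerm, h4]) (if_congr ?_ ?_ rfl)
      · simpa [levTerm, adjTerm, h14, h1.adj_iff, h1.var_zero, h4] using e1
      · simp [h14]
    · simp only [if_neg hv]
      by_contra h6
      exact hv (searchLevels_lt h ha hb (Ne.symm h6))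

section

variable {s : State} {N k : ℕ} {G : SimpleGraph ℕ} {S : Finset ℕ} {L : ℕ → ℕ}

/-- Vertices with a non-zero level and ends of edges are below `N`, so the bounded quantifiers are
as strong as unbounded ones. The other conditions are treated alike. -/
lemma upTerm_tru (h : Encodes s N k G S) (hL : ∀ v, s.arr 4 v v = L v)
    (hlt : ∀ v, L v ≠ 0 → v < N) : upTerm.Tru s ↔
    ∀ v, 1 ≤ L v → L v < 6 * k + 4 → ∃ w, G.Adj v w ∧ L w = L v + 1 := by
  have hk : k + k + (k + k) + (k + k + 4) = 6 * k + 4 := by ring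
  simp [upTerm, levGe, levLt, levSucc, adjTerm, levTerm, slabTerm, h.adj_iff, h.var_zero,
    h.var_one, hL, hk]
  constructor
  · intro H v h1 h2
    obtain ⟨w, -, hw⟩ := H v (hlt v (by omega)) h1 h2
    exact ⟨w, hw⟩
  · intro H v _ h1 h2
    obtain ⟨w, hw⟩ := H v h1 h2
    exact ⟨w, (h.adj_lt hw.1).2, hw⟩

lemma upUniqueTerm_tru (h : Encodes s N k G S) (hL : ∀ v, s.arr 4 v v = L v)
    (hlt : ∀ v, L v ≠ 0 → v < N) : upUniqueTerm.Tru s ↔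
    ∀ v w w', 1 ≤ L v → L v < 6 * k + 4 → G.Adj v w → G.Adj v w' →
      L w = L v + 1 → L w' = L v + 1 → w = w' := by
  have hk : k + k + (k + k) + (k + k + 4) = 6 * k + 4 := by ring
  simp [upUniqueTerm, levGe, levLt, levSucc, adjTerm, levTerm, slabTerm, h.adj_iff, h.var_zero,
    h.var_one, hL, hk]
  exact ⟨fun H v w w' h1 h2 h3 h4 => H v (hlt v (by omega)) w (h.adj_lt h3).2 w' (h.adj_lt h4).2
    h1 h2 h3 h4, fun H v _ w _ w' _ => H v w w'⟩

lemma downTerm_tru (h : Encodes s N k G S) (hL : ∀ v, s.arr 4 v v = L v)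
    (hlt : ∀ v, L v ≠ 0 → v < N) : downTerm.Tru s ↔
    ∀ v, 2 ≤ L v → L v ≤ 6 * k + 4 → ∃ w, G.Adj v w ∧ L w + 1 = L v := by
  have hk : k + k + (k + k) + (k + k + 4) = 6 * k + 4 := by ring
  simp [downTerm, levGe, levLe, levSucc, adjTerm, levTerm, slabTerm, h.adj_iff, h.var_zero,
    h.var_one, hL, hk]
  constructor
  · intro H v h1 h2
    obtain ⟨w, -, hw⟩ := H v (hlt v (by omega)) h1 h2
    exact ⟨w, hw.1, hw.2.symm⟩
  · intro H v _ h1 h2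
    obtain ⟨w, hw⟩ := H v h1 h2
    exact ⟨w, (h.adj_lt hw.1).2, hw.1, hw.2.symm⟩

lemma downUniqueTerm_tru (h : Encodes s N k G S) (hL : ∀ v, s.arr 4 v v = L v)
    (hlt : ∀ v, L v ≠ 0 → v < N) : downUniqueTerm.Tru s ↔
    ∀ v w w', 2 ≤ L v → L v ≤ 6 * k + 4 → G.Adj v w → G.Adj v w' →
      L w + 1 = L v → L w' + 1 = L v → w = w' := by
  have hk : k + k + (k + k) + (k + k + 4) = 6 * k + 4 := by ring
  simp [downUniqueTerm, levGe, levLe, levSucc, adjTerm, levTerm, slabTerm, h.adj_iff, h.var_zero,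
    h.var_one, hL, hk]
  exact ⟨fun H v w w' h1 h2 h3 h4 h5 h6 => H v (hlt v (by omega)) w (h.adj_lt h3).2 w'
    (h.adj_lt h4).2 h1 h2 h3 h4 h5.symm h6.symm,
    fun H v _ w _ w' _ h1 h2 h3 h4 h5 h6 => H v w w' h1 h2 h3 h4 h5.symm h6.symm⟩

lemma commTerm_tru (h : Encodes s N k G S) (hL : ∀ v, s.arr 4 v v = L v)
    (hlt : ∀ v, L v ≠ 0 → v < N) : commTerm.Tru s ↔
    ∀ v w v' w', 1 ≤ L v → L v < 6 * k + 4 → L w = L v → L v' = L v + 1 →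
      L w' = L v + 1 → G.Adj v v' → G.Adj w w' → (G.Adj v w ↔ G.Adj v' w') := by
  have hk : k + k + (k + k) + (k + k + 4) = 6 * k + 4 := by ring
  simp [commTerm, levGe, levLt, levSucc, adjTerm, levTerm, slabTerm, h.adj_iff, h.var_zero,
    h.var_one, hL, hk]
  exact ⟨fun H v w v' w' h1 h2 h3 h4 h5 h6 h7 =>
    have := H v (hlt v (by omega)) w (hlt w (by omega)) v' (hlt v' (by omega)) w'
      (hlt w' (by omega)) h1 h2 h3 h4 h5 h6 h7
    ⟨this.1, this.2⟩,
    fun H v _ w _ v' _ w' _ h1 h2 h3 h4 h5 h6 h7 =>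
    have := H v w v' w' h1 h2 h3 h4 h5 h6 h7
    ⟨this.1, this.2⟩⟩

lemma spanTerm_tru (h : Encodes s N k G S) (hL : ∀ v, s.arr 4 v v = L v) : spanTerm.Tru s ↔
    ∀ v w, G.Adj v w → 1 ≤ L v → L v ≤ 6 * k + 4 → 1 ≤ L w → L w ≤ 6 * k + 4 →
      L w ≤ L v + 1 := by
  have hk : k + k + (k + k) + (k + k + 4) = 6 * k + 4 := by ring
  simp [spanTerm, levGe, levLe, adjTerm, levTerm, slabTerm, h.adj_iff, h.var_zero,
    h.var_one, hL, hk]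
  exact ⟨fun H v w h1 => H v (h.adj_lt h1).1 w (h.adj_lt h1).2 h1, fun H v _ w _ => H v w⟩

lemma innerTerm_tru (h : Encodes s N k G S) (hL : ∀ v, s.arr 4 v v = L v) : innerTerm.Tru s ↔
    ∀ v w, G.Adj v w → 2 ≤ L v → L v < 6 * k + 4 → 1 ≤ L w ∧ L w ≤ 6 * k + 4 := by
  have hk : k + k + (k + k) + (k + k + 4) = 6 * k + 4 := by ring
  simp [innerTerm, levGe, levLt, levLe, adjTerm, levTerm, slabTerm, h.adj_iff, h.var_zero,
    h.var_one, hL, hk]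
  exact ⟨fun H v w h1 => H v (h.adj_lt h1).1 w (h.adj_lt h1).2 h1, fun H v _ w _ => H v w⟩

lemma nontrivialTerm_tru (h : Encodes s N k G S) (hL : ∀ v, s.arr 4 v v = L v)
    (hlt : ∀ v, L v ≠ 0 → v < N) : nontrivialTerm.Tru s ↔ ∃ v, L v = 1 ∧ v ≠ s.var 4 := by
  simp [nontrivialTerm, levTerm, h.var_zero, hL]
  exact ⟨fun ⟨v, _, hv⟩ => ⟨v, hv⟩, fun ⟨v, hv⟩ => ⟨v, hlt v (by omega), hv⟩⟩

end

lemma detectTerm_tru {s : State} {N k : ℕ} {G : SimpleGraph ℕ} {S : Finset ℕ} {b : ℕ}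
    (h : Encodes s N k G S) (ha : s.var 4 < N) (hb : b < N)
    (hL : ∀ v, s.arr 4 v v = searchLevels G N (s.var 4) b v) :
    detectTerm.Tru s ↔ Detects G N (6 * k + 4) (s.var 4) b := by
  have hlt : ∀ v, searchLevels G N (s.var 4) b v ≠ 0 → v < N :=
    fun v hv => searchLevels_lt h ha hb hv
  simp only [detectTerm, Term.tru_and, upTerm_tru h hL hlt, upUniqueTerm_tru h hL hlt,
    downTerm_tru h hL hlt, downUniqueTerm_tru h hL hlt, commTerm_tru h hL hlt,
    spanTerm_tru h hL, innerTerm_tru h hL, nontrivialTerm_tru h hL hlt]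
  exact ⟨fun ⟨h1, h2, h3, h4, h5, h6, h7, h8⟩ => ⟨⟨h1, h2, h3, h4, h5, h6, h7⟩, h8⟩,
    fun ⟨⟨h1, h2, h3, h4, h5, h6, h7⟩, h8⟩ => ⟨h1, h2, h3, h4, h5, h6, h7, h8⟩⟩

/-- The new adjacency and the new removal marks are both computed in spare arrays before arrays `0`
and `1` are overwritten. -/
lemma run_removeCmd {s : State} {N k : ℕ} {G : SimpleGraph ℕ} {S : Finset ℕ} {L : ℕ → ℕ}
    (h : Encodes s N k G S) (hL : ∀ v, s.arr 4 v v = L v) :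
    Encodes (removeCmd.run s) N k (removeLevel G L) (S.filter (L · ≠ 2)) ∧
      (removeCmd.run s).var = s.var := by
  have b1 := h.bounded
  have b2 := b1.fill 6 (fun i j => (Term.ind removeTerm).eval ((s.setVar 2 i).setVar 3 j))
  have b3 := b2.fill 7 (fun i j => (Term.ind (.or (deadTerm 2) (levTwo 2))).eval
    (((s.fill 6 fun i j => (Term.ind removeTerm).eval
      ((s.setVar 2 i).setVar 3 j)).setVar 2 i).setVar 3 j))
  rw [removeCmd, Cmd.run, Cmd.run_fill (by simp [Term.Avoids, Term.ind, Term.neg, Term.and,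
    Term.or, Term.ex, Term.eq, Term.le, removeTerm, levTwo, levTerm, adjTerm]) b1,
    Cmd.run, Cmd.run_fill (by simp [Term.Avoids, Term.ind, Term.neg, Term.and,
    Term.or, Term.eq, Term.le, deadTerm, levTwo, levTerm]) b2,
    Cmd.run, Cmd.run_fill (by simp [Term.Avoids]) b3, Cmd.run_fill (by simp [Term.Avoids])
    (b3.fill _ _)]
  refine ⟨⟨h.var_zero, h.var_one, (b3.fill _ _).fill _ _, fun i j => ?_, fun i => ?_,
    fun i j hij => ?_, fun i hi => h.lt i (Finset.mem_filter.1 hi).1⟩, rfl⟩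
  · have hR : (removeLevel G L).Adj i j → i < N ∧ j < N := by
      rintro ⟨-, -, h1 | ⟨v, -, h1, h2, -⟩⟩
      · exact h.adj_lt h1
      · exact ⟨(h.adj_lt h1).1, (h.adj_lt h2).1⟩
    have hT : i < N → j < N → (removeTerm.Tru ((s.setVar 2 i).setVar 3 j) ↔
        (removeLevel G L).Adj i j) := by
      intro hi hj
      simp only [removeTerm, levTwo, levTerm, adjTerm, Term.tru_and, Term.tru_or, Term.tru_neg,
        Term.tru_eq, Term.tru_ex, Term.tru_read, Term.eval_read, Term.eval_var, Term.eval_const,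
        State.setVar_var, State.setVar_arr, Nat.reduceEqDiff, if_true, if_false, hL, h.adj_iff,
        h.var_zero, removeLevel, OfNat.zero_ne_ofNat]
      refine and_congr_right fun _ => and_congr_right fun _ => or_congr_right ⟨?_, ?_⟩
      · rintro ⟨v, -, hv⟩
        exact ⟨v, hv⟩
      · rintro ⟨v, hv⟩
        exact ⟨v, (h.adj_lt hv.2.1).2, hv⟩
    simp only [State.fill_arr, State.fill_var, h.var_zero, Nat.reduceEqDiff, if_true, if_false,
      Term.eval_read, Term.eval_var, State.setVar_var, State.setVar_arr, OfNat.zero_ne_ofNat,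
      OfNat.ofNat_ne_zero, zero_ne_one, Term.eval_ind]
    by_cases hij : i < N ∧ j < N
    · simp only [hij, and_self, if_true]
      rw [← hT hij.1 hij.2]
      by_cases h1 : removeTerm.Tru ((s.setVar 2 i).setVar 3 j) <;> simp [h1]
    · simp only [if_neg hij]
      simpa using fun h1 => hij (hR h1)
  · by_cases hi : i < N
    · simp [State.fill_arr, h.var_zero, hi, deadTerm, levTwo, levTerm, h.dead, hL]
    · simp [State.fill_arr, h.var_zero, hi]
  · rw [Finset.mem_filter]
    obtain ⟨h1, -, h2 | ⟨v, -, h3, -⟩⟩ := hij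
    · exact ⟨h.mem _ _ h2, h1⟩
    · exact ⟨h.mem _ _ h3, h1⟩

end GridContraction

/-! ### Correctness of the program -/

namespace GridContraction

open RAM

/-- `G'` on `S'` is equivalent to `G` on `S`, as an instance with the parameter `k`. -/
def Equivalent (k : ℕ) (G : SimpleGraph ℕ) (S : Finset ℕ) (G' : SimpleGraph ℕ) (S' : Finset ℕ) :
    Prop :=
  Contractible (G'.induce (S' : Set ℕ)) k ↔ Contractible (G.induce (S : Set ℕ)) k

lemma run_tryCmd {s : State} {N k : ℕ} {G : SimpleGraph ℕ} {S : Finset ℕ}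
    (h : Encodes s N k G S) (ha : s.var 4 < N) (hb : s.var 5 < N) :
    ∃ G' S', Encodes (tryCmd.run s) N k G' S' ∧ Equivalent k G S G' S' ∧
      (S'.card < S.card ∧ Detects G N (6 * k + 4) (s.var 4) (s.var 5) ∨
        G' = G ∧ S' = S ∧ ¬ Detects G N (6 * k + 4) (s.var 4) (s.var 5)) := by
  obtain ⟨h1, h4, h5, hT⟩ := run_oppositeCmd h ha hb
  obtain ⟨h2, h4', h5', hL⟩ := run_levelsCmd h1 ha hb hT
  have e4 : (levelsCmd.run (oppositeCmd.run s)).var 4 = s.var 4 := h4'.trans h4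
  have hdet := detectTerm_tru (b := s.var 5) h2 (by rw [e4]; exact ha) hb (by rw [e4]; exact hL)
  rw [e4] at hdet
  rw [tryCmd, Cmd.run, Cmd.run, Cmd.run]
  change ∃ G' S', Encodes (if detectTerm.Tru _ then _ else _) _ _ _ _ ∧ _
  by_cases hd : Detects G N (6 * k + 4) (s.var 4) (s.var 5)
  · rw [if_pos (hdet.2 hd)]
    obtain ⟨h3, -⟩ := run_removeCmd h2 hL
    refine ⟨_, _, h3, ?_, Or.inl ⟨?_, hd⟩⟩
    · have := hd.contractible_iff (k := k) S.finite_toSet h.mem le_rfl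
      rw [Equivalent, Finset.coe_filter]
      exact this
    -- The start vertex has level `1`, and `up` gives it a neighbour in level `2`, which disappears.
    · apply Finset.card_lt_card
      rw [Finset.filter_ssubset]
      obtain ⟨w, hw, hw2⟩ := hd.isSlab.up (s.var 4) (by rw [searchLevels_self])
        (by rw [searchLevels_self]; omega)
      rw [searchLevels_self] at hw2
      exact ⟨w, h.mem _ _ hw.symm, by simp [hw2]⟩
  · rw [if_neg (fun h6 => hd (hdet.1 h6))]
    exact ⟨G, S, h2, Iff.rfl, Or.inr ⟨rfl, rfl, hd⟩⟩

/-- Until the first success the graph is unchanged, so that success is a detection in the initial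
graph `G`; without a success all tests concern `G`. This dichotomy allows a later argument by the
number of rounds. -/
lemma run_rep_tryCmd {s : State} {N k : ℕ} {G : SimpleGraph ℕ} {S : Finset ℕ}
    (h : Encodes s N k G S) (ha : s.var 4 < N) :
    ∃ G' S', Encodes ((Cmd.rep 5 tryCmd).run s) N k G' S' ∧ Equivalent k G S G' S' ∧
      (S'.card < S.card ∧ (∃ b < N, Detects G N (6 * k + 4) (s.var 4) b) ∨
        G' = G ∧ S' = S ∧ ∀ b < N, ¬ Detects G N (6 * k + 4) (s.var 4) b) := by
  refine (Cmd.run_rep_induction (x := 5) (c := tryCmd) h.var_zero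
    (fun j s' => s'.var 4 = s.var 4 ∧ ∃ G' S', Encodes s' N k G' S' ∧ Equivalent k G S G' S' ∧
      (S'.card < S.card ∧ (∃ b < N, Detects G N (6 * k + 4) (s.var 4) b) ∨
        G' = G ∧ S' = S ∧ ∀ b < j, ¬ Detects G N (6 * k + 4) (s.var 4) b)) ?_ ?_ ?_).2
  · exact ⟨rfl, G, S, h, Iff.rfl, Or.inr ⟨rfl, rfl, by simp⟩⟩
  · rintro j s' z ⟨h1, G', S', h2, h3⟩
    exact ⟨by simp [h1], G', S', h2.setVar z (by decide) (by decide), h3⟩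
  · rintro j hj s' ⟨h1, G', S', h2, h3, h4⟩ h5
    refine ⟨?_, ?_⟩
    · rw [Cmd.Keeps.run, h1]
      simp [tryCmd, oppositeCmd, levelsCmd, removeCmd, Cmd.Keeps, Cmd.fill]
    · obtain ⟨G'', S'', h6, h7, h8⟩ := run_tryCmd h2 (by omega) (by omega)
      refine ⟨G'', S'', h6, h7.trans h3, ?_⟩
      rw [h1, h5] at h8
      rcases h4 with ⟨h4, hd⟩ | ⟨rfl, rfl, hd⟩
      · left
        refine ⟨?_, hd⟩
        rcases h8 with ⟨h8, -⟩ | ⟨-, rfl, -⟩ <;> omega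
      · rcases h8 with ⟨h8, hd'⟩ | ⟨rfl, rfl, hd'⟩
        · exact Or.inl ⟨h8, j, hj, hd'⟩
        · refine Or.inr ⟨rfl, rfl, fun b hb => ?_⟩
          rcases Nat.lt_succ_iff_lt_or_eq.1 hb with hb | rfl
          · exact hd b hb
          · exact hd'

lemma run_rep_rep_tryCmd {s : State} {N k : ℕ} {G : SimpleGraph ℕ} {S : Finset ℕ}
    (h : Encodes s N k G S) :
    ∃ G' S', Encodes ((Cmd.rep 4 (.rep 5 tryCmd)).run s) N k G' S' ∧ Equivalent k G S G' S' ∧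
      (S'.card < S.card ∧ (∃ a < N, ∃ b < N, Detects G N (6 * k + 4) a b) ∨
        G' = G ∧ S' = S ∧ ∀ a < N, ∀ b < N, ¬ Detects G N (6 * k + 4) a b) := by
  refine Cmd.run_rep_induction (x := 4) (c := .rep 5 tryCmd) h.var_zero
    (fun i s' => ∃ G' S', Encodes s' N k G' S' ∧ Equivalent k G S G' S' ∧
      (S'.card < S.card ∧ (∃ a < N, ∃ b < N, Detects G N (6 * k + 4) a b) ∨
        G' = G ∧ S' = S ∧ ∀ a < i, ∀ b < N, ¬ Detects G N (6 * k + 4) a b)) ?_ ?_ ?_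
  · exact ⟨G, S, h, Iff.rfl, Or.inr ⟨rfl, rfl, by simp⟩⟩
  · rintro i s' z ⟨G', S', h2, h3⟩
    exact ⟨G', S', h2.setVar z (by decide) (by decide), h3⟩
  · rintro i hi s' ⟨G', S', h2, h3, h4⟩ h5
    obtain ⟨G'', S'', h6, h7, h8⟩ := run_rep_tryCmd h2 (by omega)
    refine ⟨G'', S'', h6, h7.trans h3, ?_⟩
    rw [h5] at h8
    rcases h4 with ⟨h4, hd⟩ | ⟨rfl, rfl, hd⟩
    · left
      refine ⟨?_, hd⟩
      rcases h8 with ⟨h8, -⟩ | ⟨-, rfl, -⟩ <;> omega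
    · rcases h8 with ⟨h8, hd'⟩ | ⟨rfl, rfl, hd'⟩
      · exact Or.inl ⟨h8, i, hi, hd'⟩
      · refine Or.inr ⟨rfl, rfl, fun a ha => ?_⟩
        rcases Nat.lt_succ_iff_lt_or_eq.1 ha with ha | rfl
        · exact hd a ha
        · exact hd'

/-- Every round that still finds something removes a vertex, and a round that finds nothing changes
nothing. After `N` rounds either no vertex is left or nothing is detected any more. -/
lemma run_reductions {s : State} {N k : ℕ} {G : SimpleGraph ℕ} {S : Finset ℕ}
    (h : Encodes s N k G S) :
    ∃ G' S', Encodes ((Cmd.rep 12 (.rep 4 (.rep 5 tryCmd))).run s) N k G' S' ∧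
      Equivalent k G S G' S' ∧ ∀ a ∈ S', ∀ b ∈ S', ¬ Detects G' N (6 * k + 4) a b := by
  have hcard : ∀ {s' G' S'}, Encodes s' N k G' S' → S'.card ≤ N := fun h => by
    simpa using Finset.card_le_card (fun i hi => Finset.mem_range.2 (h.lt i hi))
  obtain ⟨G', S', h1, h2, h3⟩ := Cmd.run_rep_induction (x := 12) (c := .rep 4 (.rep 5 tryCmd))
    h.var_zero
    (fun t s' => ∃ G' S', Encodes s' N k G' S' ∧ Equivalent k G S G' S' ∧
      (S'.card + t ≤ N ∨ ∀ a < N, ∀ b < N, ¬ Detects G' N (6 * k + 4) a b))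
    ⟨G, S, h, Iff.rfl, Or.inl (hcard h)⟩
    (fun t s' z ⟨G', S', h2, h3⟩ => ⟨G', S', h2.setVar z (by decide) (by decide), h3⟩)
    (by
      rintro t ht s' ⟨G', S', h2, h3, h4⟩ -
      obtain ⟨G'', S'', h6, h7, h8⟩ := run_rep_rep_tryCmd h2
      refine ⟨G'', S'', h6, h7.trans h3, ?_⟩
      rcases h8 with ⟨h8, a, ha, b, hb, hd⟩ | ⟨rfl, rfl, hd⟩
      · rcases h4 with h4 | h4
        · left; omega
        · exact absurd hd (h4 a ha b hb)
      · exact Or.inr hd)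
  refine ⟨G', S', h1, h2, fun a ha b hb => ?_⟩
  rcases h3 with h3 | h3
  · have : S' = ∅ := Finset.card_eq_zero.1 (by omega)
    simp [this] at ha
  · exact h3 a (h1.lt a ha) b (h1.lt b hb)

/-! ### Renumbering the remaining vertices and the size test -/

/-- The number of elements of `S` which are less than `u`. -/
def rank (S : Finset ℕ) (u : ℕ) : ℕ := (S.filter (· < u)).card

lemma rank_lt {S : Finset ℕ} {u : ℕ} (hu : u ∈ S) : rank S u < S.card :=
  Finset.card_lt_card (Finset.filter_ssubset.2 ⟨u, hu, lt_irrefl u⟩)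

lemma rank_lt_rank {S : Finset ℕ} {u v : ℕ} (hu : u ∈ S) (h : u < v) : rank S u < rank S v := by
  apply Finset.card_lt_card
  refine ⟨fun x hx => ?_, fun hsub => ?_⟩
  · rw [Finset.mem_filter] at hx ⊢
    exact ⟨hx.1, hx.2.trans h⟩
  · have := hsub (Finset.mem_filter.2 ⟨hu, h⟩)
    exact lt_irrefl u (Finset.mem_filter.1 this).2

lemma rank_inj {S : Finset ℕ} {u v : ℕ} (hu : u ∈ S) (hv : v ∈ S) (h : rank S u = rank S v) :
    u = v := by
  rcases lt_trichotomy u v with h1 | h1 | h1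
  · have := rank_lt_rank hu h1; omega
  · exact h1
  · have := rank_lt_rank hv h1; omega

/-- The graph `G` on `S`, with the vertices renumbered. -/
def renumber (G : SimpleGraph ℕ) (S : Finset ℕ) : SimpleGraph (Fin S.card) where
  Adj i j := ∃ u ∈ S, ∃ v ∈ S, rank S u = i ∧ rank S v = j ∧ G.Adj u v
  symm := ⟨fun _ _ ⟨u, hu, v, hv, h1, h2, h3⟩ => ⟨v, hv, u, hu, h2, h1, h3.symm⟩⟩
  loopless := ⟨fun _ ⟨_, hu, _, hv, h1, h2, h3⟩ => h3.ne (rank_inj hu hv (h1.trans h2.symm))⟩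

lemma nonempty_iso_renumber (G : SimpleGraph ℕ) (S : Finset ℕ) :
    Nonempty (G.induce (S : Set ℕ) ≃g renumber G S) := by
  let f : ↥(S : Set ℕ) → Fin S.card := fun u => ⟨rank S u, rank_lt u.2⟩
  have hf : Function.Injective f := fun u v huv =>
    Subtype.ext (rank_inj u.2 v.2 (congrArg Fin.val huv))
  have hb : Function.Bijective f :=
    (Fintype.bijective_iff_injective_and_card f).2 ⟨hf, by simp⟩
  refine ⟨⟨Equiv.ofBijective f hb, ?_⟩⟩
  rintro ⟨u, hu⟩ ⟨v, hv⟩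
  constructor
  · rintro ⟨u', hu', v', hv', h1, h2, h3⟩
    obtain rfl := rank_inj hu' hu h1
    obtain rfl := rank_inj hv' hv h2
    exact h3
  · intro h
    exact ⟨u, hu, v, hv, rfl, rfl, h⟩

/-- The bound on the size of the kernel which the program computes. -/
def sizeBound (N k : ℕ) : ℕ := 2891 * (min k N ^ 4 + 1)

/-- Multiplication is replaced by a sum over the `i < N` with `i < k`. Since `k` is given in binary
and may exceed `N`, only `min k N` is available as a factor. -/
lemma eval_mulMinTerm {s : State} {N k x c : ℕ} {e : Term} (h0 : s.var 0 = N) (h1 : s.var 1 = k)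
    (hx : x ≠ 1) (he : ∀ i, e.eval (s.setVar x i) = c) :
    (mulMinTerm x e).eval s = min k N * c := by
  have hcard : ((Finset.range N).filter (· < k)).card = min k N := by
    rw [show (Finset.range N).filter (· < k) = Finset.range (min k N) by
      ext i; simp; tauto]
    simp
  rw [← hcard, ← smul_eq_mul, ← Finset.sum_const, Finset.sum_filter]
  simp only [mulMinTerm, Term.eval_sum, h0]
  refine Finset.sum_congr rfl fun i _ => ?_
  rw [Term.eval_ite, he]
  exact if_congr (by simp [hx.symm, h1]) rfl rfl

lemma eval_boundTerm {s : State} {N k : ℕ} (h0 : s.var 0 = N) (h1 : s.var 1 = k) :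
    boundTerm.eval s = sizeBound N k := by
  rw [boundTerm, Term.eval_add, eval_mulMinTerm (c := min k N * (min k N * (min k N * 2891))) h0 h1
    (by decide)]
  · simp only [sizeBound, Term.eval_const]
    ring
  intro i
  refine eval_mulMinTerm (by simp [h0]) (by simp [h1]) (by decide) fun i => ?_
  refine eval_mulMinTerm (by simp [h0]) (by simp [h1]) (by decide) fun i => ?_
  refine eval_mulMinTerm (by simp [h0]) (by simp [h1]) (by decide) fun i => rfl

lemma Encodes.not_dead_iff {s : State} {N k : ℕ} {G : SimpleGraph ℕ} {S : Finset ℕ}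
    (h : Encodes s N k G S) {i : ℕ} (hi : i < N) : s.arr 1 i i = 0 ↔ i ∈ S := by
  have := h.dead i
  tauto

lemma eval_rankTerm {s : State} {N k : ℕ} {G : SimpleGraph ℕ} {S : Finset ℕ}
    (h : Encodes s N k G S) {x : ℕ} (hx : x ≠ 8) :
    (rankTerm x).eval s = rank S (s.var x) := by
  have : S.filter (· < s.var x) = (Finset.range N).filter fun i => i < s.var x ∧ i ∈ S := by
    ext i
    simp only [Finset.mem_filter, Finset.mem_range]
    exact ⟨fun ⟨h1, h2⟩ => ⟨h.lt i h1, h2, h1⟩, fun ⟨_, h2, h1⟩ => ⟨h1, h2⟩⟩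
  rw [rank, this, Finset.card_filter]
  simp only [rankTerm, Term.eval_sum, h.var_zero]
  refine Finset.sum_congr rfl fun i hi => ?_
  rw [Term.eval_ind]
  refine if_congr ?_ rfl rfl
  simp [hx, deadTerm, h.not_dead_iff (Finset.mem_range.1 hi)]

/-- Twice the number of edges. -/
noncomputable def adjSum {n : ℕ} (G : SimpleGraph (Fin n)) : ℕ :=
  open Classical in ∑ i, ∑ j, if G.Adj i j then 1 else 0

lemma Encodes.sum_eq {s : State} {N k : ℕ} {G : SimpleGraph ℕ} {S : Finset ℕ}
    (h : Encodes s N k G S) :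
    ∑ i ∈ Finset.range N, ∑ j ∈ Finset.range N, s.arr 0 i j = adjSum (renumber G S) := by
  classical
  have hsub : S ⊆ Finset.range N := fun i hi => Finset.mem_range.2 (h.lt i hi)
  have harr : ∀ i j, s.arr 0 i j = if G.Adj i j then 1 else 0 := by
    intro i j
    rcases h.adj i j with ⟨h1, h2⟩ | ⟨h1, h2⟩ <;> simp [h1, h2]
  obtain ⟨e⟩ := nonempty_iso_renumber G S
  have h1 : adjSum (renumber G S) = ∑ u : S, ∑ v : S, if G.Adj u v then 1 else 0 := by
    rw [adjSum, ← e.toEquiv.sum_comp]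
    refine Finset.sum_congr rfl fun u _ => ?_
    rw [← e.toEquiv.sum_comp]
    refine Finset.sum_congr rfl fun v _ => ?_
    exact if_congr e.map_adj_iff rfl rfl
  rw [h1, Finset.sum_coe_sort S fun u => ∑ v : S, if G.Adj u v then 1 else 0]
  simp only [harr]
  rw [← Finset.sum_subset hsub]
  · refine Finset.sum_congr rfl fun u _ => ?_
    rw [Finset.sum_coe_sort S fun v => if G.Adj u v then 1 else 0, ← Finset.sum_subset hsub]
    intro v _ hv
    rw [if_neg fun h2 => hv (h.mem _ _ h2.symm)]
  · intro u _ hu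
    exact Finset.sum_eq_zero fun v _ => if_neg fun h2 => hu (h.mem _ _ h2)

-- The new number of vertices is kept in variable `20`, because variable `0` still bounds the
-- remaining loops.
open Classical in
lemma run_outputCmd {s : State} {N k : ℕ} {G : SimpleGraph ℕ} {S : Finset ℕ}
    (h : Encodes s N k G S) :
    (outputCmd.run s).var 1 = k ∧ (outputCmd.run s).var 20 = S.card ∧
      ((outputCmd.run s).var 21 ≠ 0 ↔
        S.card ≤ sizeBound N k ∧ adjSum (renumber G S) ≤ sizeBound N k) ∧
      ∀ i j : Fin S.card, (outputCmd.run s).arr 0 i j = if (renumber G S).Adj i j then 1 else 0 := by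
  have hcard : (Term.sum 6 (.ind (.neg (deadTerm 6)))).eval s = S.card := by
    have : S = (Finset.range N).filter (· ∈ S) := by
      ext i
      simp only [Finset.mem_filter, Finset.mem_range]
      exact ⟨fun h1 => ⟨h.lt i h1, h1⟩, fun h1 => h1.2⟩
    rw [this, Finset.card_filter, Term.eval_sum, h.var_zero]
    refine Finset.sum_congr rfl fun i hi => ?_
    rw [Term.eval_ind]
    refine if_congr ?_ rfl rfl
    simp [deadTerm, h.not_dead_iff (Finset.mem_range.1 hi)]
  have h1 := h.setVar (x := 20) S.card (by decide) (by decide)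
  have hflag : (Term.and (.le (.var 20) boundTerm) (.le (.sum 6 (.sum 7 (adjTerm 6 7))) boundTerm)).Tru
      (s.setVar 20 S.card) ↔ S.card ≤ sizeBound N k ∧ adjSum (renumber G S) ≤ sizeBound N k := by
    rw [← h.sum_eq]
    simp [eval_boundTerm h1.var_zero h1.var_one, adjTerm, h.var_zero]
  set z := (Term.ind (.and (.le (.var 20) boundTerm)
    (.le (.sum 6 (.sum 7 (adjTerm 6 7))) boundTerm))).eval (s.setVar 20 S.card) with hz
  have h2 := h1.setVar (x := 21) z (by decide) (by decide)
  rw [outputCmd, Cmd.run, Cmd.run, hcard, Cmd.run, Cmd.run, ← hz, Cmd.run, Cmd.run_fill (by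
    simp [Term.Avoids, Term.ind, Term.neg, Term.and, Term.ex, Term.eq, Term.le, Term.lt,
      renumberTerm, deadTerm, rankTerm, adjTerm]) h2.bounded,
    Cmd.run_fill (by simp [Term.Avoids]) (h2.bounded.fill _ _)]
  refine ⟨by simp [h.var_one], by simp, ?_, fun i j => ?_⟩
  · rw [← hflag]
    simp [hz]
  · have hSN : S.card ≤ N := by
      simpa using Finset.card_le_card (fun i hi => Finset.mem_range.2 (h.lt i hi))
    have hi : (i : ℕ) < N := by omega
    have hj : (j : ℕ) < N := by omega
    have e0 : ((s.setVar 20 S.card).setVar 21 z).var 0 = N := h2.var_zero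
    simp only [State.fill_arr, if_true, State.fill_var, e0, hi, hj, and_self, Term.eval_read,
      Term.eval_var, State.setVar_var, State.setVar_arr, Nat.reduceEqDiff, if_false, Term.eval_ind]
    refine if_congr ?_ rfl rfl
    have h3 := (h2.setVar (x := 2) i (by decide) (by decide)).setVar (x := 3) j (by decide)
      (by decide)
    rw [renumberTerm, Term.tru_ex, h3.var_zero]
    simp only [renumber]
    have hiff : ∀ u < N, ∀ v < N,
        ((Term.and (.neg (deadTerm 6)) (.and (.neg (deadTerm 7)) (.and (.eq (rankTerm 6) (.var 2))
          (.and (.eq (rankTerm 7) (.var 3)) (adjTerm 6 7))))).Tru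
        ((((((s.setVar 20 S.card).setVar 21 z).setVar 2 i).setVar 3 j).setVar 6 u).setVar 7 v) ↔
        u ∈ S ∧ v ∈ S ∧ rank S u = i ∧ rank S v = j ∧ G.Adj u v) := by
      intro u hu v hv
      have h4 := (h3.setVar (x := 6) u (by decide) (by decide)).setVar (x := 7) v (by decide)
        (by decide)
      simp [deadTerm, adjTerm, h.not_dead_iff hu, h.not_dead_iff hv, eval_rankTerm h4, h.adj_iff]
    constructor
    · rintro ⟨u, hu, h4⟩
      rw [Term.tru_ex] at h4
      obtain ⟨v, hv, h4⟩ := h4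
      obtain ⟨h5, h6, h7⟩ := (hiff u hu v (by simpa [h.var_zero] using hv)).1 h4
      exact ⟨u, h5, v, h6, h7⟩
    · rintro ⟨u, hu, v, hv, h4⟩
      refine ⟨u, h.lt u hu, ?_⟩
      rw [Term.tru_ex]
      exact ⟨v, by simpa [h.var_zero] using h.lt v hv,
        (hiff u (h.lt u hu) v (h.lt v hv)).2 ⟨hu, hv, h4⟩⟩

end GridContraction

/-! ### The kernel -/

namespace GridContraction

open RAM

/-- The graph of an instance, with isolated vertices added. -/
def Inst.extend (I : Inst) : SimpleGraph ℕ where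
  Adj i j := ∃ (hi : i < I.n) (hj : j < I.n), I.graph.Adj ⟨i, hi⟩ ⟨j, hj⟩
  symm := ⟨fun _ _ ⟨hi, hj, h⟩ => ⟨hj, hi, h.symm⟩⟩
  loopless := ⟨fun _ ⟨_, _, h⟩ => h.ne rfl⟩

lemma Inst.encodes_toState (I : Inst) :
    Encodes I.toState I.n I.k I.extend (Finset.range I.n) := by
  refine ⟨by simp [Inst.toState], by simp [Inst.toState], ?_, ?_, ?_, ?_, ?_⟩
  · intro a i j hij
    simp only [Inst.toState, if_true] at hij ⊢
    exact if_neg fun ⟨_, hi, hj, _⟩ => hij ⟨hi, hj⟩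
  · intro i j
    by_cases h : I.extend.Adj i j
    · exact Or.inl ⟨if_pos ⟨rfl, h⟩, h⟩
    · exact Or.inr ⟨if_neg fun h1 => h h1.2, h⟩
  · intro i
    simp [Inst.toState]
  · rintro i j ⟨hi, -, -⟩
    exact Finset.mem_range.2 hi
  · intro i hi
    exact Finset.mem_range.1 hi

lemma Inst.contractible_extend (I : Inst) :
    Contractible (I.extend.induce (Finset.range I.n : Set ℕ)) I.k ↔ I.IsYes := by
  obtain ⟨e⟩ := nonempty_iso_induce (H := I.graph) (G := I.extend)
    (S := (Finset.range I.n : Set ℕ)) (fun i : Fin I.n => (i : ℕ)) Fin.val_injective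
    (by ext i; simp) (fun a b => ⟨fun ⟨_, _, h⟩ => h, fun h => ⟨a.2, b.2, h⟩⟩)
  rw [I.isYes_iff, contractible_congr e]

/-- A trivial no-instance. -/
def noInst : Inst := ⟨0, ⊥, 0⟩

lemma not_isYes_noInst : ¬ noInst.IsYes := by
  rw [Inst.isYes_iff]
  rintro ⟨r, q, X, Y, hr, hq, h, -⟩
  obtain ⟨u, -⟩ := h.edgeX 0 0 (by omega) (by omega)
  exact Fin.elim0 u

lemma adjSum_le {n : ℕ} (G : SimpleGraph (Fin n)) : adjSum G ≤ n * n := by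
  classical
  calc adjSum G ≤ ∑ _i : Fin n, ∑ _j : Fin n, 1 :=
        Finset.sum_le_sum fun i _ => Finset.sum_le_sum fun j _ => by split_ifs <;> simp
    _ = n * n := by simp

lemma ncard_edgeSet_le_adjSum {n : ℕ} (G : SimpleGraph (Fin n)) : G.edgeSet.ncard ≤ adjSum G := by
  classical
  have h1 : adjSum G = ∑ i, G.degree i := by
    refine Finset.sum_congr rfl fun i _ => ?_
    rw [← Finset.card_filter, ← SimpleGraph.card_neighborFinset_eq_degree,
      SimpleGraph.neighborFinset_eq_filter]
  rw [h1, G.sum_degrees_eq_twice_card_edges, ← SimpleGraph.coe_edgeFinset, Set.ncard_coe_finset]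
  omega

/-- Convexity of the fourth power, with factor `2³`. -/
lemma add_one_pow_four_le (k : ℕ) : (k + 1) ^ 4 ≤ 8 * (k ^ 4 + 1) := by
  have := add_pow_le (Nat.zero_le k) (Nat.zero_le 1) 4
  norm_num at this
  exact this

/-- For `k ≤ N`, `n ≤ 36(k + 1)⁴ + k ≤ 289(k⁴ + 1)`, and `5n + k(5 + k)` is at most `1451(k⁴ + 1)`,
so `2891` leaves room. For `k ≥ N` the trivial bounds `n ≤ N` and `n² ≤ N⁴` suffice, which is why
`min k N` does no harm. -/
lemma le_sizeBound_of_contractible {N k n : ℕ} {G : SimpleGraph (Fin n)} (h : Contractible G k)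
    (hn : n ≤ N) (hsmall : n ≤ ((k + 1) * (6 * k + 4 + 2)) ^ 2 + k) :
    n ≤ sizeBound N k ∧ adjSum G ≤ sizeBound N k := by
  have hpow : ∀ m : ℕ, m ≤ m ^ 4 ∧ m * m ≤ m ^ 4 := by
    intro m
    rcases Nat.eq_zero_or_pos m with rfl | hm
    · simp
    · exact ⟨by simpa using Nat.pow_le_pow_right hm (show 1 ≤ 4 by norm_num),
        by simpa [sq] using Nat.pow_le_pow_right hm (show 2 ≤ 4 by norm_num)⟩
  rcases le_total k N with hk | hk
  · rw [sizeBound, min_eq_left hk]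
    have h1 := add_one_pow_four_le k
    have h2 : ((k + 1) * (6 * k + 4 + 2)) ^ 2 = 36 * (k + 1) ^ 4 := by ring
    have h3 := hpow k
    have h4 : adjSum G ≤ 5 * n + k * (5 + k) := by
      have := h.sum_adj_le
      rwa [Fintype.card_fin] at this
    have h5 : k * (5 + k) = 5 * k + k * k := by ring
    omega
  · rw [sizeBound, min_eq_right hk]
    have h1 := hpow N
    have h2 := adjSum_le G
    have h3 : n * n ≤ N * N := Nat.mul_le_mul hn hn
    omega

lemma sizeBound_le (N k : ℕ) : sizeBound N k ≤ 2891 * (k ^ 4 + 1) := by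
  have : min k N ^ 4 ≤ k ^ 4 := Nat.pow_le_pow_left (min_le_left k N) 4
  rw [sizeBound]
  omega

/-- The program computes an equivalent small instance. -/
lemma exists_exec_kernelProg (I : Inst) : ∃ (J : Inst) (t : ℕ) (s : State),
    Exec kernelProg I.toState t s ∧ J.IsOutput s ∧ t ≤ (mainCmd.time + 20).eval I.n ∧
      (J.IsYes ↔ I.IsYes) ∧ J.k ≤ I.k ∧ J.n ≤ sizeBound I.n I.k ∧
      adjSum J.graph ≤ sizeBound I.n I.k := by
  classical
  obtain ⟨G, S, h1, h2, h3⟩ := run_reductions I.encodes_toState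
  obtain ⟨o1, o20, o21, o0⟩ := run_outputCmd h1
  change (mainCmd.run I.toState).var 1 = _ at o1
  change (mainCmd.run I.toState).var 20 = _ at o20
  change (mainCmd.run I.toState).var 21 ≠ 0 ↔ _ at o21
  change ∀ i j : Fin S.card, (mainCmd.run I.toState).arr 0 i j = _ at o0
  obtain ⟨t, s, e1, ⟨ha, hv⟩, -, ht⟩ := mainCmd.exec_compile (D := 30) (by norm_num) mainCmd_wf 30
    le_rfl I.toState I.toState ⟨rfl, fun _ _ => rfl⟩
  rw [I.encodes_toState.var_zero] at ht
  obtain ⟨e⟩ := nonempty_iso_renumber G S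
  have hyes : Contractible (renumber G S) I.k ↔ I.IsYes := by
    rw [← contractible_congr e, ← I.contractible_extend]
    exact h2
  have hSN : S.card ≤ I.n := by
    simpa using Finset.card_le_card (fun i hi => Finset.mem_range.2 (h1.lt i hi))
  have ht' : (mainCmd.time + 20).eval I.n = mainCmd.time.eval I.n + 20 := by simp
  rw [ht']
  by_cases hflag : (mainCmd.run I.toState).var 21 ≠ 0
  · obtain ⟨b1, b2⟩ := o21.1 hflag
    refine ⟨⟨S.card, renumber G S, I.k⟩, _, _, .seq e1 (.ite_true ?_ (.assign _ _ _)), ?_, ?_, ?_,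
      le_rfl, b1, b2⟩
    · simpa [Expr.eval, hv 21] using hflag
    · refine ⟨?_, ?_, fun i j => ?_⟩
      · simp [Expr.eval, hv 20, o20]
      · simp [hv 1, o1]
      · rw [State.setVar_arr, ha, o0]
    · simp only [Expr.cost]
      omega
    · rw [Inst.isYes_iff]
      exact hyes
  · refine ⟨noInst, _, _, .seq e1 (.ite_false ?_ (.seq (.assign _ _ _) (.assign _ _ _))), ?_, ?_,
      ?_, Nat.zero_le _, Nat.zero_le _, ?_⟩
    · simpa [Expr.eval, hv 21] using hflag
    · exact ⟨by simp [Expr.eval, noInst], by simp [Expr.eval, noInst], fun i => Fin.elim0 i⟩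
    · simp only [Expr.cost]
      omega
    -- A yes-instance on which nothing is detected would pass the size test; failing it proves a
    -- no-instance.
    · refine iff_of_false not_isYes_noInst fun hI => hflag (o21.2 ?_)
      have hc := hyes.2 hI
      refine le_sizeBound_of_contractible hc hSN ?_
      exact card_le_of_not_detects h1.mem (by omega) hSN ((contractible_congr e I.k).2 hc) h3
    · exact (adjSum_le _).trans (Nat.zero_le _)

end GridContraction

theorem theorem6 :
    ∃ f : GridContraction.Inst → GridContraction.Inst,
      GridContraction.IsKernelization f ∧
      ∃ C : ℕ, ∀ I : GridContraction.Inst,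
        (f I).n ≤ C * (I.k ^ 4 + 1) ∧
        (f I).graph.edgeSet.ncard ≤ C * (I.k ^ 4 + 1) := by
  choose f t s h1 h2 h3 h4 h5 h6 h7 using GridContraction.exists_exec_kernelProg
  -- The running time is bounded in terms of `n`, and `n ≤ n² ≤ I.size`.
  have hmono : ∀ (p : Polynomial ℕ) (a b : ℕ), a ≤ b → p.eval a ≤ p.eval b := by
    intro p a b hab
    rw [Polynomial.eval_eq_sum, Polynomial.eval_eq_sum]
    exact Finset.sum_le_sum fun i _ => Nat.mul_le_mul_left _ (Nat.pow_le_pow_left hab i)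
  refine ⟨f, ⟨⟨_, _, fun I => ⟨t I, s I, h1 I, h2 I, (h3 I).trans (hmono _ _ _ ?_)⟩⟩, h4, h5⟩,
    2891, fun I => ⟨(h6 I).trans (GridContraction.sizeBound_le _ _),
      (GridContraction.ncard_edgeSet_le_adjSum _).trans
        ((h7 I).trans (GridContraction.sizeBound_le _ _))⟩⟩
  exact (Nat.le_mul_self I.n).trans (Nat.le_add_right _ _)
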